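/- Let $V$ be a finite set of cities and let $c$ be a metric length function on the edges of the complete graph on $V$, i.e. $c(\{u,v\})\ge 0$ for all distinct $u,v\in V$, and $c(\{u,w\})\le c(\{u,v\})+c(\{v,w\})$ for all distinct $u,v,w\in V$. A tour is a cycle in the complete graph that visits each city exactly once; its length is the sum of the lengths of its edges. The Clarke–Wright savings heuristic selects a city $x$ and connects each other city to $x$ by two parallel edges. The savings of a pair $\{a,b\}$ of cities different from $x$ are $c(\{a,x\})+c(\{b,x\})-c(\{a,b\})$. The heuristic goes once through all these pairs in nonincreasing order of savings. It replaces one copy of each of the edges $\{a,x\}$ and $\{b,x\}$ by the edge $\{a,b\}$ whenever this closes no cycle on the cities different from $x$ and neither $a$ nor $b$ becomes adjacent to more than two other cities. The city $x$ and the order of pairs with equal savings are arbitrary. The approximation ratio $\rho(n)$ of the heuristic is the least real number $r$ such that, for every metric instance with $n$ cities, every choice of $x$ and every admissible order of the pairs, the result is a tour that is at most $r$ times as long as a shortest tour. **Theorem 3.** For every $n\ge 3$ the number $\rho(n)$ exists, and $$\rho(n)=\Theta(\log n)\qquad (n\to\infty).$$ Moreover, $\rho(n)>\tfrac19\log_3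 n$ for every $n=3^{k+2}$, $k\ge 0$. This bound is witnessed by the following metric instance with $n=3^{k+2}$ cities. Take the points of the $2\times\frac12(3^{k+2}-1)$ grid, with the distance of two points being their distance in the graph that joins grid points at distance $1$. Add one further city $x$ at distance $\frac12\cdot 3^{k+2}$ from every grid point. Started with the city $x$ on this instance, the heuristic can output a tour that is more than $\tfrac19\log_3 n$ times as long as a shortest tour. -/

import Mathlib

open Asymptotics Filter

namespace SavingsTSP

/-- `c` is a metric length function on the edges of the complete graph with vertex set `V`.
Edges are unordered pairs; the value of `c` at a degenerate pair `s(v, v)`, which is not an edge,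
is fixed to be `0`. Distinct cities may have distance `0`. -/
structure IsMetric {V : Type*} (c : Sym2 V → ℝ) : Prop where
  nonneg : ∀ e, 0 ≤ c e
  self_zero : ∀ v, c s(v, v) = 0
  triangle : ∀ x y z, c s(x, z) ≤ c s(x, y) + c s(y, z)

/-- The total length of a multiset of edges. -/
def length {V : Type*} (c : Sym2 V → ℝ) (T : Multiset (Sym2 V)) : ℝ :=
  (T.map c).sum

/-- `T` is the collection of edges of a tour: a cycle in the complete graph on `V` that visits
each vertex exactly once. -/
def IsTour {V : Type*} [DecidableEq V] (T : Multiset (Sym2 V)) : Prop :=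
  ∃ (v : V) (p : (⊤ : SimpleGraph V).Walk v v),
    p.IsHamiltonianCycle ∧ T = (p.edges : Multiset (Sym2 V))

/-- `S` is a tour of minimum length. -/
def IsShortestTour {V : Type*} [DecidableEq V] (c : Sym2 V → ℝ) (S : Multiset (Sym2 V)) : Prop :=
  IsTour S ∧ ∀ T, IsTour T → length c S ≤ length c T

/-! ### The Clarke-Wright savings heuristic -/

/-- The two edges `{a, x}` and `{b, x}`, for a pair `e = {a, b}`. -/
def spokes {V : Type*} (x : V) (e : Sym2 V) : Multiset (Sym2 V) :=
  e.toMultiset.map fun a => s(a, x)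

/-- The savings of the pair `e = {a, b}`: the amount `c {a, x} + c {b, x} - c {a, b}`. -/
def savings {V : Type*} (c : Sym2 V → ℝ) (x : V) (e : Sym2 V) : ℝ :=
  length c (spokes x e) - c e

/-- The initial Eulerian tour: each city other than `x` is connected to `x` by two parallel
edges. -/
def start {V : Type*} [Fintype V] [DecidableEq V] (x : V) : Multiset (Sym2 V) :=
  ∑ v ∈ Finset.univ.erase x, {s(v, x), s(v, x)}

/-- The graph formed by the edges of `E` that are not incident to `x`. -/
def awayFrom {V : Type*} (x : V) (E : Multiset (Sym2 V)) : SimpleGraph V :=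
  SimpleGraph.fromEdgeSet {e | e ∈ E ∧ x ∉ e}

/-- The pair `e = {a, b}` may be short-cut: `a` and `b` are not yet connected away from `x`
(so `{a, b}` closes no cycle on the cities different from `x`), and each of `a` and `b` is so far
adjacent to at most one city other than `x`. -/
def CanShortcut {V : Type*} (x : V) (E : Multiset (Sym2 V)) (e : Sym2 V) : Prop :=
  (∀ a ∈ e, ∀ b ∈ e, a ≠ b → ¬ (awayFrom x E).Reachable a b) ∧
    ∀ a ∈ e, ((awayFrom x E).neighborSet a).ncard ≤ 1

open Classical in
/-- Treat the pair `e = {a, b}`: if allowed, replace `{a, x}` and `{b, x}` by `{a, b}`. -/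
noncomputable def step {V : Type*} [DecidableEq V] (x : V) (E : Multiset (Sym2 V)) (e : Sym2 V) :
    Multiset (Sym2 V) :=
  if CanShortcut x E e then E - spokes x e + {e} else E

/-- `L` lists all pairs of cities different from `x`, each once, in nonincreasing order of
savings. Ties are broken arbitrarily. -/
def IsSavingsOrder {V : Type*} (c : Sym2 V → ℝ) (x : V) (L : List (Sym2 V)) : Prop :=
  L.Nodup ∧ (∀ e, e ∈ L ↔ ¬ e.IsDiag ∧ x ∉ e) ∧
    L.Pairwise fun e f => savings c x f ≤ savings c x e

/-- `E` can be the output of the Clarke-Wright savings heuristic started with city `x`. -/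
def IsOutput {V : Type*} [Fintype V] [DecidableEq V] (c : Sym2 V → ℝ) (x : V)
    (E : Multiset (Sym2 V)) : Prop :=
  ∃ L : List (Sym2 V), IsSavingsOrder c x L ∧ E = L.foldl (step x) (start x)

/-- The factor `r` is guaranteed on metric instances with `n` cities: whatever city is selected
and however ties are broken, the heuristic finds a tour that is at most `r` times longer than a
shortest tour. -/
def Guaranteed (n : ℕ) (r : ℝ) : Prop :=
  ∀ (V : Type) [Fintype V] [DecidableEq V], Fintype.card V = n →
    ∀ c : Sym2 V → ℝ, IsMetric c → ∀ (x : V) (E : Multiset (Sym2 V)), IsOutput c x E →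
      IsTour E ∧ ∀ S, IsShortestTour c S → length c E ≤ r * length c S

/-- The approximation ratio of the Clarke-Wright savings heuristic on metric instances with `n`
cities. -/
noncomputable def ratio (n : ℕ) : ℝ :=
  sInf {r | Guaranteed n r}

/-! ### The grid instances with an additional city -/

/-- The cities of the `2 × (3 ^ (k + 2) - 1) / 2` grid. -/
abbrev GridCity (k : ℕ) : Type := Fin ((3 ^ (k + 2) - 1) / 2) × Fin 2

/-- The graph on the grid whose edges join the pairs of points at distance `1`. -/
def gridGraph (k : ℕ) : SimpleGraph (GridCity k) :=
  SimpleGraph.boxProd (SimpleGraph.pathGraph _) (SimpleGraph.pathGraph _)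

/-- The length function of the graphic instance on the grid, extended by the city `none`, which is
at distance `3 ^ (k + 2) / 2` from every other city. -/
noncomputable def hubLength (k : ℕ) : Sym2 (Option (GridCity k)) → ℝ :=
  Sym2.lift ⟨fun a b => match a, b with
    | some p, some q => ((gridGraph k).dist p q : ℝ)
    | none, none => 0
    | _, _ => 3 ^ (k + 2) / 2, by
      rintro (_ | p) (_ | q) <;> simp [SimpleGraph.dist_comm]⟩

end SavingsTSP

/-! The state of the heuristic is determined by the graph `G` of chosen pairs, a system of disjoint
paths avoiding `x`: the Eulerian tour is `tourOf x G`. Since two free ends of different paths can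
always be joined, the run ends with one path through all cities but `x`, closed by two spokes.

Upper bound. Let `ρ v` be the distance from `v` to `x` minus half the savings of the last chosen
pair containing `v`. Savings decrease during the run, so every chosen edge has length at most the
sum of the two values `ρ` at its ends. Consider two cities `u`, `v`, where `u` receives its last
pair no later than `v`. At that moment both are ends of paths. If these paths differ, the pair was
not treated before, and the triangle inequality gives distance at least `ρ u`. The exceptions link
each `u` to at most one later city, the other end of its path, so two color classes remove them all
(`exists_potential`). Within a class, the cities with `ρ ≥ t` together with `x` have pairwise
distances at least `t`, so any tour has length at least `t` times their number. Hence the `i`-th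
largest potential is at most twice the tour length divided by `i`, and summation gives a harmonic
number (`length_output_le`).

Lower bound. In the grid instance savings decrease exactly as grid distances increase, and ties are
ours to break. A self-similar path system is prescribed. Initially, U-shaped paths in blocks of
three columns leave the middle upper point isolated. Joining neighboring free ends at distance `3 ^
j` produces the same pattern on every third active position, three times coarser. At each stage the
vertices of degree less than two are so far apart that every other short pair is blocked
(`exists_blocked`), so among short pairs the heuristic picks only the prescribed ones
(`runGraph_le_of_blocked`). Few short edges are thus available: for each `j < k` at least `3 ^ (k -
j) - 1` output edges have length at least `3 ^ (j + 1)`. Every scale then contributes about `2 * 3 ^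
k` to the output, while a tour around the grid has length below `18 * 3 ^ k` (`exists_long_output`,
`exists_short_tour`).

For other `n`, a copy of `x` is added at distance zero: all its savings vanish, so neither tour
length changes (`ExceedsRatio.succ`). -/

namespace SavingsTSP

/-! ### The heuristic as a growing system of disjoint paths -/

section PathSystems

/-- The number of neighbors of a vertex. -/
noncomputable def deg {V : Type*} (G : SimpleGraph V) (v : V) : ℕ := (G.neighborSet v).ncard

open Classical in
/-- The set of vertices in the connected component of `v`. -/
noncomputable def frag {V : Type*} [Fintype V] (G : SimpleGraph V) (v : V) : Finset V :=
  Finset.univ.filter (G.Reachable v)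

/-- The pair `e` joins end vertices of two different components. -/
def Joinable {V : Type*} (G : SimpleGraph V) (e : Sym2 V) : Prop :=
  (∀ a ∈ e, ∀ b ∈ e, a ≠ b → ¬ G.Reachable a b) ∧ ∀ a ∈ e, deg G a ≤ 1

open Classical in
/-- Add the edge `e` if it joins end vertices of two different components. -/
noncomputable def joinEdge {V : Type*} (G : SimpleGraph V) (e : Sym2 V) : SimpleGraph V :=
  if Joinable G e then G ⊔ SimpleGraph.fromEdgeSet {e} else G

open Classical in
/-- The Eulerian tour that consists of the edges of `G`, and of edges to `x` that fill up each
degree to two. -/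
noncomputable def tourOf {V : Type*} [Fintype V] [DecidableEq V] (x : V) (G : SimpleGraph V) :
    Multiset (Sym2 V) :=
  (Set.toFinite G.edgeSet).toFinset.val +
    ∑ v ∈ Finset.univ.erase x, Multiset.replicate (2 - deg G v) s(v, x)

/-- A graph in which `x` is isolated, the degrees are at most two, and each component has two free
ends, like a vertex-disjoint union of paths. -/
structure IsPathSystem {V : Type*} [Fintype V] (x : V) (G : SimpleGraph V) : Prop where
  isolated : ∀ w, ¬ G.Adj x w
  deg_le : ∀ v, deg G v ≤ 2
  sum_free : ∀ v, ∑ w ∈ frag G v, (2 - deg G w) = 2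

variable {V : Type*} [Fintype V]

lemma mem_frag {G : SimpleGraph V} {v w : V} : w ∈ frag G v ↔ G.Reachable v w := by
  simp [frag]

lemma deg_mono {G H : SimpleGraph V} (h : G ≤ H) (v : V) : deg G v ≤ deg H v :=
  Set.ncard_le_ncard (fun _ hw => h hw) (Set.toFinite _)

lemma deg_eq_zero {G : SimpleGraph V} {v : V} : deg G v = 0 ↔ ∀ w, ¬ G.Adj v w := by
  rw [deg, Set.ncard_eq_zero (Set.toFinite _), Set.eq_empty_iff_forall_notMem]
  rfl

lemma deg_lt_of_adj {G H : SimpleGraph V} (h : G ≤ H) {v w : V} (hH : H.Adj v w)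
    (hG : ¬ G.Adj v w) : deg G v < deg H v :=
  Set.ncard_lt_ncard (Set.ssubset_iff_of_subset (fun _ hw => h hw) |>.2 ⟨w, hH, hG⟩)
    (Set.toFinite _)

lemma deg_sup_edge_left {G : SimpleGraph V} {a b : V} (hab : a ≠ b) (h : ¬ G.Adj a b) :
    deg (G ⊔ SimpleGraph.edge a b) a = deg G a + 1 := by
  have : (G ⊔ SimpleGraph.edge a b).neighborSet a = insert b (G.neighborSet a) := by
    ext w
    simp only [SimpleGraph.mem_neighborSet, SimpleGraph.sup_adj, SimpleGraph.edge_adj,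
      Set.mem_insert_iff]
    grind
  unfold deg
  rw [this]
  exact Set.ncard_insert_of_notMem (s := G.neighborSet a) h (Set.toFinite _)

lemma deg_sup_edge_right {G : SimpleGraph V} {a b : V} (hab : a ≠ b) (h : ¬ G.Adj a b) :
    deg (G ⊔ SimpleGraph.edge a b) b = deg G b + 1 := by
  rw [SimpleGraph.edge_comm]
  exact deg_sup_edge_left hab.symm (fun h' => h h'.symm)

lemma deg_sup_edge_of_ne {V : Type*} {G : SimpleGraph V} {a b v : V} (ha : v ≠ a) (hb : v ≠ b) :
    deg (G ⊔ SimpleGraph.edge a b) v = deg G v := by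
  have : (G ⊔ SimpleGraph.edge a b).neighborSet v = G.neighborSet v := by
    ext w
    simp only [SimpleGraph.mem_neighborSet, SimpleGraph.sup_adj, SimpleGraph.edge_adj]
    grind
  rw [deg, this, deg]

lemma reachable_sup_edge {V : Type*} {G : SimpleGraph V} {a b v w : V} :
    (G ⊔ SimpleGraph.edge a b).Reachable v w ↔
      G.Reachable v w ∨ (G.Reachable v a ∧ G.Reachable b w) ∨
        (G.Reachable v b ∧ G.Reachable a w) := by
  constructor
  · rintro ⟨p⟩
    induction p with
    | nil => exact Or.inl (SimpleGraph.Reachable.refl _)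
    | @cons u u' w h p ih =>
      rw [SimpleGraph.sup_adj, SimpleGraph.edge_adj] at h
      rcases h with h | ⟨⟨rfl, rfl⟩ | ⟨rfl, rfl⟩, -⟩
      · have h := h.reachable
        rcases ih with ih | ⟨h1, h2⟩ | ⟨h1, h2⟩
        · exact Or.inl (h.trans ih)
        · exact Or.inr (Or.inl ⟨h.trans h1, h2⟩)
        · exact Or.inr (Or.inr ⟨h.trans h1, h2⟩)
      · rcases ih with ih | ⟨h1, h2⟩ | ⟨h1, h2⟩
        · exact Or.inr (Or.inl ⟨.refl _, ih⟩)
        · exact Or.inr (Or.inl ⟨.refl _, h2⟩)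
        · exact Or.inl h2
      · rcases ih with ih | ⟨h1, h2⟩ | ⟨h1, h2⟩
        · exact Or.inr (Or.inr ⟨.refl _, ih⟩)
        · exact Or.inl h2
        · exact Or.inr (Or.inr ⟨.refl _, h2⟩)
  · have hle : G ≤ G ⊔ SimpleGraph.edge a b := le_sup_left
    have hab : (G ⊔ SimpleGraph.edge a b).Reachable a b := by
      by_cases h : a = b
      · exact h ▸ .refl _
      · exact SimpleGraph.Adj.reachable (by simp [SimpleGraph.edge_adj, h])
    rintro (h | ⟨h1, h2⟩ | ⟨h1, h2⟩)
    · exact h.mono hle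
    · exact (h1.mono hle).trans (hab.trans (h2.mono hle))
    · exact (h1.mono hle).trans (hab.symm.trans (h2.mono hle))

lemma IsPathSystem.bot (x : V) : IsPathSystem x (⊥ : SimpleGraph V) := by
  have h0 : ∀ v, deg (⊥ : SimpleGraph V) v = 0 := fun v => deg_eq_zero.2 (by simp)
  refine ⟨by simp, by simp [h0], fun v => ?_⟩
  have : frag (⊥ : SimpleGraph V) v = {v} := by
    ext w
    simp [mem_frag, eq_comm]
  simp [this, h0]

/-- Each of the two joined components loses one of its two free ends, so their union again has two.
A cycle would have none; the count of free ends thus replaces any explicit acyclicity condition. -/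
lemma IsPathSystem.sup_edge {x : V} {G : SimpleGraph V} (hG : IsPathSystem x G) {a b : V}
    (hax : a ≠ x) (hbx : b ≠ x) (hr : ¬ G.Reachable a b) (ha : deg G a ≤ 1) (hb : deg G b ≤ 1) :
    IsPathSystem x (G ⊔ SimpleGraph.edge a b) := by
  classical
  have hab : a ≠ b := by rintro rfl; exact hr (.refl _)
  have hadj : ¬ G.Adj a b := fun h => hr h.reachable
  have hda := deg_sup_edge_left hab hadj
  have hdb := deg_sup_edge_right hab hadj
  refine ⟨fun w => ?_, fun v => ?_, fun v => ?_⟩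
  · simp only [SimpleGraph.sup_adj, SimpleGraph.edge_adj, not_or]
    exact ⟨hG.isolated w, by grind⟩
  · by_cases hva : v = a
    · subst hva; omega
    by_cases hvb : v = b
    · subst hvb; omega
    rw [deg_sup_edge_of_ne hva hvb]
    exact hG.deg_le v
  · by_cases hv : G.Reachable v a ∨ G.Reachable v b
    · have hfr : frag (G ⊔ SimpleGraph.edge a b) v = frag G a ∪ frag G b := by
        ext w
        simp only [Finset.mem_union, mem_frag, reachable_sup_edge]
        constructor
        · rintro (h | ⟨-, h⟩ | ⟨-, h⟩)
          · exact hv.imp (fun h' => h'.symm.trans h) (fun h' => h'.symm.trans h)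
          · exact Or.inr h
          · exact Or.inl h
        · rcases hv with hv | hv <;> rintro (h | h)
          · exact Or.inl (hv.trans h)
          · exact Or.inr (Or.inl ⟨hv, h⟩)
          · exact Or.inr (Or.inr ⟨hv, h⟩)
          · exact Or.inl (hv.trans h)
      have hdis : Disjoint (frag G a) (frag G b) := by
        rw [Finset.disjoint_left]
        intro w h1 h2
        rw [mem_frag] at h1 h2
        exact hr (h1.trans h2.symm)
      have hma : a ∈ frag G a := mem_frag.2 (.refl _)
      have hmb : b ∈ frag G b := mem_frag.2 (.refl _)
      have h1 : ∑ w ∈ frag G a, (2 - deg (G ⊔ SimpleGraph.edge a b) w) + 1 = 2 := by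
        have h := hG.sum_free a
        rw [← Finset.add_sum_erase _ _ hma] at h ⊢
        rw [hda, Finset.sum_congr (g := fun w => 2 - deg G w) rfl]
        · omega
        · intro w hw
          rw [Finset.mem_erase, mem_frag] at hw
          rw [deg_sup_edge_of_ne hw.1 (by rintro rfl; exact hr hw.2)]
      have h2 : ∑ w ∈ frag G b, (2 - deg (G ⊔ SimpleGraph.edge a b) w) + 1 = 2 := by
        have h := hG.sum_free b
        rw [← Finset.add_sum_erase _ _ hmb] at h ⊢
        rw [hdb, Finset.sum_congr (g := fun w => 2 - deg G w) rfl]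
        · omega
        · intro w hw
          rw [Finset.mem_erase, mem_frag] at hw
          rw [deg_sup_edge_of_ne (by rintro rfl; exact hr hw.2.symm) hw.1]
      rw [hfr, Finset.sum_union hdis]
      omega
    · rw [not_or] at hv
      have hfr : frag (G ⊔ SimpleGraph.edge a b) v = frag G v := by
        ext w
        simp only [mem_frag, reachable_sup_edge]
        tauto
      rw [hfr]
      refine (Finset.sum_congr rfl fun w hw => ?_).trans (hG.sum_free v)
      rw [mem_frag] at hw
      rw [deg_sup_edge_of_ne (by rintro rfl; exact hv.1 hw) (by rintro rfl; exact hv.2 hw)]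

lemma IsPathSystem.exists_deg_le_one {x : V} {G : SimpleGraph V} (hG : IsPathSystem x G) (v : V) :
    ∃ w, G.Reachable v w ∧ deg G w ≤ 1 := by
  by_contra! h
  have := hG.sum_free v
  rw [Finset.sum_eq_zero] at this
  · omega
  · intro w hw
    have := h w (mem_frag.1 hw)
    omega

/-- A component has at most two vertices of degree at most one. -/
lemma IsPathSystem.end_unique {x : V} {G : SimpleGraph V} (hG : IsPathSystem x G) {u v w : V}
    (hv : G.Reachable u v) (hw : G.Reachable u w) (huv : u ≠ v) (huw : u ≠ w)
    (du : deg G u ≤ 1) (dv : deg G v ≤ 1) (dw : deg G w ≤ 1) : v = w := by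
  classical
  by_contra hvw
  have hsub : ({u, v, w} : Finset V) ⊆ frag G u := by
    intro z hz
    simp only [Finset.mem_insert, Finset.mem_singleton] at hz
    rw [mem_frag]
    rcases hz with rfl | rfl | rfl
    exacts [.refl _, hv, hw]
  have := Finset.sum_le_sum_of_subset (f := fun w => 2 - deg G w) hsub
  rw [hG.sum_free u, Finset.sum_insert (by simp [huv, huw]), Finset.sum_pair hvw] at this
  omega

/-- If a component has two vertices of degree at most one, all other degrees are two. -/
lemma IsPathSystem.deg_eq_of_ends {x : V} {G : SimpleGraph V} (hG : IsPathSystem x G) {u v : V}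
    (hv : G.Reachable u v) (huv : u ≠ v) (du : deg G u ≤ 1) (dv : deg G v ≤ 1) :
    deg G u = 1 ∧ deg G v = 1 ∧ ∀ w, G.Reachable u w → w ≠ u → w ≠ v → deg G w = 2 := by
  classical
  have hsub : ({u, v} : Finset V) ⊆ frag G u := by
    intro z hz
    simp only [Finset.mem_insert, Finset.mem_singleton] at hz
    rw [mem_frag]
    rcases hz with rfl | rfl
    exacts [.refl _, hv]
  have := Finset.sum_le_sum_of_subset (f := fun w => 2 - deg G w) hsub
  rw [hG.sum_free u, Finset.sum_pair huv] at this
  refine ⟨by omega, by omega, fun w hw h1 h2 => ?_⟩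
  by_contra h
  have := hG.deg_le w
  exact h2 (hG.end_unique hw hv h1.symm huv du (by omega) dv)

lemma IsPathSystem.ne_of_reachable {x : V} {G : SimpleGraph V} (hG : IsPathSystem x G) {u w : V}
    (hu : u ≠ x) (h : G.Reachable u w) : w ≠ x := by
  rintro rfl
  obtain ⟨p⟩ := h.symm
  cases p with
  | nil => exact hu rfl
  | cons h p => exact hG.isolated _ h

lemma tourOf_bot [DecidableEq V] (x : V) : tourOf x (⊥ : SimpleGraph V) = start x := by
  have h0 : ∀ v, deg (⊥ : SimpleGraph V) v = 0 := fun v => deg_eq_zero.2 (by simp)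
  simp only [tourOf, start, h0]
  simp

lemma awayFrom_tourOf [DecidableEq V] {x : V} {G : SimpleGraph V} (hx : ∀ w, ¬ G.Adj x w) :
    awayFrom x (tourOf x G) = G := by
  ext u v
  simp only [awayFrom, tourOf, SimpleGraph.fromEdgeSet_adj, Set.mem_ofPred_eq, Multiset.mem_add,
    Multiset.mem_sum, Multiset.mem_replicate, Finset.mem_val, Set.Finite.mem_toFinset,
    SimpleGraph.mem_edgeSet, Sym2.mem_iff, not_or]
  constructor
  · rintro ⟨⟨h | ⟨w, -, -, h⟩, h1, h2⟩, -⟩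
    · exact h
    · simp only [Sym2.eq_iff] at h
      rcases h with ⟨-, rfl⟩ | ⟨rfl, -⟩ <;> simp at h1 h2
  · intro h
    exact ⟨⟨Or.inl h, by rintro rfl; exact hx _ h, by rintro rfl; exact hx _ h.symm⟩, h.ne⟩

/-- The spokes are always those that complete the degrees to two, so the multiset carries no
information beyond `G`, and the run can be studied on graphs alone. -/
lemma step_tourOf [DecidableEq V] {x : V} {G : SimpleGraph V} (hG : IsPathSystem x G) {e : Sym2 V}
    (hd : ¬ e.IsDiag) (hx : x ∉ e) : step x (tourOf x G) e = tourOf x (joinEdge G e) := by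
  classical
  have hc : CanShortcut x (tourOf x G) e ↔ Joinable G e := by
    rw [CanShortcut, awayFrom_tourOf hG.isolated]
    rfl
  unfold step joinEdge
  simp only [hc]
  split_ifs with h
  · induction e with | _ a b
    simp only [Sym2.mk_isDiag_iff] at hd
    simp only [Sym2.mem_iff, not_or] at hx
    obtain ⟨h1, h2⟩ := h
    have ha := h2 a (by simp)
    have hb := h2 b (by simp)
    have hr := h1 a (by simp) b (by simp) hd
    have hadj : ¬ G.Adj a b := fun h => hr h.reachable
    have hsp : spokes x s(a, b) = {s(a, x)} + {s(b, x)} := by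
      simp [spokes, Sym2.toMultiset]
      rfl
    have hE : (Set.toFinite (G ⊔ SimpleGraph.edge a b).edgeSet).toFinset =
        insert s(a, b) (Set.toFinite G.edgeSet).toFinset := by
      ext f
      simp [SimpleGraph.edgeSet_edge_of_ne hd]
    have hS : ∑ v ∈ Finset.univ.erase x, Multiset.replicate (2 - deg G v) s(v, x) =
        ∑ v ∈ Finset.univ.erase x,
          Multiset.replicate (2 - deg (G ⊔ SimpleGraph.edge a b) v) s(v, x) +
          ({s(a, x)} + {s(b, x)}) := by
      have hma : a ∈ Finset.univ.erase x := by simp [Ne.symm hx.1]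
      have hmb : b ∈ (Finset.univ.erase x).erase a := by simp [Ne.symm hx.2, Ne.symm hd]
      rw [← Finset.add_sum_erase _ _ hma, ← Finset.add_sum_erase _ _ hmb,
        ← Finset.add_sum_erase _ _ hma, ← Finset.add_sum_erase _ _ hmb,
        deg_sup_edge_left hd hadj, deg_sup_edge_right hd hadj,
        Finset.sum_congr (s₁ := ((Finset.univ.erase x).erase a).erase b)
          (g := fun v => Multiset.replicate (2 - deg (G ⊔ SimpleGraph.edge a b) v) s(v, x)) rfl]
      -- The truncated subtraction is exact because `a` and `b` have degree at most one; each gives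
      -- up exactly one spoke.
      · rw [show 2 - deg G a = (2 - (deg G a + 1)) + 1 by omega,
          show 2 - deg G b = (2 - (deg G b + 1)) + 1 by omega, Multiset.replicate_succ,
          Multiset.replicate_succ, ← Multiset.singleton_add, ← Multiset.singleton_add]
        abel
      · intro v hv
        simp only [Finset.mem_erase] at hv
        rw [deg_sup_edge_of_ne hv.2.1 hv.1]
    have : G ⊔ SimpleGraph.fromEdgeSet {s(a, b)} = G ⊔ SimpleGraph.edge a b := rfl
    rw [this]
    unfold tourOf
    rw [hS, hsp, hE, ← add_assoc, add_tsub_cancel_right, Finset.insert_val,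
      Multiset.ndinsert_of_notMem (by simpa using hadj), ← Multiset.singleton_add]
    abel
  · rfl

lemma IsPathSystem.joinEdge {x : V} {G : SimpleGraph V} (hG : IsPathSystem x G) {e : Sym2 V}
    (hd : ¬ e.IsDiag) (hx : x ∉ e) : IsPathSystem x (joinEdge G e) := by
  unfold SavingsTSP.joinEdge
  split_ifs with h
  · induction e with | _ a b
    simp only [Sym2.mk_isDiag_iff] at hd
    simp only [Sym2.mem_iff, not_or] at hx
    exact hG.sup_edge (Ne.symm hx.1) (Ne.symm hx.2) (h.1 a (by simp) b (by simp) hd)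
      (h.2 a (by simp)) (h.2 b (by simp))
  · exact hG

lemma le_joinEdge {V : Type*} (G : SimpleGraph V) (e : Sym2 V) : G ≤ joinEdge G e := by
  unfold joinEdge
  split_ifs
  · exact le_sup_left
  · exact le_rfl

/-- The graph of the shortcuts made for the first `i` pairs of the list. -/
noncomputable def runGraph {V : Type*} (L : List (Sym2 V)) (i : ℕ) : SimpleGraph V :=
  (L.take i).foldl joinEdge ⊥

lemma runGraph_zero {V : Type*} (L : List (Sym2 V)) : runGraph L 0 = ⊥ := by
  simp [runGraph]

lemma runGraph_succ {V : Type*} {L : List (Sym2 V)} {i : ℕ} (hi : i < L.length) :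
    runGraph L (i + 1) = joinEdge (runGraph L i) L[i] := by
  rw [runGraph, List.take_add_one, List.getElem?_eq_getElem hi, List.foldl_append]
  rfl

lemma runGraph_of_length_le {V : Type*} {L : List (Sym2 V)} {i : ℕ} (hi : L.length ≤ i) :
    runGraph L i = runGraph L L.length := by
  simp [runGraph, List.take_of_length_le hi]

lemma runGraph_mono {V : Type*} (L : List (Sym2 V)) : Monotone (runGraph L) := by
  refine monotone_nat_of_le_succ fun i => ?_
  by_cases hi : i < L.length
  · rw [runGraph_succ hi]
    exact le_joinEdge _ _
  · rw [runGraph_of_length_le (by omega), runGraph_of_length_le (i := i + 1) (by omega)]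

/-- All members of the list are proper pairs of cities different from `x`. -/
def Proper {V : Type*} (x : V) (L : List (Sym2 V)) : Prop := ∀ e ∈ L, ¬ e.IsDiag ∧ x ∉ e

lemma isPathSystem_foldl {x : V} {L : List (Sym2 V)} (hL : Proper x L) :
    ∀ G : SimpleGraph V, IsPathSystem x G → IsPathSystem x (L.foldl joinEdge G) := by
  induction L with
  | nil => exact fun G hG => hG
  | cons e L ih =>
    intro G hG
    rw [List.foldl_cons]
    exact ih (fun f hf => hL f (by simp [hf])) _
      (hG.joinEdge (hL e (by simp)).1 (hL e (by simp)).2)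

lemma foldl_step_tourOf [DecidableEq V] {x : V} {L : List (Sym2 V)} (hL : Proper x L) :
    ∀ G : SimpleGraph V, IsPathSystem x G →
      L.foldl (step x) (tourOf x G) = tourOf x (L.foldl joinEdge G) := by
  induction L with
  | nil => exact fun G _ => rfl
  | cons e L ih =>
    intro G hG
    rw [List.foldl_cons, List.foldl_cons, step_tourOf hG (hL e (by simp)).1 (hL e (by simp)).2]
    exact ih (fun f hf => hL f (by simp [hf])) _
      (hG.joinEdge (hL e (by simp)).1 (hL e (by simp)).2)

lemma isPathSystem_runGraph {x : V} {L : List (Sym2 V)} (hL : Proper x L) (i : ℕ) :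
    IsPathSystem x (runGraph L i) :=
  isPathSystem_foldl (fun _ he => hL _ (List.mem_of_mem_take he)) _ (IsPathSystem.bot x)

lemma foldl_step_start [DecidableEq V] {x : V} {L : List (Sym2 V)} (hL : Proper x L) :
    L.foldl (step x) (start x) = tourOf x (runGraph L L.length) := by
  rw [← tourOf_bot, foldl_step_tourOf hL _ (IsPathSystem.bot x), runGraph, List.take_length]

/-- The pair at index `i` is chosen. -/
def Chosen {V : Type*} (L : List (Sym2 V)) (i : ℕ) : Prop :=
  ∃ h : i < L.length, Joinable (runGraph L i) L[i]

lemma runGraph_succ_of_chosen {V : Type*} {L : List (Sym2 V)} {i : ℕ} (h : Chosen L i) :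
    runGraph L (i + 1) = runGraph L i ⊔ SimpleGraph.fromEdgeSet {L[i]'h.1} := by
  rw [runGraph_succ h.1, joinEdge, if_pos h.2]

lemma runGraph_succ_of_not_chosen {V : Type*} {L : List (Sym2 V)} {i : ℕ} (h : ¬ Chosen L i) :
    runGraph L (i + 1) = runGraph L i := by
  by_cases hi : i < L.length
  · rw [runGraph_succ hi, joinEdge, if_neg fun h' => h ⟨hi, h'⟩]
  · rw [runGraph_of_length_le (by omega), runGraph_of_length_le (i := i) (by omega)]

lemma exists_chosen_of_adj {V : Type*} {L : List (Sym2 V)} {i : ℕ} {u v : V}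
    (h : (runGraph L i).Adj u v) : ∃ j, j < i ∧ ∃ hj : Chosen L j, L[j]'hj.1 = s(u, v) := by
  induction i with
  | zero => simp [runGraph_zero] at h
  | succ i ih =>
    by_cases hi : Chosen L i
    · rw [runGraph_succ_of_chosen hi, SimpleGraph.sup_adj, SimpleGraph.fromEdgeSet_adj] at h
      rcases h with h | ⟨h, -⟩
      · obtain ⟨j, hj, h⟩ := ih h
        exact ⟨j, by omega, h⟩
      · exact ⟨i, by omega, hi, h.symm⟩
    · rw [runGraph_succ_of_not_chosen hi] at h
      obtain ⟨j, hj, h⟩ := ih h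
      exact ⟨j, by omega, h⟩

/-- A pair of different vertices that was treated cannot be joined any more. -/
lemma not_joinable_of_lt {L : List (Sym2 V)} {i j : ℕ} (hj : j < L.length) (hji : j < i) {u v : V}
    (huv : u ≠ v) (he : L[j] = s(u, v)) (hu : deg (runGraph L i) u ≤ 1)
    (hv : deg (runGraph L i) v ≤ 1) : (runGraph L i).Reachable u v := by
  have hle : runGraph L j ≤ runGraph L i := runGraph_mono L hji.le
  by_cases hc : Chosen L j
  · have : (runGraph L (j + 1)).Adj u v := by
      rw [runGraph_succ_of_chosen hc, he]
      simp [huv]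
    exact (runGraph_mono L (show j + 1 ≤ i by omega) this).reachable
  -- Degrees and reachability only grow, so a pair that satisfies the conditions at time `i`
  -- satisfied them when it was treated and would have been chosen then.
  · by_contra hr
    refine hc ⟨hj, ?_⟩
    rw [he]
    have h1 := (deg_mono hle u).trans hu
    have h2 := (deg_mono hle v).trans hv
    constructor
    · intro a ha b hb hab h
      have h := h.mono hle
      rw [Sym2.mem_iff] at ha hb
      rcases ha with rfl | rfl <;> rcases hb with rfl | rfl
      · exact hab rfl
      · exact hr h
      · exact hr h.symm
      · exact hab rfl
    · intro a ha
      rw [Sym2.mem_iff] at ha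
      rcases ha with rfl | rfl <;> assumption

/-- At the end of the run, all vertices other than `x` are connected. -/
lemma reachable_final {x : V} {L : List (Sym2 V)} (hL : ∀ e, e ∈ L ↔ ¬ e.IsDiag ∧ x ∉ e) {u v : V}
    (hu : u ≠ x) (hv : v ≠ x) : (runGraph L L.length).Reachable u v := by
  have hP : Proper x L := fun e he => (hL e).1 he
  have hS := isPathSystem_runGraph hP L.length
  -- Free ends of the components of `u` and `v`: either they coincide, or their pair has been
  -- treated, which forces them to be connected.
  obtain ⟨u', hu', du⟩ := hS.exists_deg_le_one u
  obtain ⟨v', hv', dv⟩ := hS.exists_deg_le_one v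
  by_cases h : u' = v'
  · subst h
    exact hu'.trans hv'.symm
  have hm : s(u', v') ∈ L := by
    rw [hL]
    simp [h, (hS.ne_of_reachable hu hu').symm, (hS.ne_of_reachable hv hv').symm]
  obtain ⟨j, hj, hje⟩ := List.getElem_of_mem hm
  exact hu'.trans ((not_joinable_of_lt hj hj h hje du dv).trans hv'.symm)

end PathSystems

/-! ### Tours as Hamiltonian cycles, as lists of cities, and lower bounds on their lengths -/

section Tours

variable {V : Type*}

/-- A connected graph with all degrees two consists of the edges of a tour. -/
lemma isTour_of_deg_eq_two [Fintype V] [DecidableEq V] {G : SimpleGraph V} (hc : G.Connected)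
    (hd : ∀ v, deg G v = 2) : IsTour (Set.toFinite G.edgeSet).toFinset.val := by
  classical
  obtain ⟨v⟩ := hc.nonempty
  have hcyc : G.IsCycles := fun v _ => hd v
  have hsupp : ∀ w, w ∈ (G.connectedComponentMk v).supp := by
    intro w
    rw [SimpleGraph.ConnectedComponent.mem_supp_iff, SimpleGraph.ConnectedComponent.eq]
    exact hc.preconnected w v
  have hnon : (G.neighborSet v).Nonempty := by
    rw [Set.nonempty_iff_ne_empty]
    intro h
    have := hd v
    rw [deg, h] at this
    simp at this
  obtain ⟨p, hp, hverts⟩ := hcyc.exists_cycle_toSubgraph_verts_eq_connectedComponentSupp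
    (hsupp v) hnon
  have hmem : ∀ w, w ∈ p.support := by
    intro w
    have := hsupp w
    rw [← hverts] at this
    simpa using this
  -- The cycle already uses two edges at every vertex, and `G` has no more.
  have hedge : ∀ e, e ∈ p.edges ↔ e ∈ G.edgeSet := by
    intro e
    refine ⟨fun h => p.edges_subset_edgeSet h, fun h => ?_⟩
    induction e with | _ a b
    have h2 := hp.ncard_neighborSet_toSubgraph_eq_two (hmem a)
    have heq : p.toSubgraph.neighborSet a = G.neighborSet a := by
      refine Set.eq_of_subset_of_ncard_le (p.toSubgraph.neighborSet_subset a) ?_ (Set.toFinite _)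
      rw [h2]
      exact (hd a).le
    have : b ∈ p.toSubgraph.neighborSet a := by
      rw [heq]
      exact h
    rw [← SimpleGraph.Walk.mem_edges_toSubgraph]
    exact this
  refine ⟨v, p.mapLe le_top, ?_, ?_⟩
  · rw [SimpleGraph.Walk.isHamiltonianCycle_iff_isCycle_and_support_count_tail_eq_one]
    refine ⟨hp.mapLe le_top, fun a => ?_⟩
    rw [SimpleGraph.Walk.support_mapLe_eq_support]
    refine List.count_eq_one_of_mem hp.support_nodup ?_
    by_cases ha : a = v
    · subst ha
      exact SimpleGraph.Walk.end_mem_tail_support hp.not_nil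
    · have := hmem a
      rw [← SimpleGraph.Walk.cons_tail_support, List.mem_cons] at this
      exact this.resolve_left ha
  · rw [SimpleGraph.Walk.edges_mapLe_eq_edges]
    refine (Multiset.Nodup.ext (Finset.nodup _) ?_).2 ?_
    · exact Multiset.coe_nodup.2 hp.edges_nodup
    · intro e
      simp [hedge]

lemma length_add (c : Sym2 V → ℝ) (A B : Multiset (Sym2 V)) :
    length c (A + B) = length c A + length c B := by
  simp [length]

lemma length_nonneg {c : Sym2 V → ℝ} (hc : IsMetric c) (A : Multiset (Sym2 V)) :
    0 ≤ length c A :=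
  Multiset.sum_nonneg (by simp only [Multiset.mem_map]; rintro _ ⟨e, -, rfl⟩; exact hc.nonneg e)

/-- The graph of a spanning path system with a single path away from `x`, closed at `x`. -/
def closure (x : V) (G : SimpleGraph V) : SimpleGraph V :=
  G ⊔ SimpleGraph.fromEdgeSet {e | ∃ v, v ≠ x ∧ deg G v = 1 ∧ e = s(v, x)}

lemma closure_adj {x : V} {G : SimpleGraph V} {u v : V} :
    (closure x G).Adj u v ↔ G.Adj u v ∨ (u ≠ x ∧ deg G u = 1 ∧ v = x) ∨
      (v ≠ x ∧ deg G v = 1 ∧ u = x) := by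
  simp only [closure, SimpleGraph.sup_adj, SimpleGraph.fromEdgeSet_adj, Set.mem_ofPred_eq,
    Sym2.eq_iff]
  grind

variable [Fintype V] [DecidableEq V]

lemma one_le_deg {x : V} {G : SimpleGraph V} (hr : ∀ u v, u ≠ x → v ≠ x → G.Reachable u v)
    (hcard : 3 ≤ Fintype.card V) {v : V} (hv : v ≠ x) : 1 ≤ deg G v := by
  classical
  obtain ⟨w, hw⟩ : ∃ w, w ∉ ({v, x} : Finset V) := by
    by_contra! h
    have := Finset.card_le_card (s := Finset.univ) (t := {v, x}) (fun w _ => h w)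
    have h2 := Finset.card_le_two (a := v) (b := x)
    rw [Finset.card_univ] at this
    omega
  simp only [Finset.mem_insert, Finset.mem_singleton, not_or] at hw
  by_contra h
  have h0 : deg G v = 0 := by omega
  rw [deg_eq_zero] at h0
  obtain ⟨p⟩ := hr v w hv hw.2
  cases p with
  | nil => exact hw.1 rfl
  | cons h p => exact h0 _ h

lemma sum_free_eq_two {x : V} {G : SimpleGraph V} (hG : IsPathSystem x G)
    (hr : ∀ u v, u ≠ x → v ≠ x → G.Reachable u v) (hcard : 3 ≤ Fintype.card V) :
    ∑ v ∈ Finset.univ.erase x, (2 - deg G v) = 2 := by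
  obtain ⟨v₀, hv₀⟩ : ∃ v, v ≠ x := by
    by_contra! h
    have := Fintype.card_le_one_iff.2 (fun a b => (h a).trans (h b).symm)
    omega
  have hfrag : frag G v₀ = Finset.univ.erase x := by
    ext w
    simp only [mem_frag, Finset.mem_erase, Finset.mem_univ, and_true]
    exact ⟨hG.ne_of_reachable hv₀, hr _ _ hv₀⟩
  rw [← hfrag]
  exact hG.sum_free v₀

/-- The cities other than `x` form one component, so two free ends remain in all. With at least
three cities no vertex of this component is isolated; the free ends therefore sit at two different
vertices, and the spokes close the path to a simple cycle instead of a doubled edge. -/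
lemma isTour_tourOf {x : V} {G : SimpleGraph V} (hG : IsPathSystem x G)
    (hr : ∀ u v, u ≠ x → v ≠ x → G.Reachable u v) (hcard : 3 ≤ Fintype.card V) :
    IsTour (tourOf x G) := by
  classical
  have hpos : ∀ v, v ≠ x → 1 ≤ deg G v := fun v hv => one_le_deg hr hcard hv
  have hrep : ∀ v ∈ Finset.univ.erase x, 2 - deg G v = if deg G v = 1 then 1 else 0 := by
    intro v hv
    have h1 := hpos v (Finset.ne_of_mem_erase hv)
    have h2 := hG.deg_le v
    split_ifs <;> omega
  have htwo : ((Finset.univ.erase x).filter (fun v => deg G v = 1)).card = 2 := by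
    rw [Finset.card_filter, ← Finset.sum_congr rfl hrep]
    exact sum_free_eq_two hG hr hcard
  have hends : ∃ v, v ≠ x ∧ deg G v = 1 := by
    obtain ⟨v, hv⟩ := Finset.card_pos.1 (htwo ▸ two_pos)
    simp only [Finset.mem_filter, Finset.mem_erase] at hv
    exact ⟨v, hv.1.1, hv.2⟩
  have hE : tourOf x G = (Set.toFinite (closure x G).edgeSet).toFinset.val := by
    have hsum : ∑ v ∈ Finset.univ.erase x, Multiset.replicate (2 - deg G v) s(v, x) =
        (((Finset.univ.erase x).filter (fun v => deg G v = 1)).image (fun v => s(v, x))).val := by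
      rw [Finset.image_val, Multiset.Nodup.dedup, ← Multiset.sum_map_singleton (Multiset.map _ _),
        Multiset.map_map]
      · change _ = Finset.sum _ _
        rw [Finset.sum_filter]
        refine Finset.sum_congr rfl fun v hv => ?_
        rw [hrep v hv]
        split_ifs <;> simp
      · refine (Finset.nodup _).map ?_
        intro a b hab
        rw [Sym2.eq_iff] at hab
        rcases hab with ⟨h, -⟩ | ⟨h, h'⟩
        exacts [h, h.trans h']
    rw [tourOf, hsum]
    refine (Multiset.Nodup.ext ?_ (Finset.nodup _)).2 ?_
    · rw [Multiset.nodup_add]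
      refine ⟨Finset.nodup _, Finset.nodup _, ?_⟩
      rw [Multiset.disjoint_left]
      intro e he he'
      simp only [Finset.mem_val, Set.Finite.mem_toFinset, Finset.mem_image] at he he'
      obtain ⟨v, -, rfl⟩ := he'
      exact hG.isolated v (SimpleGraph.Adj.symm he)
    · intro e
      simp only [Multiset.mem_add, Finset.mem_val, Set.Finite.mem_toFinset, Finset.mem_image,
        Finset.mem_filter, Finset.mem_erase, Finset.mem_univ, and_true]
      induction e with | _ a b
      simp only [SimpleGraph.mem_edgeSet, closure_adj, Sym2.eq_iff]
      grind
  rw [hE]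
  apply isTour_of_deg_eq_two
  · have hle : G ≤ closure x G := le_sup_left
    have hxr : ∀ v, (closure x G).Reachable x v := by
      intro v
      by_cases hv : v = x
      · exact hv ▸ .refl _
      · obtain ⟨w, hw, hw1⟩ := hends
        exact SimpleGraph.Reachable.trans
          (SimpleGraph.Adj.reachable (closure_adj.2 (Or.inr (Or.inr ⟨hw, hw1, rfl⟩))))
          ((hr w v hw hv).mono hle)
    exact { preconnected := fun u v => (hxr u).symm.trans (hxr v), nonempty := ⟨x⟩ }
  · intro v
    by_cases hv : v = x
    · subst hv
      rw [deg, ← htwo, ← Set.ncard_coe_finset]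
      congr 1
      ext w
      simp only [SimpleGraph.mem_neighborSet, closure_adj, Finset.coe_filter, Finset.mem_erase,
        Finset.mem_univ, Set.mem_ofPred_eq]
      have := hG.isolated w
      grind
    · have h1 := hpos v hv
      have h2 := hG.deg_le v
      by_cases h : deg G v = 1
      · have : (closure x G).neighborSet v = insert x (G.neighborSet v) := by
          ext w
          simp only [SimpleGraph.mem_neighborSet, closure_adj, Set.mem_insert_iff]
          grind
        rw [deg, this, Set.ncard_insert_of_notMem (s := G.neighborSet v)
          (fun h' => hG.isolated v (SimpleGraph.Adj.symm h')) (Set.toFinite _)]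
        rw [deg] at h
        rw [h]
      · have : (closure x G).neighborSet v = G.neighborSet v := by
          ext w
          simp only [SimpleGraph.mem_neighborSet, closure_adj]
          grind
        rw [deg, this]
        rw [deg] at h h1 h2
        omega

lemma isTour_of_isOutput {c : Sym2 V → ℝ} {x : V} {E : Multiset (Sym2 V)} (hE : IsOutput c x E)
    (hcard : 3 ≤ Fintype.card V) : IsTour E := by
  obtain ⟨L, hL, rfl⟩ := hE
  have hP : Proper x L := fun e he => (hL.2.1 e).1 he
  rw [foldl_step_start hP]
  exact isTour_tourOf (isPathSystem_runGraph hP _) (fun u v => reachable_final hL.2.1) hcard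

/-- The tour edges between consecutive members of a list. -/
def pathEdges {V : Type*} : List V → List (Sym2 V)
  | [] => []
  | [_] => []
  | a :: b :: l => s(a, b) :: pathEdges (b :: l)

lemma edges_eq_pathEdges {V : Type*} {G : SimpleGraph V} {u v : V} (p : G.Walk u v) :
    p.edges = pathEdges p.support := by
  induction p with
  | nil => rfl
  | @cons a b w h p ih =>
    rw [SimpleGraph.Walk.edges_cons, SimpleGraph.Walk.support_cons, ih,
      ← SimpleGraph.Walk.cons_tail_support p]
    rfl

lemma exists_walk_of_list {V : Type*} (l : List V) : ∀ (a b : V), (a :: l ++ [b]).IsChain (· ≠ ·) →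
    ∃ p : (⊤ : SimpleGraph V).Walk a b, p.support = a :: l ++ [b] := by
  induction l with
  | nil =>
    intro a b h
    have h : a ≠ b := by simpa using h
    exact ⟨.cons h .nil, rfl⟩
  | cons d l ih =>
    intro a b h
    simp only [List.cons_append, List.isChain_cons_cons] at h
    obtain ⟨p, hp⟩ := ih d b h.2
    exact ⟨.cons h.1 p, by simp [hp]⟩

/-- Two cities besides `x` are needed so that the first edge is not traversed again as the last one.
-/
lemma isTour_of_list {V : Type*} [DecidableEq V] {x : V} {l : List V}
    (hn : (x :: l).Nodup) (hm : ∀ v, v ∈ x :: l)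
    (hl : 2 ≤ l.length) : IsTour (pathEdges (x :: l ++ [x]) : Multiset (Sym2 V)) := by
  match l, hl with
  | b :: d :: l, _ =>
    have hnod : (b :: (d :: l) ++ [x]).Nodup := by
      have : (b :: (d :: l) ++ [x]).Perm (x :: b :: d :: l) := List.perm_append_singleton _ _
      exact this.nodup_iff.2 hn
    obtain ⟨p, hp⟩ := exists_walk_of_list (d :: l) b x hnod.isChain
    have hpath : p.IsPath := by
      rw [SimpleGraph.Walk.isPath_def, hp]
      exact hnod
    have hxb : x ≠ b := by
      simp only [List.nodup_cons, List.mem_cons] at hn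
      tauto
    have hnot : s(x, b) ∉ p.edges := by
      rw [edges_eq_pathEdges, hp]
      intro h
      simp only [List.cons_append, pathEdges, List.mem_cons] at h
      rcases h with h | h
      · simp only [List.nodup_cons, List.mem_cons] at hn
        rw [Sym2.eq_iff] at h
        grind
      · have hsub : ∀ (l : List V) (u v : V), s(u, v) ∈ pathEdges l → v ∈ l := by
          intro l
          induction l with
          | nil => simp [pathEdges]
          | cons a l ih =>
            intro u v huv
            cases l with
            | nil => simp [pathEdges] at huv
            | cons a' l =>
              simp only [pathEdges, List.mem_cons] at huv
              rcases huv with huv | huv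
              · rw [Sym2.eq_iff] at huv
                grind
              · exact List.mem_cons_of_mem _ (ih u v huv)
        have := hsub _ _ _ h
        simp only [List.cons_append, List.nodup_cons] at hnod
        exact hnod.1 this
    have hcons : (SimpleGraph.Walk.cons (G := ⊤) hxb p).IsCycle :=
      (SimpleGraph.Walk.cons_isCycle_iff _ _).2 ⟨hpath, hnot⟩
    refine ⟨x, .cons hxb p, ?_, ?_⟩
    · rw [SimpleGraph.Walk.isHamiltonianCycle_iff_isCycle_and_support_count_tail_eq_one]
      refine ⟨hcons, fun a => List.count_eq_one_of_mem hcons.support_nodup ?_⟩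
      have := hm a
      rw [SimpleGraph.Walk.support_cons, List.tail_cons, hp]
      simp only [List.mem_cons, List.mem_append, List.cons_append] at this ⊢
      tauto
    · rw [edges_eq_pathEdges, SimpleGraph.Walk.support_cons, hp]
      rfl

lemma exists_hamiltonianCycle_of_isTour {V : Type*} [DecidableEq V] {T : Multiset (Sym2 V)}
    (hT : IsTour T) (x : V) :
    ∃ p : (⊤ : SimpleGraph V).Walk x x, p.IsHamiltonianCycle ∧
      T = (p.edges : Multiset (Sym2 V)) := by
  obtain ⟨v, p, hp, rfl⟩ := hT
  refine ⟨p.rotate x (hp.mem_support x), hp.rotate _, ?_⟩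
  rw [Multiset.coe_eq_coe]
  exact (p.rotate_edges _ _).perm.symm

lemma exists_list_of_isTour {V : Type*} [DecidableEq V] {T : Multiset (Sym2 V)}
    (hT : IsTour T) (x : V) :
    ∃ l : List V, (x :: l).Nodup ∧ (∀ v, v ∈ x :: l) ∧
      T = (pathEdges (x :: l ++ [x]) : Multiset (Sym2 V)) := by
  obtain ⟨p, hp, rfl⟩ := exists_hamiltonianCycle_of_isTour hT x
  have hne : p.support.tail ≠ [] :=
    List.ne_nil_of_mem (SimpleGraph.Walk.end_mem_tail_support hp.not_nil)
  have hlast : p.support.tail.getLast hne = x := by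
    rw [List.getLast_tail]
    exact p.getLast_support
  have happ : p.support.tail = p.support.tail.dropLast ++ [x] := by
    conv_lhs => rw [← List.dropLast_append_getLast hne, hlast]
  have hperm : p.support.tail.Perm (x :: p.support.tail.dropLast) := by
    conv_lhs => rw [happ]
    exact List.perm_append_singleton _ _
  refine ⟨p.support.tail.dropLast, hperm.nodup_iff.1 hp.support_nodup, fun v => ?_, ?_⟩
  · rw [← hperm.mem_iff]
    rw [SimpleGraph.Walk.isHamiltonianCycle_iff_isCycle_and_support_count_tail_eq_one] at hp
    exact List.count_pos_iff.1 (by rw [hp.2 v]; exact one_pos)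
  · rw [edges_eq_pathEdges, List.cons_append, ← happ, SimpleGraph.Walk.cons_tail_support]

lemma exists_isShortestTour (c : Sym2 V → ℝ) {T : Multiset (Sym2 V)} (hT : IsTour T) :
    ∃ S, IsShortestTour c S := by
  classical
  have hfin : {T : Multiset (Sym2 V) | IsTour T}.Finite := by
    -- A cycle repeats no edge, so tours are among the finitely many multisets that come from finite
    -- sets of edges.
    refine (Set.toFinite (Set.range (fun F : Finset (Sym2 V) => F.val))).subset ?_
    rintro T ⟨v, p, hp, rfl⟩
    exact ⟨⟨_, Multiset.coe_nodup.2 hp.isCycle.edges_nodup⟩, rfl⟩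
  obtain ⟨S, hS, hmin⟩ := Set.exists_min_image _ (length c) hfin ⟨T, hT⟩
  exact ⟨S, hS, hmin⟩

/-- A walk that visits many points with large pairwise distances is long. -/
lemma mul_card_le_of_separated {V : Type*} [DecidableEq V] {c : Sym2 V → ℝ}
    (hc : IsMetric c) {t : ℝ} {B : Finset V}
    (hB : ∀ u ∈ B, ∀ v ∈ B, u ≠ v → t ≤ c s(u, v)) (ht : 0 ≤ t) {G : SimpleGraph V} {u w : V}
    (p : G.Walk u w) : ∀ a ∈ B, t * (((B.erase a).filter (· ∈ p.support)).card : ℝ) ≤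
      c s(a, u) + length c (p.edges : Multiset (Sym2 V)) := by
  -- The anchor `a` is the point of `B` passed last. When the walk meets a new point of `B`, the
  -- distance from the anchor pays `t` for it and the anchor moves there; elsewhere the triangle
  -- inequality transports the anchor distance along the edge.
  induction p with
  | @nil u =>
    intro a ha
    by_cases hu : u ∈ B.erase a
    · have h1 : (B.erase a).filter (· ∈ (SimpleGraph.Walk.nil : G.Walk u u).support) ⊆ {u} := by
        intro v
        simp
      have h2 := Finset.card_le_card h1
      rw [Finset.card_singleton] at h2
      have h3 : (((B.erase a).filter
        (· ∈ (SimpleGraph.Walk.nil : G.Walk u u).support)).card : ℝ) ≤ 1 := by exact_mod_cast h2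
      rw [Finset.mem_erase] at hu
      have := hB a ha u hu.2 hu.1.symm
      simp only [length, SimpleGraph.Walk.edges_nil, Multiset.coe_nil, Multiset.map_zero,
        Multiset.sum_zero]
      nlinarith
    · rw [Finset.filter_eq_empty_iff.2]
      · have := hc.nonneg s(a, u)
        simpa [length] using this
      · rintro v hv hvu
        simp only [SimpleGraph.Walk.support_nil, List.mem_singleton] at hvu
        exact hu (hvu ▸ hv)
  | @cons u u' w h p ih =>
    intro a ha
    have hlen : length c ((SimpleGraph.Walk.cons h p).edges : Multiset (Sym2 V)) =
        c s(u, u') + length c (p.edges : Multiset (Sym2 V)) := by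
      simp [length]
    rw [hlen]
    by_cases hu : u ∈ B
    · have h1 := ih u hu
      by_cases hau : u = a
      · subst hau
        have : (B.erase u).filter (· ∈ (SimpleGraph.Walk.cons h p).support) =
            (B.erase u).filter (· ∈ p.support) := by
          refine Finset.filter_congr fun v hv => ?_
          simp [Finset.ne_of_mem_erase hv]
        rw [this]
        linarith [hc.nonneg s(u, u)]
      · have hsub : (B.erase a).filter (· ∈ (SimpleGraph.Walk.cons h p).support) ⊆
            insert u ((B.erase u).filter (· ∈ p.support)) := by
          intro v
          simp only [Finset.mem_filter, Finset.mem_erase, Finset.mem_insert,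
            SimpleGraph.Walk.support_cons, List.mem_cons]
          tauto
        have h2 := (Finset.card_le_card hsub).trans (Finset.card_insert_le _ _)
        have h3 : (((B.erase a).filter (· ∈ (SimpleGraph.Walk.cons h p).support)).card : ℝ) ≤
          (((B.erase u).filter (· ∈ p.support)).card : ℝ) + 1 := by exact_mod_cast h2
        have := hB a ha u hu (Ne.symm hau)
        nlinarith
    · have : (B.erase a).filter (· ∈ (SimpleGraph.Walk.cons h p).support) =
          (B.erase a).filter (· ∈ p.support) := by
        refine Finset.filter_congr fun v hv => ?_
        have : v ≠ u := by
          rintro rfl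
          exact hu (Finset.mem_of_mem_erase hv)
        simp [this]
      rw [this]
      have h1 := ih a ha
      have h2 := hc.triangle a u u'
      linarith

/-- The tour is started at `x`, which joins the separated set as initial anchor and is itself not
counted. -/
lemma mul_card_le_length {V : Type*} [DecidableEq V] {c : Sym2 V → ℝ}
    (hc : IsMetric c) {t : ℝ} {B : Finset V}
    (hB : ∀ u ∈ B, ∀ v ∈ B, u ≠ v → t ≤ c s(u, v)) (ht : 0 ≤ t) {x : V} (hx : x ∉ B)
    (hBx : ∀ v ∈ B, t ≤ c s(v, x)) {T : Multiset (Sym2 V)} (hT : IsTour T) :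
    t * (B.card : ℝ) ≤ length c T := by
  obtain ⟨p, hp, rfl⟩ := exists_hamiltonianCycle_of_isTour hT x
  have h := mul_card_le_of_separated hc (t := t) (B := insert x B) ?_ ht p x (by simp)
  · rw [Finset.erase_insert hx, Finset.filter_true_of_mem (fun v _ => hp.mem_support v),
      hc.self_zero, zero_add] at h
    exact h
  · intro u hu v hv huv
    rw [Finset.mem_insert] at hu hv
    rcases hu with rfl | hu <;> rcases hv with rfl | hv
    · exact absurd rfl huv
    · rw [Sym2.eq_swap]
      exact hBx v hv
    · exact hBx u hu
    · exact hB u hu v hv huv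

lemma le_length_tour {V : Type*} [DecidableEq V] {c : Sym2 V → ℝ}
    (hc : IsMetric c) {x v : V} (hv : v ≠ x)
    {T : Multiset (Sym2 V)} (hT : IsTour T) : c s(v, x) ≤ length c T := by
  have := mul_card_le_length hc (t := c s(v, x)) (B := {v}) (x := x) (by simp)
    (hc.nonneg _) (by simpa using hv.symm) (by simp) hT
  simpa using this

end Tours

/-! ### Upper bound: potentials and a harmonic sum -/

section UpperBound

lemma savings_mk {V : Type*} (c : Sym2 V → ℝ) (x a b : V) :
    savings c x s(a, b) = c s(a, x) + c s(b, x) - c s(a, b) := by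
  have : spokes x s(a, b) = {s(a, x)} + {s(b, x)} := by
    simp [spokes, Sym2.toMultiset]
    rfl
  rw [savings, this]
  simp [length]

/-- Each vertex has at most one conflict with a vertex of larger `τ`, so the conflicts form a forest
oriented upward. Colors are assigned by decreasing `τ`, each vertex avoiding the color of its unique
successor. -/
lemma exists_alternating_coloring {V : Type*} {τ : V → ℕ} {K : ℕ} (hK : ∀ v, τ v ≤ K)
    {C : V → V → Prop} (hlt : ∀ v w, C v w → τ v < τ w)
    (huniq : ∀ v w w', C v w → C v w' → w = w') :
    ∃ col : V → Bool, ∀ v w, C v w → col v ≠ col w := by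
  classical
  have key : ∀ k, ∃ col : V → Bool, ∀ v w, K ≤ τ v + k → C v w → col v ≠ col w := by
    intro k
    induction k with
    | zero =>
      refine ⟨fun _ => true, fun v w h hC => ?_⟩
      have := hlt v w hC
      have := hK w
      omega
    | succ k ih =>
      obtain ⟨col, hcol⟩ := ih
      refine ⟨fun v => if h : τ v + k + 1 = K ∧ ∃ w, C v w then !col h.2.choose else col v,
        fun v w h hC => ?_⟩
      have hvw := hlt v w hC
      by_cases hv : τ v + k + 1 = K
      · have hex : ∃ w, C v w := ⟨w, hC⟩
        have hw : ¬ τ w + k + 1 = K := by omega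
        have : hex.choose = w := huniq _ _ _ hex.choose_spec hC
        simp [hv, hw, hex, this]
      · have hw : ¬ τ w + k + 1 = K := by omega
        simp only [hv, hw, false_and, dite_false]
        exact hcol v w (by omega) hC
  obtain ⟨col, hcol⟩ := key K
  exact ⟨col, fun v w => hcol v w (by omega)⟩

/-- If `a` minimizes `f` among `n` elements, then with `t = f a` all of them are counted, so `f a ≤
K / n`. Removing minima one by one adds up these bounds. -/
lemma sum_le_mul_harmonic {α : Type*} (f : α → ℝ) (K : ℝ) (n : ℕ) :
    ∀ A : Finset α, A.card = n → (∀ a ∈ A, 0 ≤ f a) →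
      (∀ t : ℝ, 0 < t → t * ((A.filter (fun a => t ≤ f a)).card : ℝ) ≤ K) →
      ∑ a ∈ A, f a ≤ K * (harmonic n : ℝ) := by
  classical
  induction n with
  | zero =>
    intro A hA _ _
    rw [Finset.card_eq_zero] at hA
    simp [hA]
  | succ n ih =>
    intro A hA hf hK
    obtain ⟨a, ha, hmin⟩ := A.exists_min_image f (Finset.card_pos.1 (by omega))
    have hn : (0 : ℝ) < (n : ℝ) + 1 := by positivity
    have hK0 : 0 ≤ K := by
      have := hK 1 one_pos
      have h2 : (0 : ℝ) ≤ 1 * ((A.filter (fun a => 1 ≤ f a)).card : ℝ) := by positivity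
      linarith
    have h1 : f a ≤ K * (1 / ((n : ℝ) + 1)) := by
      rcases (hf a ha).eq_or_lt with h0 | h0
      · rw [← h0]
        positivity
      · have := hK (f a) h0
        rw [Finset.filter_true_of_mem hmin, hA] at this
        rw [mul_one_div, le_div_iff₀ hn]
        exact_mod_cast this
    have h2 := ih (A.erase a) (by rw [Finset.card_erase_of_mem ha, hA]; rfl)
      (fun b hb => hf b (Finset.mem_of_mem_erase hb)) (fun t ht => by
        refine le_trans ?_ (hK t ht)
        have := Finset.card_le_card
          (Finset.filter_subset_filter (fun a => t ≤ f a) (A.erase_subset a))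
        gcongr)
    rw [← Finset.add_sum_erase _ _ ha, harmonic_succ]
    push_cast
    rw [mul_add]
    have h3 : ((n : ℝ) + 1)⁻¹ = 1 / ((n : ℝ) + 1) := by rw [one_div]
    rw [h3]
    linarith

variable {V : Type*} [Fintype V]

/-- Double counting of the incidences between vertices and edges. -/
lemma sum_edges_sum_mem [DecidableEq V] (G : SimpleGraph V) (f : V → ℝ) :
    ∑ e ∈ (Set.toFinite G.edgeSet).toFinset, ∑ v ∈ Finset.univ.filter (· ∈ e), f v =
      ∑ v, (deg G v : ℝ) * f v := by
  classical
  simp_rw [Finset.sum_filter]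
  rw [Finset.sum_comm]
  refine Finset.sum_congr rfl fun v _ => ?_
  rw [← Finset.sum_filter, Finset.sum_const, nsmul_eq_mul]
  congr 2
  rw [deg, ← Set.ncard_coe_finset, ← Set.ncard_image_of_injective (f := fun w => s(v, w))
    (G.neighborSet v) (fun a b h => Sym2.congr_right.1 h)]
  congr 1
  ext e
  simp only [Finset.coe_filter, Set.Finite.mem_toFinset, Set.mem_ofPred_eq, Set.mem_image,
    SimpleGraph.mem_neighborSet]
  constructor
  · rintro ⟨he, w, rfl⟩
    exact ⟨w, he, rfl⟩
  · rintro ⟨w, hw, rfl⟩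
    exact ⟨hw, by simp⟩

lemma sum_mem_mk [DecidableEq V] {a b : V} (hab : a ≠ b) (f : V → ℝ) :
    ∑ v ∈ Finset.univ.filter (· ∈ s(a, b)), f v = f a + f b := by
  rw [← Finset.sum_pair hab]
  congr 1
  ext v
  simp

lemma length_sum {V ι : Type*} (c : Sym2 V → ℝ) (A : Finset ι) (T : ι → Multiset (Sym2 V)) :
    length c (∑ i ∈ A, T i) = ∑ i ∈ A, length c (T i) := by
  classical
  induction A using Finset.induction_on with
  | empty => simp [length]
  | insert i A hi ih => rw [Finset.sum_insert hi, Finset.sum_insert hi, length_add, ih]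

lemma length_tourOf [DecidableEq V] (c : Sym2 V → ℝ) (x : V) (G : SimpleGraph V) :
    length c (tourOf x G) = ∑ e ∈ (Set.toFinite G.edgeSet).toFinset, c e +
      ∑ v ∈ Finset.univ.erase x, ((2 - deg G v : ℕ) : ℝ) * c s(v, x) := by
  rw [tourOf, length_add]
  congr 1
  rw [length_sum]
  refine Finset.sum_congr rfl fun v _ => ?_
  simp [length]

lemma exists_last_chosen {x : V} {L : List (Sym2 V)} (hL : ∀ e, e ∈ L ↔ ¬ e.IsDiag ∧ x ∉ e)
    (hcard : 3 ≤ Fintype.card V) {v : V} (hv : v ≠ x) :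
    ∃ i, (∃ hi : Chosen L i, v ∈ L[i]'hi.1) ∧
      ∀ j, (∃ hj : Chosen L j, v ∈ L[j]'hj.1) → j ≤ i := by
  classical
  have hpos := one_le_deg (fun u v => reachable_final hL) hcard hv
  have hex : ∃ w, (runGraph L L.length).Adj v w := by
    by_contra! h
    rw [deg_eq_zero.2 h] at hpos
    omega
  obtain ⟨w, hw⟩ := hex
  obtain ⟨j, hj, hc, hje⟩ := exists_chosen_of_adj hw
  refine ⟨Nat.findGreatest (fun i => ∃ hi : Chosen L i, v ∈ L[i]'hi.1) L.length, ?_, ?_⟩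
  · exact Nat.findGreatest_spec (P := fun i => ∃ hi : Chosen L i, v ∈ L[i]'hi.1) hj.le
      ⟨hc, by rw [hje]; simp⟩
  · intro i hi
    exact Nat.le_findGreatest hi.1.1.le hi

/-- Potentials of the vertices that bound the lengths of the chosen edges, and a partition of
the vertices into two classes, in each of which the vertices are far apart compared to their
potentials. -/
lemma exists_potential {c : Sym2 V → ℝ} (hc : IsMetric c) {x : V} {L : List (Sym2 V)}
    (hL : IsSavingsOrder c x L) (hcard : 3 ≤ Fintype.card V) :
    ∃ (ρ : V → ℝ) (col : V → Bool), (∀ v, v ≠ x → 0 ≤ ρ v ∧ ρ v ≤ c s(v, x)) ∧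
      (∀ a b, (runGraph L L.length).Adj a b → c s(a, b) ≤ ρ a + ρ b) ∧
      ∀ u v, u ≠ x → v ≠ x → u ≠ v → col u = col v → min (ρ u) (ρ v) ≤ c s(u, v) := by
  classical
  obtain ⟨hnd, hmem, hpw⟩ := hL
  have hP : Proper x L := fun e he => (hmem e).1 he
  have hlast : ∀ v, ∃ i, v ≠ x → (∃ hi : Chosen L i, v ∈ L[i]'hi.1) ∧
      ∀ j, (∃ hj : Chosen L j, v ∈ L[j]'hj.1) → j ≤ i := by
    intro v
    by_cases hv : v = x
    · exact ⟨0, fun h => absurd hv h⟩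
    · obtain ⟨i, hi⟩ := exists_last_chosen hmem hcard hv
      exact ⟨i, fun _ => hi⟩
  -- `τ v` is the index of the last chosen pair containing `v`. Just before it is joined, `v` still
  -- has degree at most one.
  choose τ hτ using hlast
  have hsav : ∀ i j (hi : i < L.length) (hj : j < L.length), i ≤ j →
      savings c x L[j] ≤ savings c x L[i] := by
    intro i j hi hj hij
    rcases hij.eq_or_lt with rfl | hij
    · exact le_rfl
    · exact List.pairwise_iff_getElem.1 hpw i j hi hj hij
  have hdeg : ∀ v, v ≠ x → deg (runGraph L (τ v)) v ≤ 1 := by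
    intro v hv
    obtain ⟨⟨hi, hvi⟩, -⟩ := hτ v hv
    exact hi.2.2 v hvi
  have hdeg' : ∀ v w, w ≠ x → τ v ≤ τ w → deg (runGraph L (τ v)) w ≤ 1 := fun v w hw h =>
    (deg_mono (runGraph_mono L h) w).trans (hdeg w hw)
  -- The conflicting pairs: `w` is the opposite end of the path of `v` at time `τ v`. As a path has
  -- only two ends, `w` is unique.
  let C : V → V → Prop := fun v w => v ≠ x ∧ w ≠ x ∧ v ≠ w ∧ τ v < τ w ∧
    (runGraph L (τ v)).Reachable v w
  obtain ⟨col, hcol⟩ : ∃ col : V → Bool, ∀ v w, C v w → col v ≠ col w := by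
    refine exists_alternating_coloring (τ := τ) (K := ∑ v, τ v)
      (fun v => Finset.single_le_sum (fun _ _ => Nat.zero_le _) (Finset.mem_univ v))
      (fun v w h => h.2.2.2.1) ?_
    rintro v w w' ⟨hv, hw, hvw, hlt, hr⟩ ⟨-, hw', hvw', hlt', hr'⟩
    exact (isPathSystem_runGraph hP (τ v)).end_unique hr hr' hvw hvw' (hdeg v hv)
      (hdeg' v w hw hlt.le) (hdeg' v w' hw' hlt'.le)
  -- The default value is never used for a city other than `x`.
  let σ : V → ℝ := fun v => if h : τ v < L.length then savings c x L[τ v] else 0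
  have hσ : ∀ v, v ≠ x → ∃ (h : τ v < L.length), σ v = savings c x L[τ v] := by
    intro v hv
    obtain ⟨⟨hi, -⟩, -⟩ := hτ v hv
    exact ⟨hi.1, by simp [σ, hi.1]⟩
  have hσ0 : ∀ v, v ≠ x → 0 ≤ σ v ∧ σ v ≤ 2 * c s(v, x) := by
    intro v hv
    obtain ⟨⟨hi, hvi⟩, -⟩ := hτ v hv
    obtain ⟨h, hs⟩ := hσ v hv
    obtain ⟨w, hw⟩ := hvi
    rw [hs, hw, savings_mk]
    have h1 := hc.triangle v x w
    have h2 := hc.triangle w v x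
    rw [Sym2.eq_swap (a := x) (b := w)] at h1
    rw [Sym2.eq_swap (a := w) (b := v)] at h2
    constructor <;> linarith
  -- The savings of a chosen pair are at least `σ` of either end. Splitting them equally between the
  -- ends bounds its length by the sum of these potentials.
  refine ⟨fun v => c s(v, x) - σ v / 2, col, ?_, ?_, ?_⟩
  · intro v hv
    have := hσ0 v hv
    constructor <;> linarith
  · intro a b hab
    obtain ⟨j, -, hj, hje⟩ := exists_chosen_of_adj hab
    have hmemL : s(a, b) ∈ L := hje ▸ List.getElem_mem hj.1
    have hx := (hP _ hmemL).2
    simp only [Sym2.mem_iff, not_or] at hx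
    have key : ∀ v, v ≠ x → v ∈ s(a, b) → σ v ≤ savings c x s(a, b) := by
      intro v hv hvab
      obtain ⟨h, hs⟩ := hσ v hv
      rw [hs, ← hje]
      exact hsav j (τ v) hj.1 h ((hτ v hv).2 j ⟨hj, by rw [hje]; exact hvab⟩)
    have h1 := key a (Ne.symm hx.1) (by simp)
    have h2 := key b (Ne.symm hx.2) (by simp)
    rw [savings_mk] at h1 h2
    linarith
  · have main : ∀ u v, u ≠ x → v ≠ x → u ≠ v → col u = col v → τ u ≤ τ v →
        c s(u, x) - σ u / 2 ≤ c s(u, v) := by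
      intro u v hu hv huv hcuv hle
      have hr : ¬ (runGraph L (τ u)).Reachable u v := by
        intro hr
        -- For equal times, `u` and `v` are the two cities of the same chosen pair, hence not yet
        -- connected; otherwise the coloring excludes a common path.
        rcases hle.eq_or_lt with heq | hlt
        · obtain ⟨⟨hi, hui⟩, -⟩ := hτ u hu
          obtain ⟨⟨hi', hvi⟩, -⟩ := hτ v hv
          have hvi : v ∈ L[τ u]'hi.1 := by
            convert hvi using 2
          exact hi.2.1 u hui v hvi huv hr
        · exact hcol u v ⟨hu, hv, huv, hlt, hr⟩ hcuv
      have hm : s(u, v) ∈ L := by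
        rw [hmem]
        simp [huv, hu.symm, hv.symm]
      obtain ⟨j, hj, hje⟩ := List.getElem_of_mem hm
      -- Both cities are still ends of different paths, so their pair cannot have been treated
      -- earlier and its savings are at most `σ u`.
      have hjle : τ u ≤ j := by
        by_contra hlt
        exact hr (not_joinable_of_lt hj (by omega) huv hje (hdeg u hu) (hdeg' u v hv hle))
      obtain ⟨h, hs⟩ := hσ u hu
      have h1 := hsav (τ u) j h hj hjle
      rw [hje, savings_mk, ← hs] at h1
      -- Adding this to the savings inequality eliminates the distance from `v` to `x` and leaves
      -- twice the claim.
      have h2 := hc.triangle u v x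
      linarith
    intro u v hu hv huv hcuv
    rcases le_total (τ u) (τ v) with h | h
    · exact (min_le_left _ _).trans (main u v hu hv huv hcuv h)
    · refine (min_le_right _ _).trans ?_
      rw [Sym2.eq_swap]
      exact main v u hv hu huv.symm hcuv.symm h

/-- The result of the savings heuristic is longer than any tour by at most a logarithmic factor. -/
theorem length_output_le [DecidableEq V] {c : Sym2 V → ℝ} (hc : IsMetric c) {x : V}
    {E : Multiset (Sym2 V)} (hE : IsOutput c x E) (hcard : 3 ≤ Fintype.card V)
    {S : Multiset (Sym2 V)} (hS : IsTour S) :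
    length c E ≤ (4 * harmonic (Fintype.card V) + 2) * length c S := by
  classical
  obtain ⟨L, hL, rfl⟩ := hE
  have hP : Proper x L := fun e he => (hL.2.1 e).1 he
  rw [foldl_step_start hP]
  have hG := isPathSystem_runGraph hP L.length
  have hr : ∀ u v, u ≠ x → v ≠ x → (runGraph L L.length).Reachable u v :=
    fun u v => reachable_final hL.2.1
  obtain ⟨ρ, col, hρ, hadj, hsep⟩ := exists_potential hc hL hcard
  set G := runGraph L L.length
  have hS0 := length_nonneg hc S
  have hclass : ∀ (t : ℝ), 0 < t → ∀ b : Bool, t * (((Finset.univ.erase x).filter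
      (fun v => t ≤ ρ v ∧ col v = b)).card : ℝ) ≤ length c S := by
    intro t ht b
    refine mul_card_le_length hc ?_ ht.le (x := x) (by simp) ?_ hS
    · intro u hu v hv huv
      simp only [Finset.mem_filter, Finset.mem_erase] at hu hv
      exact (le_min hu.2.1 hv.2.1).trans
        (hsep u v hu.1.1 hv.1.1 huv (hu.2.2.trans hv.2.2.symm))
    · intro v hv
      simp only [Finset.mem_filter, Finset.mem_erase] at hv
      exact hv.2.1.trans (hρ v hv.1.1).2
  have hsum : ∑ v ∈ Finset.univ.erase x, ρ v ≤
      2 * length c S * (harmonic (Fintype.card V - 1) : ℝ) := by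
    -- Each of the two color classes contributes at most one tour length, whence the factor two.
    refine sum_le_mul_harmonic ρ _ _ _ (by simp) (fun v hv => (hρ v (Finset.ne_of_mem_erase hv)).1)
      fun t ht => ?_
    have hsplit : ((Finset.univ.erase x).filter (fun v => t ≤ ρ v)).card =
        ((Finset.univ.erase x).filter (fun v => t ≤ ρ v ∧ col v = true)).card +
        ((Finset.univ.erase x).filter (fun v => t ≤ ρ v ∧ col v = false)).card := by
      rw [← Finset.card_filter_add_card_filter_not (p := fun v => col v = true),
        Finset.filter_filter, Finset.filter_filter]
      simp
    rw [hsplit]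
    push_cast
    have := hclass t ht true
    have := hclass t ht false
    linarith
  have hharm : (harmonic (Fintype.card V - 1) : ℝ) ≤ harmonic (Fintype.card V) := by
    have : Fintype.card V = (Fintype.card V - 1) + 1 := by omega
    conv_rhs => rw [this, harmonic_succ]
    push_cast
    have : (0 : ℝ) ≤ (((Fintype.card V - 1 : ℕ) : ℝ) + 1)⁻¹ := by positivity
    linarith
  have hedges : ∑ e ∈ (Set.toFinite G.edgeSet).toFinset, c e ≤
      2 * ∑ v ∈ Finset.univ.erase x, ρ v := by
    calc ∑ e ∈ (Set.toFinite G.edgeSet).toFinset, c e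
        ≤ ∑ e ∈ (Set.toFinite G.edgeSet).toFinset, ∑ v ∈ Finset.univ.filter (· ∈ e), ρ v := by
          refine Finset.sum_le_sum fun e he => ?_
          rw [Set.Finite.mem_toFinset] at he
          induction e with | _ a b
          rw [sum_mem_mk (SimpleGraph.Adj.ne he)]
          exact hadj a b he
      _ = ∑ v, (deg G v : ℝ) * ρ v := sum_edges_sum_mem G ρ
      _ = ∑ v ∈ Finset.univ.erase x, (deg G v : ℝ) * ρ v := by
          rw [← Finset.add_sum_erase _ _ (Finset.mem_univ x), deg_eq_zero.2 hG.isolated]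
          simp
      _ ≤ ∑ v ∈ Finset.univ.erase x, 2 * ρ v := by
          refine Finset.sum_le_sum fun v hv => ?_
          have h1 := (hρ v (Finset.ne_of_mem_erase hv)).1
          have h2 : (deg G v : ℝ) ≤ 2 := by exact_mod_cast hG.deg_le v
          exact mul_le_mul_of_nonneg_right h2 h1
      _ = _ := by rw [Finset.mul_sum]
  have hspokes : ∑ v ∈ Finset.univ.erase x, ((2 - deg G v : ℕ) : ℝ) * c s(v, x) ≤
      2 * length c S := by
    calc ∑ v ∈ Finset.univ.erase x, ((2 - deg G v : ℕ) : ℝ) * c s(v, x)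
        ≤ ∑ v ∈ Finset.univ.erase x, ((2 - deg G v : ℕ) : ℝ) * length c S := by
          refine Finset.sum_le_sum fun v hv => ?_
          exact mul_le_mul_of_nonneg_left (le_length_tour hc (Finset.ne_of_mem_erase hv) hS)
            (by positivity)
      _ = 2 * length c S := by
          rw [← Finset.sum_mul, ← Nat.cast_sum, sum_free_eq_two hG hr hcard]
          norm_num
  rw [length_tourOf]
  have := mul_le_mul_of_nonneg_left hharm (mul_nonneg zero_le_two hS0)
  linarith

end UpperBound

/-! ### The approximation ratio: attainment and transfer to larger instances -/

section Ratio

/-- There is an instance with `n` cities for which the heuristic can output a tour that is more than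
`r` times as long as some tour. -/
def ExceedsRatio (n : ℕ) (r : ℝ) : Prop :=
  ∃ (V : Type) (_ : Fintype V) (_ : DecidableEq V) (c : Sym2 V → ℝ) (x : V)
    (E S : Multiset (Sym2 V)), Fintype.card V = n ∧ IsMetric c ∧ IsOutput c x E ∧ IsTour S ∧
      r * length c S < length c E

lemma savings_nonneg {V : Type*} {c : Sym2 V → ℝ} (hc : IsMetric c) (x : V) (e : Sym2 V) :
    0 ≤ savings c x e := by
  induction e with | _ a b
  rw [savings_mk]
  have := hc.triangle a x b
  rw [Sym2.eq_swap (a := x) (b := b)] at this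
  linarith

/-- The length of the Eulerian tour is the initial length minus the realized savings. -/
lemma length_tourOf_eq_sub {V : Type*} [Fintype V] [DecidableEq V] {c : Sym2 V → ℝ}
    (hc : IsMetric c) {x : V} {G : SimpleGraph V} (hG : IsPathSystem x G) :
    length c (tourOf x G) = ∑ v, 2 * c s(v, x) -
      ∑ e ∈ (Set.toFinite G.edgeSet).toFinset, savings c x e := by
  have h1 : ∑ e ∈ (Set.toFinite G.edgeSet).toFinset, savings c x e =
      ∑ v, (deg G v : ℝ) * c s(v, x) - ∑ e ∈ (Set.toFinite G.edgeSet).toFinset, c e := by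
    rw [← sum_edges_sum_mem G (fun v => c s(v, x)), ← Finset.sum_sub_distrib]
    refine Finset.sum_congr rfl fun e he => ?_
    rw [Set.Finite.mem_toFinset] at he
    induction e with | _ a b
    rw [savings_mk, sum_mem_mk (SimpleGraph.Adj.ne he)]
  rw [h1, length_tourOf, ← Finset.add_sum_erase _ _ (Finset.mem_univ x),
    ← Finset.add_sum_erase Finset.univ (fun v => (deg G v : ℝ) * c s(v, x)) (Finset.mem_univ x),
    hc.self_zero]
  have h2 : ∑ v ∈ Finset.univ.erase x, ((2 - deg G v : ℕ) : ℝ) * c s(v, x) =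
      ∑ v ∈ Finset.univ.erase x, 2 * c s(v, x) -
        ∑ v ∈ Finset.univ.erase x, (deg G v : ℝ) * c s(v, x) := by
    rw [← Finset.sum_sub_distrib]
    refine Finset.sum_congr rfl fun v _ => ?_
    rw [Nat.cast_sub (hG.deg_le v)]
    push_cast
    ring
  rw [h2]
  ring

/-- By `length_tourOf_eq_sub` the length changes only by realized savings, so it does not matter
which of these pairs are chosen. -/
lemma length_foldl_of_savings_eq_zero {V : Type*} [Fintype V] [DecidableEq V] {c : Sym2 V → ℝ}
    (hc : IsMetric c) {x : V} {N : List (Sym2 V)} (hN : Proper x N)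
    (h0 : ∀ e ∈ N, savings c x e = 0) : ∀ G : SimpleGraph V, IsPathSystem x G →
      length c (tourOf x (N.foldl joinEdge G)) = length c (tourOf x G) := by
  classical
  induction N with
  | nil => exact fun G _ => rfl
  | cons e N ih =>
    intro G hG
    have hG' := hG.joinEdge (hN e (by simp)).1 (hN e (by simp)).2
    rw [List.foldl_cons, ih (fun f hf => hN f (by simp [hf])) (fun f hf => h0 f (by simp [hf])) _
      hG', length_tourOf_eq_sub hc hG', length_tourOf_eq_sub hc hG]
    congr 1
    unfold joinEdge
    split_ifs with hj
    · have hE : (Set.toFinite (G ⊔ SimpleGraph.fromEdgeSet {e}).edgeSet).toFinset =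
          insert e (Set.toFinite G.edgeSet).toFinset := by
        ext f
        simp only [Set.Finite.mem_toFinset, SimpleGraph.edgeSet_sup,
          SimpleGraph.edgeSet_fromEdgeSet, Set.mem_union, Set.mem_sdiff, Set.mem_singleton_iff,
          Finset.mem_insert]
        constructor
        · tauto
        · rintro (rfl | h)
          · exact Or.inr ⟨rfl, (hN f (by simp)).1⟩
          · exact Or.inl h
      rw [hE]
      by_cases he : e ∈ (Set.toFinite G.edgeSet).toFinset
      · rw [Finset.insert_eq_of_mem he]
      · rw [Finset.sum_insert he, h0 e (by simp), zero_add]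
    · rfl

/-- The projection that identifies the additional city with `x`. -/
def collapse {V : Type*} (x : V) (o : Option V) : V := o.getD x

lemma reachable_map_some {V : Type*} {G : SimpleGraph V} {a b : V} :
    (G.map Function.Embedding.some).Reachable (some a) (some b) ↔ G.Reachable a b := by
  constructor
  · intro h
    let f : G.map Function.Embedding.some →g G :=
      { toFun := collapse a
        map_rel' := by
          intro u v h
          rw [SimpleGraph.map_adj] at h
          obtain ⟨u, v, h, rfl, rfl⟩ := h
          exact h }
    exact h.map f
  · intro h
    exact h.map (SimpleGraph.Embedding.map Function.Embedding.some G).toHom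

lemma deg_map_some {V : Type*} {G : SimpleGraph V} (a : V) :
    deg (G.map Function.Embedding.some) (some a) = deg G a := by
  have : (G.map Function.Embedding.some).neighborSet (some a) = some '' G.neighborSet a :=
    SimpleGraph.neighborSet_map _ Function.Embedding.some a
  rw [deg, this]
  exact Set.ncard_image_of_injective (G.neighborSet a) (Option.some_injective V)

/-- The added city stays isolated while only old pairs are treated, so the run on the enlarged
instance begins as a copy of the old run. -/
lemma joinEdge_map_some {V : Type*} (G : SimpleGraph V) (e : Sym2 V) :
    joinEdge (G.map Function.Embedding.some) (e.map some) =
      (joinEdge G e).map Function.Embedding.some := by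
  have hj : Joinable (G.map Function.Embedding.some) (e.map some) ↔ Joinable G e := by
    simp only [Joinable, Sym2.mem_map, forall_exists_index, and_imp, forall_apply_eq_imp_iff₂,
      reachable_map_some, deg_map_some, ne_eq, Option.some.injEq]
  unfold joinEdge
  by_cases hJ : Joinable G e
  · rw [if_pos (hj.2 hJ), if_pos hJ]
    induction e with | _ a b
    ext u v
    simp only [SimpleGraph.sup_adj, SimpleGraph.map_adj, SimpleGraph.fromEdgeSet_adj,
      Set.mem_singleton_iff, Sym2.map_mk, Sym2.eq_iff]
    constructor
    · rintro (⟨a', b', h, rfl, rfl⟩ | ⟨⟨rfl, rfl⟩ | ⟨rfl, rfl⟩, h⟩)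
      · exact ⟨a', b', Or.inl h, rfl, rfl⟩
      · exact ⟨a, b, Or.inr ⟨Or.inl ⟨rfl, rfl⟩, by simpa using h⟩, rfl, rfl⟩
      · exact ⟨b, a, Or.inr ⟨Or.inr ⟨rfl, rfl⟩, by simpa using h⟩, rfl, rfl⟩
    · rintro ⟨a', b', h | ⟨⟨rfl, rfl⟩ | ⟨rfl, rfl⟩, h⟩, rfl, rfl⟩
      · exact Or.inl ⟨a', b', h, rfl, rfl⟩
      · exact Or.inr ⟨Or.inl ⟨rfl, rfl⟩, by simpa using h⟩
      · exact Or.inr ⟨Or.inr ⟨rfl, rfl⟩, by simpa using h⟩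
  · rw [if_neg (mt hj.1 hJ), if_neg hJ]

lemma foldl_map_some {V : Type*} (L : List (Sym2 V)) : ∀ G : SimpleGraph V,
    (L.map (Sym2.map some)).foldl joinEdge (G.map Function.Embedding.some) =
      (L.foldl joinEdge G).map Function.Embedding.some := by
  induction L with
  | nil => exact fun G => rfl
  | cons e L ih =>
    intro G
    rw [List.map_cons, List.foldl_cons, List.foldl_cons, joinEdge_map_some, ih]

lemma pathEdges_map {V W : Type*} (f : V → W) (l : List V) :
    pathEdges (l.map f) = (pathEdges l).map (Sym2.map f) := by
  induction l with
  | nil => rfl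
  | cons a l ih =>
    cases l with
    | nil => rfl
    | cons b l => simpa [pathEdges] using ih

lemma savings_map {V W : Type*} (c : Sym2 V → ℝ) (f : W → V) (x : W) (e : Sym2 W) :
    savings (fun e => c (e.map f)) x e = savings c (f x) (e.map f) := by
  induction e with | _ a b
  rw [savings_mk, Sym2.map_mk]
  exact (savings_mk c (f x) (f a) (f b)).symm

/-- Adding a copy of the city `x` shows that the approximation ratio does not decrease. -/
lemma ExceedsRatio.succ {n : ℕ} {r : ℝ} (hn : 3 ≤ n) (h : ExceedsRatio n r) :
    ExceedsRatio (n + 1) r := by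
  classical
  obtain ⟨V, _, _, c, x, E, S, hcard, hc, ⟨L, hL, rfl⟩, hS, hlt⟩ := h
  set c' : Sym2 (Option V) → ℝ := fun e => c (e.map (collapse x)) with hc'
  have hmet : IsMetric c' :=
    ⟨fun e => hc.nonneg _, fun v => hc.self_zero _, fun u v w => hc.triangle _ _ _⟩
  have hcs : ∀ e : Sym2 V, (e.map some).map (collapse x) = e := by
    intro e
    rw [Sym2.map_map]
    exact congrFun Sym2.map_id e
  -- All pairs with the new copy of `x`. Their savings are zero and all savings are nonnegative, so
  -- they may be put at the end in any order.
  set N : List (Sym2 (Option V)) :=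
    (Finset.univ.filter (fun e => ¬ e.IsDiag ∧ some x ∉ e ∧ none ∈ e)).toList with hNdef
  have hN : ∀ e, e ∈ N ↔ ¬ e.IsDiag ∧ some x ∉ e ∧ none ∈ e := by simp [hNdef]
  have hN0 : ∀ e ∈ N, savings c' (some x) e = 0 := by
    intro e he
    obtain ⟨-, -, v, rfl⟩ := (hN e).1 he
    rw [savings_map, Sym2.map_mk, savings_mk]
    change c s(x, x) + c s(collapse x v, x) - c s(x, collapse x v) = 0
    rw [hc.self_zero, Sym2.eq_swap (a := x)]
    ring
  have hP : Proper x L := fun e he => (hL.2.1 e).1 he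
  have hmapmem : ∀ e : Sym2 V, ¬ (e.map some).IsDiag ∧ some x ∉ e.map some ↔
      ¬ e.IsDiag ∧ x ∉ e := by
    intro e
    induction e with | _ a b
    simp
  have hPN : Proper (some x) N := fun e he => ⟨((hN e).1 he).1, ((hN e).1 he).2.1⟩
  have hPM : Proper (some x) (L.map (Sym2.map some)) := by
    intro e he
    rw [List.mem_map] at he
    obtain ⟨e, he, rfl⟩ := he
    exact (hmapmem e).2 (hP e he)
  have hPL' : Proper (some x) (L.map (Sym2.map some) ++ N) := by
    intro e he
    rw [List.mem_append] at he
    exact he.elim (hPM e) (hPN e)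
  have hord : IsSavingsOrder c' (some x) (L.map (Sym2.map some) ++ N) := by
    refine ⟨?_, ?_, ?_⟩
    · rw [List.nodup_append]
      refine ⟨hL.1.map (Sym2.map.injective (Option.some_injective V)), Finset.nodup_toList _, ?_⟩
      rintro e he f hf rfl
      rw [List.mem_map] at he
      obtain ⟨e, he, rfl⟩ := he
      have := ((hN _).1 hf).2.2
      rw [Sym2.mem_map] at this
      obtain ⟨v, -, hv⟩ := this
      exact absurd hv (by simp)
    · intro e
      refine ⟨fun he => hPL' e he, fun he => ?_⟩
      rw [List.mem_append]
      by_cases hnone : none ∈ e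
      · exact Or.inr ((hN e).2 ⟨he.1, he.2, hnone⟩)
      · left
        have : ∃ f : Sym2 V, f.map some = e := by
          induction e with | _ a b
          simp only [Sym2.mem_iff, not_or] at hnone
          obtain ⟨a, rfl⟩ := Option.ne_none_iff_exists'.1 (Ne.symm hnone.1)
          obtain ⟨b, rfl⟩ := Option.ne_none_iff_exists'.1 (Ne.symm hnone.2)
          exact ⟨s(a, b), rfl⟩
        obtain ⟨f, rfl⟩ := this
        exact List.mem_map_of_mem ((hL.2.1 f).2 ((hmapmem f).1 he))
    · rw [List.pairwise_append]
      refine ⟨?_, ?_, ?_⟩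
      · rw [List.pairwise_map]
        refine hL.2.2.imp ?_
        intro e f h
        rw [savings_map, savings_map, hcs, hcs]
        exact h
      · refine List.pairwise_iff_getElem.2 fun i j hi hj _ => ?_
        rw [hN0 _ (List.getElem_mem hi), hN0 _ (List.getElem_mem hj)]
      · intro e he f hf
        rw [hN0 f hf]
        exact savings_nonneg hmet _ _
  have hG := isPathSystem_runGraph hP L.length
  have hGdef : runGraph L L.length = L.foldl joinEdge ⊥ := by rw [runGraph, List.take_length]
  rw [foldl_step_start hP] at hlt
  have hbot : (⊥ : SimpleGraph (Option V)) = (⊥ : SimpleGraph V).map Function.Embedding.some := by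
    ext u v
    simp only [SimpleGraph.map_adj, SimpleGraph.bot_adj, false_and, exists_false]
  have hGM : IsPathSystem (some x) ((runGraph L L.length).map Function.Embedding.some) := by
    rw [hGdef, ← foldl_map_some, ← hbot]
    exact isPathSystem_foldl hPM _ (IsPathSystem.bot _)
  have hlen : length c' ((L.map (Sym2.map some) ++ N).foldl (step (some x)) (start (some x))) =
      length c (tourOf x (runGraph L L.length)) := by
    rw [foldl_step_start hPL', runGraph, List.take_length, List.foldl_append, hbot, foldl_map_some,
      ← hGdef, length_foldl_of_savings_eq_zero hmet hPN hN0 _ hGM, length_tourOf_eq_sub hmet hGM,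
      length_tourOf_eq_sub hc hG, Fintype.sum_option]
    have h1 : c' s(none, some x) = 0 := hc.self_zero x
    have h2 : (Set.toFinite ((runGraph L L.length).map
        Function.Embedding.some).edgeSet).toFinset =
        (Set.toFinite (runGraph L L.length).edgeSet).toFinset.map
          (Function.Embedding.sym2Map Function.Embedding.some) := by
      ext e
      rw [Set.Finite.mem_toFinset, SimpleGraph.edgeSet_map]
      simp
    rw [h1, h2, Finset.sum_map]
    have h3 : ∀ e : Sym2 V, savings c' (some x)
        (Function.Embedding.sym2Map Function.Embedding.some e) = savings c x e := by
      intro e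
      have : Function.Embedding.sym2Map Function.Embedding.some e = e.map some := rfl
      rw [this, savings_map, hcs]
      rfl
    simp only [h3, mul_zero, zero_add]
    rfl
  obtain ⟨l, hnd, hmem, rfl⟩ := exists_list_of_isTour hS x
  have hll : (x :: l).length = n := by
    rw [← List.toFinset_card_of_nodup hnd, ← hcard, ← Finset.card_univ]
    congr 1
    ext v
    have := hmem v
    simpa using this
  rw [List.length_cons] at hll
  refine ⟨Option V, inferInstance, inferInstance, c', some x, _,
    (pathEdges (some x :: (none :: l.map some) ++ [some x]) : Multiset _), ?_, hmet,
    ⟨_, hord, rfl⟩, isTour_of_list ?_ ?_ ?_, ?_⟩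
  · rw [Fintype.card_option, hcard]
  · rw [List.nodup_cons] at hnd
    simp [List.nodup_cons, hnd.1, hnd.2.map (Option.some_injective V)]
  · rintro (_ | v)
    · simp
    · have := hmem v
      simpa using this
  · simp only [List.length_cons, List.length_map]
    omega
  · rw [hlen]
    -- The copy is visited immediately after `x`, at no cost.
    refine lt_of_le_of_lt (le_of_eq ?_) hlt
    congr 1
    have hl : ∀ l : List (Option V), length c' (pathEdges l : Multiset _) =
        length c (pathEdges (l.map (collapse x)) : Multiset _) := by
      intro l
      rw [pathEdges_map, length, length, ← Multiset.map_coe, Multiset.map_map]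
      rfl
    have hmm : (l.map some).map (collapse x) = l := by
      rw [List.map_map]
      exact List.map_id l
    rw [hl]
    simp only [List.cons_append, List.map_cons, List.map_append, List.map_nil, hmm]
    change length c (pathEdges (x :: x :: (l ++ [x])) : Multiset _) = _
    simp [pathEdges, length, hc.self_zero]

lemma ExceedsRatio.mono {m n : ℕ} {r : ℝ} (hm : 3 ≤ m) (hmn : m ≤ n) (h : ExceedsRatio m r) :
    ExceedsRatio n r := by
  induction n, hmn using Nat.le_induction with
  | base => exact h
  | succ k hk ih => exact ih.succ (by omega)

/-- An instance whose output has positive length excludes nonpositive factors, which bounds the set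
of guaranteed factors from below. All distances between different cities are one, so every order of
the pairs is admissible. -/
lemma exceedsRatio_zero {n : ℕ} (hn : 3 ≤ n) : ExceedsRatio n 0 := by
  classical
  set c : Sym2 (Fin n) → ℝ := fun e => if e.IsDiag then 0 else 1 with hc
  have hmet : IsMetric c := by
    refine ⟨fun e => ?_, fun v => by simp [hc], fun u v w => ?_⟩
    · simp only [hc]
      split_ifs <;> norm_num
    · simp only [hc, Sym2.mk_isDiag_iff]
      by_cases huv : u = v
      · subst huv
        split_ifs <;> norm_num
      · rw [if_neg huv]
        split_ifs <;> norm_num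
  have h0 : 0 < n := by omega
  set x : Fin n := ⟨0, h0⟩
  set L : List (Sym2 (Fin n)) := (Finset.univ.filter (fun e => ¬ e.IsDiag ∧ x ∉ e)).toList
  have hmem : ∀ e, e ∈ L ↔ ¬ e.IsDiag ∧ x ∉ e := by simp [L]
  have hs : ∀ e ∈ L, savings c x e = 1 := by
    intro e he
    rw [hmem] at he
    induction e with | _ a b
    simp only [Sym2.mem_iff, not_or, Sym2.mk_isDiag_iff] at he
    simp [savings_mk, hc, he.1, Ne.symm he.2.1, Ne.symm he.2.2]
  have hord : IsSavingsOrder c x L := by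
    refine ⟨Finset.nodup_toList _, hmem, ?_⟩
    refine List.pairwise_iff_getElem.2 fun i j hi hj _ => ?_
    rw [hs _ (List.getElem_mem hi), hs _ (List.getElem_mem hj)]
  have hout : IsOutput c x (L.foldl (step x) (start x)) := ⟨L, hord, rfl⟩
  have htour := isTour_of_isOutput hout (by simpa using hn)
  refine ⟨Fin n, inferInstance, inferInstance, c, x, _, _, by simp, hmet, hout, htour, ?_⟩
  rw [zero_mul]
  have hle := le_length_tour hmet (v := ⟨1, by omega⟩) (x := x) (by simp [x]) htour
  refine lt_of_lt_of_le ?_ hle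
  simp [hc, x]

lemma guaranteed_harmonic {n : ℕ} (hn : 3 ≤ n) : Guaranteed n (4 * harmonic n + 2) := by
  intro V _ _ hcard c hc x E hE
  subst hcard
  exact ⟨isTour_of_isOutput hE hn, fun S hS => length_output_le hc hE hn hS.1⟩

lemma ExceedsRatio.lt_of_guaranteed {n : ℕ} {r r' : ℝ} (hr : 0 ≤ r) (h : ExceedsRatio n r)
    (h' : Guaranteed n r') : r < r' := by
  obtain ⟨V, _, _, c, x, E, S, hcard, hc, hE, hS, hlt⟩ := h
  obtain ⟨S', hS'⟩ := exists_isShortestTour c hS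
  have h1 := (h' V hcard c hc x E hE).2 S' hS'
  have h2 := hS'.2 S hS
  have h3 := length_nonneg hc S'
  by_contra hle
  rw [not_lt] at hle
  have h4 := mul_le_mul_of_nonneg_right hle h3
  have h5 := mul_le_mul_of_nonneg_left h2 hr
  linarith

lemma bddBelow_guaranteed {n : ℕ} (hn : 3 ≤ n) : BddBelow {r : ℝ | Guaranteed n r} :=
  ⟨0, fun _ hr => ((exceedsRatio_zero hn).lt_of_guaranteed le_rfl hr).le⟩

/-- Each instance imposes a closed condition on the factor, so the infimum satisfies it too. -/
lemma isLeast_ratio {n : ℕ} (hn : 3 ≤ n) : IsLeast {r : ℝ | Guaranteed n r} (ratio n) := by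
  have hne : {r : ℝ | Guaranteed n r}.Nonempty := ⟨_, guaranteed_harmonic hn⟩
  have hbdd := bddBelow_guaranteed hn
  refine ⟨?_, fun r hr => csInf_le hbdd hr⟩
  intro V _ _ hcard c hc x E hE
  refine ⟨isTour_of_isOutput hE (hcard ▸ hn), fun S hS => ?_⟩
  -- Distances may vanish. If the shortest tour has length zero, the finite harmonic factor forces
  -- the output to have length zero as well.
  rcases (length_nonneg hc S).eq_or_lt with h0 | h0
  · have := (guaranteed_harmonic hn V hcard c hc x E hE).2 S hS
    rw [← h0, mul_zero] at this ⊢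
    exact this
  · rw [← div_le_iff₀ h0]
    refine le_csInf hne fun r hr => ?_
    rw [div_le_iff₀ h0]
    exact (hr V hcard c hc x E hE).2 S hS

lemma ratio_le_harmonic {n : ℕ} (hn : 3 ≤ n) : ratio n ≤ 4 * harmonic n + 2 :=
  (isLeast_ratio hn).2 (guaranteed_harmonic hn)

lemma ExceedsRatio.lt_ratio {n : ℕ} {r : ℝ} (hr : 0 ≤ r) (hn : 3 ≤ n) (h : ExceedsRatio n r) :
    r < ratio n :=
  h.lt_of_guaranteed hr (isLeast_ratio hn).1

end Ratio

/-! ### Forcing the heuristic to follow a prescribed path system -/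

section Prescribed

variable {V : Type*} [Fintype V]

/-- An edge of a path system `H` can be added to a part of `H` that does not contain it. -/
lemma joinable_of_le {x : V} {G H : SimpleGraph V} (hG : IsPathSystem x G) (hGH : G ≤ H)
    (hdeg : ∀ v, deg H v ≤ 2) (hend : ∀ v, ∃ w, H.Reachable v w ∧ deg H w ≤ 1) {a b : V}
    (hab : H.Adj a b) (hnot : ¬ G.Adj a b) : Joinable G s(a, b) := by
  have hne : a ≠ b := hab.ne
  have ha : deg G a ≤ 1 := by
    have := deg_lt_of_adj hGH hab hnot
    have := hdeg a
    omega
  have hb : deg G b ≤ 1 := by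
    have := deg_lt_of_adj hGH hab.symm (fun h => hnot h.symm)
    have := hdeg b
    omega
  -- If the edge closed a cycle, every vertex of this component would have degree two in `G` with
  -- the edge added. As `H` has no larger degrees, the component would be closed under adjacency in
  -- `H`, and it would contain no end, against `hend`.
  have hr : ¬ G.Reachable a b := by
    intro hr
    obtain ⟨da, db, dw⟩ := hG.deg_eq_of_ends hr hne ha hb
    have hle : G ⊔ SimpleGraph.edge a b ≤ H :=
      sup_le hGH ((SimpleGraph.edge_le_iff _).2 (Or.inr hab))
    have htwo : ∀ w, G.Reachable a w → deg (G ⊔ SimpleGraph.edge a b) w = 2 := by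
      intro w hw
      by_cases hwa : w = a
      · rw [hwa, deg_sup_edge_left hne hnot, da]
      by_cases hwb : w = b
      · rw [hwb, deg_sup_edge_right hne hnot, db]
      rw [deg_sup_edge_of_ne hwa hwb]
      exact dw w hw hwa hwb
    have hclosed : ∀ u w, H.Adj u w → G.Reachable a u → G.Reachable a w := by
      intro u w huw hu
      have hset : (G ⊔ SimpleGraph.edge a b).neighborSet u = H.neighborSet u := by
        refine Set.eq_of_subset_of_ncard_le (fun z hz => hle hz) ?_ (Set.toFinite _)
        exact (hdeg u).trans (htwo u hu).ge
      have hw : w ∈ (G ⊔ SimpleGraph.edge a b).neighborSet u := by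
        rw [hset]
        exact huw
      rw [SimpleGraph.mem_neighborSet, SimpleGraph.sup_adj, SimpleGraph.edge_adj] at hw
      rcases hw with hw | ⟨⟨-, rfl⟩ | ⟨-, rfl⟩, -⟩
      · exact hu.trans hw.reachable
      · exact hr
      · exact .refl _
    have hall : ∀ u w, H.Reachable u w → G.Reachable a u → G.Reachable a w := by
      rintro u w ⟨p⟩
      induction p with
      | nil => exact id
      | cons h p ih => exact fun hu => ih (hclosed _ _ h hu)
    obtain ⟨w, hw, dw'⟩ := hend a
    have h1 := htwo w (hall a w hw (.refl _))
    have h2 := deg_mono hle w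
    omega
  constructor
  · intro u hu v hv huv
    rw [Sym2.mem_iff] at hu hv
    rcases hu with rfl | rfl <;> rcases hv with rfl | rfl
    · exact absurd rfl huv
    · exact hr
    · exact fun h => hr h.symm
    · exact absurd rfl huv
  · intro u hu
    rw [Sym2.mem_iff] at hu
    rcases hu with rfl | rfl <;> assumption

/-- If the edges of the path system `H` come first among the pairs of the same length, and all other
short pairs are blocked by edges of `H` that are not longer, then only edges of `H` are chosen among
the short pairs. -/
lemma runGraph_le_of_blocked {x : V} {L : List (Sym2 V)} (hnd : L.Nodup)
    (hL : ∀ e, e ∈ L ↔ ¬ e.IsDiag ∧ x ∉ e) {H : SimpleGraph V} {c : Sym2 V → ℝ} {D : ℝ}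
    (hfirst : ∀ i j (hi : i < L.length) (hj : j < L.length), i < j → L[j] ∈ H.edgeSet →
      L[i] ∉ H.edgeSet → c L[i] < c L[j])
    (hx : ∀ w, ¬ H.Adj x w) (hdeg : ∀ v, deg H v ≤ 2)
    (hend : ∀ v, ∃ w, H.Reachable v w ∧ deg H w ≤ 1)
    (hrej : ∀ a b, a ≠ b → a ≠ x → b ≠ x → ¬ H.Adj a b → c s(a, b) < D →
      ∃ v ∈ s(a, b), 2 ≤ {w | H.Adj v w ∧ c s(v, w) ≤ c s(a, b)}.ncard) (i : ℕ) :
    (∀ j (hj : j < L.length), j < i → c L[j] < D) → runGraph L i ≤ H ∧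
      ∀ j (hj : j < L.length), j < i → L[j] ∈ H.edgeSet → L[j] ∈ (runGraph L i).edgeSet := by
  have hP : Proper x L := fun e he => (hL e).1 he
  induction i with
  | zero =>
    intro _
    rw [runGraph_zero]
    exact ⟨bot_le, fun j _ hj => absurd hj (Nat.not_lt_zero j)⟩
  | succ i ih =>
    intro hD
    obtain ⟨ih1, ih2⟩ := ih fun j hj hji => hD j hj (by omega)
    by_cases hi : i < L.length
    swap
    · rw [runGraph_succ_of_not_chosen fun h => hi h.1]
      exact ⟨ih1, fun j hj _ => ih2 j hj (by omega)⟩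
    by_cases hmem : L[i] ∈ H.edgeSet
    · have hJ : Joinable (runGraph L i) L[i] := by
        obtain ⟨⟨a, b⟩, hab⟩ := (Sym2.mk_surjective (L[i]) : _)
        have hab : s(a, b) = L[i] := hab
        rw [← hab] at hmem ⊢
        refine joinable_of_le (isPathSystem_runGraph hP i) ih1 hdeg hend hmem ?_
        intro hadj
        obtain ⟨j, hji, hc, hje⟩ := exists_chosen_of_adj hadj
        rw [hab] at hje
        have := (hnd.getElem_inj_iff).1 hje
        omega
      rw [runGraph_succ_of_chosen ⟨hi, hJ⟩]
      refine ⟨sup_le ih1 ?_, fun j hj hji hjH => ?_⟩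
      · intro u v huv
        rw [SimpleGraph.fromEdgeSet_adj] at huv
        have : s(u, v) = L[i] := huv.1
        rw [← this] at hmem
        exact hmem
      · rw [SimpleGraph.edgeSet_sup]
        rcases Nat.lt_succ_iff_lt_or_eq.1 hji with h | rfl
        · exact Or.inl (ih2 j hj h hjH)
        · right
          rw [SimpleGraph.edgeSet_fromEdgeSet]
          exact ⟨rfl, (hP _ (List.getElem_mem hj)).1⟩
    · have hc : ¬ Chosen L i := by
        rintro ⟨_, hJ⟩
        obtain ⟨⟨a, b⟩, hab⟩ := (Sym2.mk_surjective (L[i]) : _)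
        have hab : s(a, b) = L[i] := hab
        have hp := hP _ (List.getElem_mem hi)
        rw [← hab] at hp
        simp only [Sym2.mem_iff, not_or, Sym2.mk_isDiag_iff] at hp
        obtain ⟨v, hv, hcard⟩ := hrej a b hp.1 (Ne.symm hp.2.1) (Ne.symm hp.2.2)
          (fun h => hmem (hab ▸ h)) (hab ▸ hD i hi (by omega))
        rw [hab] at hv hcard
        -- The blocking edges are in `H` and not longer, so by the tie-breaking rule they come
        -- before the pair at `i` and, by induction, have been chosen; `v` is already saturated.
        have hsub : {w | H.Adj v w ∧ c s(v, w) ≤ c L[i]} ⊆ (runGraph L i).neighborSet v := by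
          rintro w ⟨hw, hcw⟩
          have hvx : x ≠ v := by rintro rfl; exact hx _ hw
          have hwx : x ≠ w := by rintro rfl; exact hx _ hw.symm
          have hm : s(v, w) ∈ L := (hL _).2 ⟨by simpa using hw.ne, by simp [hvx, hwx]⟩
          obtain ⟨m, hm, hme⟩ := List.getElem_of_mem hm
          have hmH : L[m] ∈ H.edgeSet := by rw [hme]; exact hw
          have hmi : m < i := by
            by_contra hmi
            rcases Nat.lt_or_ge i m with h | h
            · have := hfirst i m hi hm h hmH hmem
              rw [hme] at this
              linarith
            · obtain rfl : m = i := by omega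
              exact hmem hmH
          have := ih2 m hm hmi hmH
          rw [hme] at this
          exact this
        have h1 := hJ.2 v hv
        have h2 := Set.ncard_le_ncard hsub (Set.toFinite _)
        rw [deg] at h1
        omega
      rw [runGraph_succ_of_not_chosen hc]
      refine ⟨ih1, fun j hj hji hjH => ?_⟩
      rcases Nat.lt_succ_iff_lt_or_eq.1 hji with h | rfl
      · exact ih2 j hj h hjH
      · exact absurd hjH hmem

/-- The run is stopped right after this pair is chosen; everything treated up to then is no longer
than it, hence below the threshold `D`. -/
lemma adj_of_runGraph_adj {x : V} {L : List (Sym2 V)} (hnd : L.Nodup)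
    (hL : ∀ e, e ∈ L ↔ ¬ e.IsDiag ∧ x ∉ e) {H : SimpleGraph V} {c : Sym2 V → ℝ} {D : ℝ}
    (hmono : ∀ i j (hi : i < L.length) (hj : j < L.length), i < j → c L[i] ≤ c L[j])
    (hfirst : ∀ i j (hi : i < L.length) (hj : j < L.length), i < j → L[j] ∈ H.edgeSet →
      L[i] ∉ H.edgeSet → c L[i] < c L[j])
    (hx : ∀ w, ¬ H.Adj x w) (hdeg : ∀ v, deg H v ≤ 2)
    (hend : ∀ v, ∃ w, H.Reachable v w ∧ deg H w ≤ 1)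
    (hrej : ∀ a b, a ≠ b → a ≠ x → b ≠ x → ¬ H.Adj a b → c s(a, b) < D →
      ∃ v ∈ s(a, b), 2 ≤ {w | H.Adj v w ∧ c s(v, w) ≤ c s(a, b)}.ncard)
    {a b : V} (hab : (runGraph L L.length).Adj a b) (hc : c s(a, b) < D) : H.Adj a b := by
  obtain ⟨j, -, hj, hje⟩ := exists_chosen_of_adj hab
  have h := (runGraph_le_of_blocked hnd hL hfirst hx hdeg hend hrej (j + 1) ?_).1
  · apply h
    rw [runGraph_succ_of_chosen hj, hje]
    simp [hab.ne]
  · intro i hi hij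
    have hle : c L[i] ≤ c (L[j]'hj.1) := by
      rcases Nat.lt_succ_iff_lt_or_eq.1 hij with h | rfl
      · exact hmono i j hi hj.1 h
      · exact le_rfl
    rw [hje] at hle
    exact hle.trans_lt hc

lemma exists_sorted_list {α : Type*} [DecidableEq α] (F : Finset α) (key : α → ℕ) :
    ∃ L : List α, L.Nodup ∧ (∀ a, a ∈ L ↔ a ∈ F) ∧ L.Pairwise fun a b => key a ≤ key b := by
  have : Std.Total (fun a b : α => key a ≤ key b) := ⟨fun a b => le_total _ _⟩
  have : IsTrans α (fun a b : α => key a ≤ key b) := ⟨fun a b c => le_trans⟩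
  refine ⟨F.toList.insertionSort (fun a b => key a ≤ key b), ?_, fun a => ?_,
    List.pairwise_insertionSort _ _⟩
  · exact (List.perm_insertionSort _ _).nodup_iff.2 F.nodup_toList
  · rw [(List.perm_insertionSort _ _).mem_iff, Finset.mem_toList]

end Prescribed

/-! ### Graphs that join consecutive positions of a row -/

section Links

lemma deg_sup_of_disjoint {V : Type*} [Fintype V] {G H : SimpleGraph V} {v : V}
    (h : ∀ w, G.Adj v w → ¬ H.Adj v w) : deg (G ⊔ H) v = deg G v + deg H v := by
  exact Set.ncard_union_eq (s := G.neighborSet v) (t := H.neighborSet v) (Set.disjoint_left.2 h)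
    (Set.toFinite _) (Set.toFinite _)

/-- The graph whose edges join `g t` and `g (t + 1)` for all `t` with `link t`. -/
def linkGraph {V : Type*} (g : ℕ → V) (link : ℕ → Prop) : SimpleGraph V :=
  SimpleGraph.fromEdgeSet {e | ∃ t, link t ∧ e = s(g t, g (t + 1))}

variable {V : Type*} {g : ℕ → V} {link : ℕ → Prop} {P : ℕ}

lemma linkGraph_adj (hg : Set.InjOn g (Set.Iio P)) (hl : ∀ t, link t → t + 1 < P) {u v : V} :
    (linkGraph g link).Adj u v ↔
      ∃ t, link t ∧ ((u = g t ∧ v = g (t + 1)) ∨ (u = g (t + 1) ∧ v = g t)) := by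
  simp only [linkGraph, SimpleGraph.fromEdgeSet_adj, Set.mem_ofPred_eq, Sym2.eq_iff]
  constructor
  · rintro ⟨h, -⟩
    exact h
  · rintro ⟨t, ht, h⟩
    refine ⟨⟨t, ht, h⟩, ?_⟩
    have hP := hl t ht
    have hne : g t ≠ g (t + 1) := fun h' => by
      have := hg (Set.mem_Iio.2 (by omega)) (Set.mem_Iio.2 hP) h'
      omega
    rcases h with ⟨rfl, rfl⟩ | ⟨rfl, rfl⟩
    exacts [hne, hne.symm]

open Classical in
lemma deg_linkGraph (hg : Set.InjOn g (Set.Iio P)) (hl : ∀ t, link t → t + 1 < P) {t : ℕ}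
    (ht : t < P) : deg (linkGraph g link) (g t) =
      (if link t then 1 else 0) + (if 1 ≤ t ∧ link (t - 1) then 1 else 0) := by
  have hinj : ∀ {s s'}, s < P → s' < P → g s = g s' → s = s' := fun hs hs' h => hg hs hs' h
  have hset : (linkGraph g link).neighborSet (g t) =
      {w | link t ∧ w = g (t + 1)} ∪ {w | (1 ≤ t ∧ link (t - 1)) ∧ w = g (t - 1)} := by
    ext w
    simp only [SimpleGraph.mem_neighborSet, linkGraph_adj hg hl, Set.mem_union, Set.mem_ofPred_eq]
    constructor
    · rintro ⟨s, hs, ⟨h1, rfl⟩ | ⟨h1, rfl⟩⟩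
      · obtain rfl := hinj ht (by have := hl s hs; omega) h1
        exact Or.inl ⟨hs, rfl⟩
      · obtain rfl := hinj ht (hl s hs) h1
        exact Or.inr ⟨⟨by omega, hs⟩, rfl⟩
    · rintro (⟨h, rfl⟩ | ⟨⟨h1, h⟩, rfl⟩)
      · exact ⟨t, h, Or.inl ⟨rfl, rfl⟩⟩
      · refine ⟨t - 1, h, Or.inr ⟨?_, rfl⟩⟩
        rw [Nat.sub_add_cancel h1]
  have hfin : ∀ (p : Prop) (z : V), {w | p ∧ w = z}.Finite := fun p z =>
    (Set.finite_singleton z).subset fun w hw => hw.2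
  have hcard : ∀ (p : Prop) (z : V), {w | p ∧ w = z}.ncard = if p then 1 else 0 := by
    intro p z
    split_ifs with h <;> simp [h]
  have hdis : Disjoint {w | link t ∧ w = g (t + 1)}
      {w | (1 ≤ t ∧ link (t - 1)) ∧ w = g (t - 1)} := by
    rw [Set.disjoint_left]
    rintro w ⟨h1, rfl⟩ ⟨h2, h3⟩
    have := hinj (hl t h1) (by omega) h3
    omega
  rw [deg, hset, Set.ncard_union_eq hdis (hfin _ _) (hfin _ _), hcard, hcard]
  congr

lemma linkGraph_not_adj (hg : Set.InjOn g (Set.Iio P)) (hl : ∀ t, link t → t + 1 < P) {v : V}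
    (hv : ∀ t < P, v ≠ g t) (w : V) : ¬ (linkGraph g link).Adj v w := by
  rw [linkGraph_adj hg hl]
  rintro ⟨t, ht, ⟨h, -⟩ | ⟨h, -⟩⟩
  · exact hv t (by have := hl t ht; omega) h
  · exact hv (t + 1) (hl t ht) h

lemma linkGraph_reachable (hg : Set.InjOn g (Set.Iio P)) (hl : ∀ t, link t → t + 1 < P) {t : ℕ}
    (ht : link t) : (linkGraph g link).Reachable (g t) (g (t + 1)) :=
  SimpleGraph.Adj.reachable ((linkGraph_adj hg hl).2 ⟨t, ht, Or.inl ⟨rfl, rfl⟩⟩)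

end Links

/-! ### The self-similar pattern of links between free ends -/

section Pattern

/-- The number of free ends at position `t` of a row of `P` positions. -/
def free (P t : ℕ) : ℕ := if t % 3 = 1 ∨ t + 2 = P then 2 else 1

/-- Positions `t` and `t + 1` of a row of `P` positions are joined. -/
def Link (P t : ℕ) : Prop :=
  t + 1 < P ∧ (((t % 9 = 0 ∨ t % 9 = 2 ∨ t % 9 = 5 ∨ t % 9 = 7) ∧ t + 6 ≠ P ∧ t + 4 ≠ P) ∨
    t + 5 = P ∨ t + 3 = P)

/-- The other end of the path that ends at position `t`, where `3 ∣ t`. -/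
def mate (P t : ℕ) : ℕ := if t + 4 = P then t + 3 else t + 2

lemma Link.lt {P t : ℕ} (h : Link P t) : t + 1 < P := h.1

-- Positions outside the residue class one modulo three are saturated by the links: they leave the
-- active row.
open Classical in
lemma free_link_of_mod_ne {P t : ℕ} (hP : P % 9 = 4) (hP' : 13 ≤ P) (ht : t < P)
    (hmod : t % 3 ≠ 1) : 2 - free P t + ((if Link P t then 1 else 0) +
      (if 1 ≤ t ∧ Link P (t - 1) then 1 else 0)) = 2 := by
  unfold free Link
  split_ifs <;> omega

-- The positions `3 * s + 1` carry the same pattern of free ends again, on a row of `P'` positions.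
-- The exceptional links near the right end reproduce the final block of four, which contains two
-- isolated positions instead of one.
open Classical in
lemma free_link_of_mod_eq {P P' s : ℕ} (hP : P % 9 = 4) (hP' : 13 ≤ P) (hPP' : P = 3 * P' + 1)
    (hs : s < P') : 2 - free P (3 * s + 1) + ((if Link P (3 * s + 1) then 1 else 0) +
      (if 1 ≤ 3 * s + 1 ∧ Link P (3 * s + 1 - 1) then 1 else 0)) = 2 - free P' s := by
  unfold free Link
  split_ifs <;> omega

lemma sum_free (q : ℕ) (hq : 1 ≤ q) : ∑ t ∈ Finset.range (3 * q + 1), free (3 * q + 1) t =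
    4 * q + 2 := by
  have h1 : ∀ t, free (3 * q + 1) t =
      (if t % 3 = 1 then 2 else 1) + (if t = 3 * q - 1 then 1 else 0) := by
    intro t
    unfold free
    split_ifs <;> omega
  have h2 : ∀ m, ∑ t ∈ Finset.range (3 * m + 1), (if t % 3 = 1 then 2 else 1) = 4 * m + 1 := by
    intro m
    induction m with
    | zero => simp
    | succ m ih =>
      rw [show 3 * (m + 1) + 1 = 3 * m + 1 + 1 + 1 + 1 by ring, Finset.sum_range_succ,
        Finset.sum_range_succ, Finset.sum_range_succ, ih]
      split_ifs <;> omega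
  simp_rw [h1]
  rw [Finset.sum_add_distrib, h2, Finset.sum_ite_eq', if_pos (Finset.mem_range.2 (by omega))]

variable {V : Type*} {G : SimpleGraph V} {g : ℕ → V} {P P' : ℕ}

/-- No path loses contact with the active row: following links and mates from any position leads to
a position that remains active. -/
lemma exists_reachable_next (hP : P % 9 = 4) (hP' : 13 ≤ P) (hPP' : P = 3 * P' + 1)
    (hl : ∀ t, Link P t → G.Reachable (g t) (g (t + 1)))
    (hm : ∀ t, t % 3 = 0 → t + 1 < P → G.Reachable (g t) (g (mate P t))) {t : ℕ} (ht : t < P) :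
    ∃ s < P', G.Reachable (g t) (g (3 * s + 1)) := by
  have hfwd : ∀ t u, u < P → Link P t → u = t + 1 → G.Reachable (g t) (g u) := by
    rintro t _ - h rfl
    exact hl t h
  have hmate : ∀ t u, u < P → t % 3 = 0 → (t + 4 = P ∧ u = t + 3 ∨ t + 4 ≠ P ∧ u = t + 2) →
      G.Reachable (g t) (g u) := by
    intro t u hu h3 h
    have : u = mate P t := by
      unfold mate
      split_ifs <;> omega
    rw [this]
    exact hm t h3 (by omega)
  have h1 : ∀ t < P, t % 3 = 1 → ∃ s < P', G.Reachable (g t) (g (3 * s + 1)) := by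
    intro t ht h
    refine ⟨t / 3, by omega, ?_⟩
    rw [show 3 * (t / 3) + 1 = t by omega]
  have step : ∀ t u, G.Reachable (g t) (g u) → (∃ s < P', G.Reachable (g u) (g (3 * s + 1))) →
      ∃ s < P', G.Reachable (g t) (g (3 * s + 1)) := by
    rintro t u h ⟨s, hs, h'⟩
    exact ⟨s, hs, h.trans h'⟩
  have h2 : ∀ t < P, t % 9 = 2 → ∃ s < P', G.Reachable (g t) (g (3 * s + 1)) := by
    intro t ht h
    by_cases hlast : t + 2 = P
    · exact step t (t - 1) (hfwd (t - 1) t ht (by unfold Link; omega) (by omega)).symm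
        (h1 _ (by omega) (by omega))
    · exact step t (t - 2) (hmate (t - 2) t ht (by omega) (by omega)).symm
        (step (t - 2) (t - 1) (hfwd (t - 2) (t - 1) (by omega) (by unfold Link; omega) (by omega))
          (h1 _ (by omega) (by omega)))
  have h3 : ∀ t < P, t % 9 = 3 → ∃ s < P', G.Reachable (g t) (g (3 * s + 1)) := fun t ht h =>
    step t (t - 1) (hfwd (t - 1) t ht (by unfold Link; omega) (by omega)).symm
      (h2 _ (by omega) (by omega))
  have h5 : ∀ t < P, t % 9 = 5 → ∃ s < P', G.Reachable (g t) (g (3 * s + 1)) := fun t ht h =>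
    step t (t - 2) (hmate (t - 2) t ht (by omega) (by omega)).symm (h3 _ (by omega) (by omega))
  have h6 : ∀ t < P, t % 9 = 6 → ∃ s < P', G.Reachable (g t) (g (3 * s + 1)) := fun t ht h =>
    step t (t - 1) (hfwd (t - 1) t ht (by unfold Link; omega) (by omega)).symm
      (h5 _ (by omega) (by omega))
  have h8 : ∀ t < P, t % 9 = 8 → ∃ s < P', G.Reachable (g t) (g (3 * s + 1)) := by
    intro t ht h
    by_cases hlast : t + 5 = P
    · exact step t (t - 2) (hmate (t - 2) t ht (by omega) (by omega)).symm
        (h6 _ (by omega) (by omega))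
    · exact step t (t - 1) (hfwd (t - 1) t ht (by unfold Link; omega) (by omega)).symm
        (h1 _ (by omega) (by omega))
  have h0 : ∀ t < P, t % 9 = 0 → ∃ s < P', G.Reachable (g t) (g (3 * s + 1)) := by
    intro t ht h
    by_cases hlast : t + 4 = P
    · exact step t (t + 3) (hmate t (t + 3) (by omega) (by omega) (by omega))
        (h3 _ (by omega) (by omega))
    · exact step t (t + 1) (hfwd t (t + 1) (by omega) (by unfold Link; omega) rfl)
        (h1 _ (by omega) (by omega))
  have hcases : t % 3 = 1 ∨ t % 9 = 0 ∨ t % 9 = 2 ∨ t % 9 = 3 ∨ t % 9 = 5 ∨ t % 9 = 6 ∨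
      t % 9 = 8 := by omega
  rcases hcases with h | h | h | h | h | h | h
  exacts [h1 t ht h, h0 t ht h, h2 t ht h, h3 t ht h, h5 t ht h, h6 t ht h, h8 t ht h]

/-- In a block of nine positions the new path runs through 1, 0, 2, 3, 5, 6, 8, 7, alternating links
and mates and leaving 4 isolated. In the final block of thirteen it runs through 1, 0, 2, 3, 5, 6,
8, 9, 12, 11, 10, leaving 4 and 7. -/
lemma reachable_mate_next (hP : P % 9 = 4) (hPP' : P = 3 * P' + 1)
    (hl : ∀ t, Link P t → G.Reachable (g t) (g (t + 1)))
    (hm : ∀ t, t % 3 = 0 → t + 1 < P → G.Reachable (g t) (g (mate P t))) {s : ℕ}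
    (hs : s % 3 = 0) (hs' : s + 1 < P') :
    G.Reachable (g (3 * s + 1)) (g (3 * mate P' s + 1)) := by
  have hfwd : ∀ t u, Link P t → u = t + 1 → G.Reachable (g t) (g u) := by
    rintro t _ h rfl
    exact hl t h
  have hmate : ∀ t u, u < P → t % 3 = 0 → (t + 4 = P ∧ u = t + 3 ∨ t + 4 ≠ P ∧ u = t + 2) →
      G.Reachable (g t) (g u) := by
    intro t u hu h3 h
    have : u = mate P t := by
      unfold mate
      split_ifs <;> omega
    rw [this]
    exact hm t h3 (by omega)
  have a1 : G.Reachable (g (3 * s + 1)) (g (3 * s)) :=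
    (hfwd (3 * s) (3 * s + 1) (by unfold Link; omega) rfl).symm
  have a2 : G.Reachable (g (3 * s)) (g (3 * s + 2)) :=
    hmate _ _ (by omega) (by omega) (by omega)
  have a3 : G.Reachable (g (3 * s + 2)) (g (3 * s + 3)) :=
    hfwd _ _ (by unfold Link; omega) rfl
  have a4 : G.Reachable (g (3 * s + 3)) (g (3 * s + 5)) :=
    hmate _ _ (by omega) (by omega) (by omega)
  have a5 : G.Reachable (g (3 * s + 5)) (g (3 * s + 6)) :=
    hfwd _ _ (by unfold Link; omega) rfl
  have a6 : G.Reachable (g (3 * s + 6)) (g (3 * s + 8)) :=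
    hmate _ _ (by omega) (by omega) (by omega)
  have a := a1.trans (a2.trans (a3.trans (a4.trans (a5.trans a6))))
  unfold mate
  split_ifs with hlast
  · have b1 : G.Reachable (g (3 * s + 8)) (g (3 * s + 9)) :=
      hfwd _ _ (by unfold Link; omega) rfl
    have b2 : G.Reachable (g (3 * s + 9)) (g (3 * s + 12)) :=
      hmate _ _ (by omega) (by omega) (by omega)
    have b3 : G.Reachable (g (3 * s + 11)) (g (3 * s + 12)) :=
      hfwd _ _ (by unfold Link; omega) rfl
    have b4 : G.Reachable (g (3 * s + 10)) (g (3 * s + 11)) :=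
      hfwd _ _ (by unfold Link; omega) rfl
    rw [show 3 * (s + 3) + 1 = 3 * s + 10 by ring]
    exact a.trans (b1.trans (b2.trans (b3.symm.trans b4.symm)))
  · have b1 : G.Reachable (g (3 * s + 7)) (g (3 * s + 8)) :=
      hfwd _ _ (by unfold Link; omega) rfl
    rw [show 3 * (s + 2) + 1 = 3 * s + 7 by ring]
    exact a.trans b1.symm

end Pattern

/-! ### Columns of the active positions on each level -/

section Repunit

/-- The number with `i` digits `1` in base three. -/
abbrev repunit (i : ℕ) : ℕ := (3 ^ i - 1) / 2

lemma two_mul_repunit_add_one (i : ℕ) : 2 * repunit i + 1 = 3 ^ i := by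
  have h : 3 ^ i % 2 = 1 := by
    induction i with
    | zero => rfl
    | succ i ih => rw [pow_succ]; omega
  unfold repunit
  generalize 3 ^ i = m at h ⊢
  omega

lemma repunit_zero : repunit 0 = 0 := rfl

lemma repunit_succ (i : ℕ) : repunit (i + 1) = 3 * repunit i + 1 := by
  have h1 := two_mul_repunit_add_one i
  have h2 := two_mul_repunit_add_one (i + 1)
  rw [pow_succ] at h2
  omega

lemma repunit_add (a b : ℕ) : repunit (a + b) = 3 ^ b * repunit a + repunit b := by
  have h1 := two_mul_repunit_add_one a
  have h2 := two_mul_repunit_add_one b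
  have h3 := two_mul_repunit_add_one (a + b)
  rw [pow_add, ← h1] at h3
  generalize repunit (a + b) = x at *
  generalize repunit a = y at *
  generalize repunit b = z at *
  have : (2 * y + 1) * 3 ^ b = 2 * (3 ^ b * y) + 3 ^ b := by ring
  omega

/-- The column of the position `t` on level `j`. -/
def col (j t : ℕ) : ℕ := 3 ^ j * t + repunit j

lemma col_zero (t : ℕ) : col 0 t = t := by
  simp [col, repunit_zero]

/-- The self-similarity in coordinates: the active positions of the next level are the middle
positions of the blocks of three. -/
lemma col_succ (j s : ℕ) : col (j + 1) s = col j (3 * s + 1) := by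
  have h1 := two_mul_repunit_add_one j
  have h2 := repunit_succ j
  unfold col
  rw [pow_succ, h2]
  nlinarith

lemma col_lt_iff {j m t : ℕ} : col j t < repunit (m + j) ↔ t < repunit m := by
  rw [repunit_add, col, Nat.add_lt_add_iff_right]
  exact Nat.mul_lt_mul_left (by positivity)

lemma col_injective (j : ℕ) : Function.Injective (col j) := by
  intro s t h
  unfold col at h
  have h3 : 0 < 3 ^ j := by positivity
  exact Nat.eq_of_mul_eq_mul_left h3 (by omega)

lemma pow_le_col_sub {j s t : ℕ} (h : s < t) : col j s + 3 ^ j ≤ col j t := by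
  unfold col
  have := Nat.mul_le_mul_left (3 ^ j) (show s + 1 ≤ t from h)
  rw [mul_add, mul_one] at this
  omega

end Repunit

/-! ### The grid instance, its distances, and its prescribed paths -/

section Grid

variable {k : ℕ}

lemma pathGraph_dist {n : ℕ} (i j : Fin n) :
    (SimpleGraph.pathGraph n).dist i j = (i.val - j.val) + (j.val - i.val) := by
  have hle : ∀ {i j : Fin n} (p : (SimpleGraph.pathGraph n).Walk i j),
      (i.val - j.val) + (j.val - i.val) ≤ p.length := by
    intro i j p
    induction p with
    | nil => simp
    | cons h p ih =>
      rw [SimpleGraph.pathGraph_adj] at h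
      rw [SimpleGraph.Walk.length_cons]
      omega
  have hwalk : ∀ (d : ℕ) (i j : Fin n), i.val + d = j.val →
      ∃ p : (SimpleGraph.pathGraph n).Walk i j, p.length = d := by
    intro d
    induction d with
    | zero =>
      intro i j h
      obtain rfl : i = j := Fin.ext (by omega)
      exact ⟨.nil, rfl⟩
    | succ d ih =>
      intro i j h
      have hi : i.val + 1 < n := by have := j.isLt; omega
      obtain ⟨p, hp⟩ := ih ⟨i.val + 1, hi⟩ j (by simp only; omega)
      have hadj : (SimpleGraph.pathGraph n).Adj i ⟨i.val + 1, hi⟩ :=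
        SimpleGraph.pathGraph_adj.2 (Or.inl rfl)
      exact ⟨.cons hadj p, by rw [SimpleGraph.Walk.length_cons, hp]⟩
  have hge : ∀ i j : Fin n, i.val ≤ j.val →
      (SimpleGraph.pathGraph n).dist i j ≤ j.val - i.val := by
    intro i j h
    obtain ⟨p, hp⟩ := hwalk (j.val - i.val) i j (by omega)
    exact hp ▸ SimpleGraph.dist_le p
  obtain ⟨p, hp⟩ := (SimpleGraph.pathGraph_preconnected n i j).exists_walk_length_eq_dist
  have h1 := hle p
  rcases le_total i.val j.val with h | h
  · have := hge i j h
    omega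
  · have := hge j i h
    rw [SimpleGraph.dist_comm] at this
    omega

lemma gridGraph_preconnected (p q : GridCity k) : (gridGraph k).Reachable p q := by
  rw [gridGraph, SimpleGraph.reachable_boxProd]
  exact ⟨SimpleGraph.pathGraph_preconnected _ _ _, SimpleGraph.pathGraph_preconnected _ _ _⟩

lemma gridGraph_dist (p q : GridCity k) : (gridGraph k).dist p q =
    (p.1.val - q.1.val) + (q.1.val - p.1.val) + ((p.2.val - q.2.val) + (q.2.val - p.2.val)) := by
  rw [← pathGraph_dist, ← pathGraph_dist]
  have h := SimpleGraph.edist_boxProd (G := SimpleGraph.pathGraph ((3 ^ (k + 2) - 1) / 2))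
    (H := SimpleGraph.pathGraph 2) p q
  rw [← (SimpleGraph.pathGraph_preconnected _ _ _).coe_dist_eq_edist,
    ← (SimpleGraph.pathGraph_preconnected _ _ _).coe_dist_eq_edist] at h
  have h2 := (gridGraph_preconnected p q).coe_dist_eq_edist
  rw [gridGraph] at h2 ⊢
  rw [h] at h2
  exact_mod_cast h2

/-- The city in row `r` and column `c` of the grid; the hub if there is no such column. -/
def city (k c : ℕ) (r : Fin 2) : Option (GridCity k) :=
  if h : c < repunit (k + 2) then some (⟨c, h⟩, r) else none

lemma city_eq {c : ℕ} (h : c < repunit (k + 2)) (r : Fin 2) :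
    city k c r = some ((⟨c, h⟩ : Fin _), r) := by
  rw [city, dif_pos h]

lemma city_ne_none {c : ℕ} (h : c < repunit (k + 2)) (r : Fin 2) : city k c r ≠ none := by
  rw [city_eq h]
  exact Option.some_ne_none _

lemma city_inj {c c' : ℕ} (h : c < repunit (k + 2)) (h' : c' < repunit (k + 2)) {r r' : Fin 2} :
    city k c r = city k c' r' ↔ c = c' ∧ r = r' := by
  rw [city_eq h, city_eq h', Option.some_inj, Prod.mk.injEq, Fin.mk.injEq]

lemma exists_city {v : Option (GridCity k)} (hv : v ≠ none) :
    ∃ c < repunit (k + 2), v = city k c 0 ∨ v = city k c 1 := by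
  obtain ⟨⟨⟨c, hc⟩, r⟩, rfl⟩ := Option.ne_none_iff_exists'.1 hv
  refine ⟨c, hc, ?_⟩
  rw [city_eq hc, city_eq hc]
  fin_cases r
  · exact Or.inl rfl
  · exact Or.inr rfl

lemma hubLength_some (p q : GridCity k) :
    hubLength k s(some p, some q) = ((gridGraph k).dist p q : ℝ) := rfl

lemma hubLength_none_left (p : GridCity k) : hubLength k s(none, some p) = 3 ^ (k + 2) / 2 := rfl

lemma hubLength_none_right (p : GridCity k) : hubLength k s(some p, none) = 3 ^ (k + 2) / 2 := rfl

lemma hubLength_none_none : hubLength k s(none, none) = 0 := rfl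

lemma hubLength_city {c c' : ℕ} (h : c < repunit (k + 2)) (h' : c' < repunit (k + 2))
    (r r' : Fin 2) : hubLength k s(city k c r, city k c' r') =
      (((c - c') + (c' - c) + ((r.val - r'.val) + (r'.val - r.val)) : ℕ) : ℝ) := by
  rw [city_eq h, city_eq h', hubLength_some, gridGraph_dist]

lemma isMetric_hubLength (k : ℕ) : IsMetric (hubLength k) := by
  have hpos : (0 : ℝ) < 3 ^ (k + 2) / 2 := by positivity
  have htri : ∀ p q r : GridCity k,
      (gridGraph k).dist p r ≤ (gridGraph k).dist p q + (gridGraph k).dist q r := by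
    intro p q r
    rw [gridGraph_dist, gridGraph_dist, gridGraph_dist]
    omega
  -- The grid diameter is at most twice the distance to the hub, as the triangle inequality through
  -- the hub requires.
  have hle : ∀ p q : GridCity k, ((gridGraph k).dist p q : ℝ) ≤ 3 ^ (k + 2) := by
    intro p q
    have h : (gridGraph k).dist p q ≤ 3 ^ (k + 2) := by
      rw [gridGraph_dist]
      have h1 := two_mul_repunit_add_one (k + 2)
      have h2 : p.1.val < repunit (k + 2) := p.1.isLt
      have h3 : q.1.val < repunit (k + 2) := q.1.isLt
      have h4 := p.2.isLt
      have h5 := q.2.isLt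
      omega
    exact_mod_cast h
  refine ⟨fun e => ?_, fun v => ?_, fun u v w => ?_⟩
  · induction e with | _ a b
    rcases a with _ | p <;> rcases b with _ | q
    · exact hubLength_none_none.ge
    · exact hpos.le
    · exact hpos.le
    · rw [hubLength_some]
      positivity
  · rcases v with _ | p
    · exact hubLength_none_none
    · rw [hubLength_some, SimpleGraph.dist_self, Nat.cast_zero]
  · rcases u with _ | p <;> rcases v with _ | q <;> rcases w with _ | r <;>
      simp only [hubLength_some, hubLength_none_left, hubLength_none_right, hubLength_none_none]
    · norm_num
    · linarith
    · positivity
    · have : (0 : ℝ) ≤ ((gridGraph k).dist q r : ℝ) := by positivity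
      linarith
    · linarith
    · linarith [hle p r]
    · have : (0 : ℝ) ≤ ((gridGraph k).dist p q : ℝ) := by positivity
      linarith
    · exact_mod_cast htri p q r

lemma card_gridCity (k : ℕ) : Fintype.card (Option (GridCity k)) = 3 ^ (k + 2) := by
  rw [Fintype.card_option, Fintype.card_prod, Fintype.card_fin, Fintype.card_fin]
  have := two_mul_repunit_add_one (k + 2)
  unfold repunit at this
  omega

/-- The hub is equally far from all grid points, so nonincreasing savings means nondecreasing
distance. -/
lemma savings_hubLength {e : Sym2 (Option (GridCity k))} (he : none ∉ e) :
    savings (hubLength k) none e = 3 ^ (k + 2) - hubLength k e := by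
  induction e with | _ a b
  simp only [Sym2.mem_iff, not_or] at he
  obtain ⟨p, rfl⟩ := Option.ne_none_iff_exists'.1 (Ne.symm he.1)
  obtain ⟨q, rfl⟩ := Option.ne_none_iff_exists'.1 (Ne.symm he.2)
  rw [savings_mk, hubLength_none_right, hubLength_none_right]
  ring

lemma exists_nat_hubLength {u v : Option (GridCity k)} (hu : u ≠ none) (hv : v ≠ none)
    (huv : u ≠ v) : ∃ d : ℕ, 1 ≤ d ∧ hubLength k s(u, v) = d := by
  obtain ⟨p, rfl⟩ := Option.ne_none_iff_exists'.1 hu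
  obtain ⟨q, rfl⟩ := Option.ne_none_iff_exists'.1 hv
  refine ⟨_, ?_, hubLength_some p q⟩
  exact (gridGraph_preconnected p q).pos_dist_of_ne (fun h => huv (h ▸ rfl))

/-! ### The prescribed path system -/

/-- The columns `c` and `c + 1` of a grid with `P` columns are joined in the lower row. -/
def LowLink (P c : ℕ) : Prop := c + 1 < P ∧ (c % 3 ≠ 2 ∨ c + 2 = P)

/-- The vertical edges. -/
def verticals (k : ℕ) : SimpleGraph (Option (GridCity k)) :=
  SimpleGraph.fromEdgeSet
    {e | ∃ c < repunit (k + 2), free (repunit (k + 2)) c = 1 ∧ e = s(city k c 0, city k c 1)}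

/-- The edges in the lower row. -/
def lowRow (k : ℕ) : SimpleGraph (Option (GridCity k)) :=
  linkGraph (fun c => city k c 1) (LowLink (repunit (k + 2)))

/-- The edges in the upper row that are added on level `j`. -/
def level (k j : ℕ) : SimpleGraph (Option (GridCity k)) :=
  linkGraph (fun t => city k (col j t) 0) (Link (repunit (k + 2 - j)))

/-- The path system before level `j`. -/
def paths (k : ℕ) : ℕ → SimpleGraph (Option (GridCity k))
  | 0 => lowRow k ⊔ verticals k
  | j + 1 => paths k j ⊔ level k j

lemma col_lt {j t : ℕ} (hj : j ≤ k + 2) (ht : t < repunit (k + 2 - j)) :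
    col j t < repunit (k + 2) := by
  have := (col_lt_iff (j := j)).2 ht
  rwa [Nat.sub_add_cancel hj] at this

lemma injOn_low : Set.InjOn (fun c => city k c 1) (Set.Iio (repunit (k + 2))) := by
  intro a ha b hb h
  exact ((city_inj ha hb).1 h).1

lemma injOn_level {j : ℕ} (hj : j ≤ k + 2) :
    Set.InjOn (fun t => city k (col j t) 0) (Set.Iio (repunit (k + 2 - j))) := by
  intro a ha b hb h
  exact col_injective j ((city_inj (col_lt hj ha) (col_lt hj hb)).1 h).1

lemma lowRow_adj {u v : Option (GridCity k)} : (lowRow k).Adj u v ↔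
    ∃ c, LowLink (repunit (k + 2)) c ∧ ((u = city k c 1 ∧ v = city k (c + 1) 1) ∨
      (u = city k (c + 1) 1 ∧ v = city k c 1)) :=
  linkGraph_adj injOn_low (fun _ h => h.1)

lemma verticals_adj {u v : Option (GridCity k)} : (verticals k).Adj u v ↔
    ∃ c < repunit (k + 2), free (repunit (k + 2)) c = 1 ∧
      ((u = city k c 0 ∧ v = city k c 1) ∨ (u = city k c 1 ∧ v = city k c 0)) := by
  simp only [verticals, SimpleGraph.fromEdgeSet_adj, Set.mem_ofPred_eq, Sym2.eq_iff]
  constructor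
  · rintro ⟨h, -⟩
    exact h
  · rintro ⟨c, hc, hf, h⟩
    refine ⟨⟨c, hc, hf, h⟩, ?_⟩
    have hne : city k c 0 ≠ city k c 1 := fun h => by
      have := ((city_inj hc hc).1 h).2
      exact absurd this (by decide)
    rcases h with ⟨rfl, rfl⟩ | ⟨rfl, rfl⟩
    exacts [hne, hne.symm]

lemma level_adj {j : ℕ} (hj : j ≤ k + 2) {u v : Option (GridCity k)} : (level k j).Adj u v ↔
    ∃ t, Link (repunit (k + 2 - j)) t ∧
      ((u = city k (col j t) 0 ∧ v = city k (col j (t + 1)) 0) ∨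
        (u = city k (col j (t + 1)) 0 ∧ v = city k (col j t) 0)) :=
  linkGraph_adj (injOn_level hj) (fun _ h => h.1)

lemma hubLength_of_lowRow_adj {u v : Option (GridCity k)} (h : (lowRow k).Adj u v) :
    hubLength k s(u, v) = 1 := by
  obtain ⟨c, hc, ⟨rfl, rfl⟩ | ⟨rfl, rfl⟩⟩ := lowRow_adj.1 h
  · rw [hubLength_city (by have := hc.1; omega) hc.1]
    simp
  · rw [hubLength_city hc.1 (by have := hc.1; omega)]
    simp

lemma hubLength_of_verticals_adj {u v : Option (GridCity k)} (h : (verticals k).Adj u v) :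
    hubLength k s(u, v) = 1 := by
  obtain ⟨c, hc, -, ⟨rfl, rfl⟩ | ⟨rfl, rfl⟩⟩ := verticals_adj.1 h
  · rw [hubLength_city hc hc]
    simp
  · rw [hubLength_city hc hc]
    simp

lemma hubLength_of_level_adj {j : ℕ} (hj : j ≤ k + 2) {u v : Option (GridCity k)}
    (h : (level k j).Adj u v) : hubLength k s(u, v) = 3 ^ j := by
  obtain ⟨t, ht, h⟩ := (level_adj hj).1 h
  have h1 := col_lt hj ht.lt
  have h0 := col_lt hj (show t < _ by have := ht.lt; omega)
  have hstep : col j (t + 1) = col j t + 3 ^ j := by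
    unfold col
    ring
  rcases h with ⟨rfl, rfl⟩ | ⟨rfl, rfl⟩
  · rw [hubLength_city h0 h1, hstep]
    simp
  · rw [hubLength_city h1 h0, hstep]
    simp

lemma paths_adj_iff {j : ℕ} {u v : Option (GridCity k)} : (paths k j).Adj u v ↔
    (lowRow k).Adj u v ∨ (verticals k).Adj u v ∨ ∃ i < j, (level k i).Adj u v := by
  induction j with
  | zero => simp [paths]
  | succ j ih =>
    rw [paths, SimpleGraph.sup_adj, ih]
    constructor
    · rintro ((h | h | ⟨i, hi, h⟩) | h)
      · exact Or.inl h
      · exact Or.inr (Or.inl h)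
      · exact Or.inr (Or.inr ⟨i, by omega, h⟩)
      · exact Or.inr (Or.inr ⟨j, by omega, h⟩)
    · rintro (h | h | ⟨i, hi, h⟩)
      · exact Or.inl (Or.inl h)
      · exact Or.inl (Or.inr (Or.inl h))
      · rcases Nat.lt_succ_iff_lt_or_eq.1 hi with hi | rfl
        · exact Or.inl (Or.inr (Or.inr ⟨i, hi, h⟩))
        · exact Or.inr h

lemma paths_mono (k : ℕ) : Monotone (paths k) :=
  monotone_nat_of_le_succ fun _ => le_sup_left

lemma hubLength_le_of_paths_adj {j : ℕ} (hj : j ≤ k + 2) {u v : Option (GridCity k)}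
    (h : (paths k j).Adj u v) : hubLength k s(u, v) ≤ 3 ^ (j - 1) := by
  have h1 : (1 : ℝ) ≤ 3 ^ (j - 1) := one_le_pow₀ (by norm_num)
  rcases paths_adj_iff.1 h with h | h | ⟨i, hi, h⟩
  · rw [hubLength_of_lowRow_adj h]
    exact h1
  · rw [hubLength_of_verticals_adj h]
    exact h1
  · rw [hubLength_of_level_adj (by omega) h]
    exact pow_le_pow_right₀ (by norm_num) (by omega)

lemma paths_adj_of_hubLength_lt {i j : ℕ} (hi : i ≤ k + 2) {u v : Option (GridCity k)}
    (h : (paths k i).Adj u v) (hlt : hubLength k s(u, v) < 3 ^ j) : (paths k j).Adj u v := by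
  rw [paths_adj_iff] at h ⊢
  rcases h with h | h | ⟨m, hm, h⟩
  · exact Or.inl h
  · exact Or.inr (Or.inl h)
  · rw [hubLength_of_level_adj (by omega) h] at hlt
    exact Or.inr (Or.inr ⟨m, (pow_lt_pow_iff_right₀ (by norm_num)).1 hlt, h⟩)

/-- Edges of level `j ≥ 1` are longer than all earlier ones. On level zero all lengths are one, but
the new edges lie in the upper row, and the initial ones do not. -/
lemma not_level_adj_of_paths_adj {j : ℕ} (hj : j ≤ k + 2) {u v : Option (GridCity k)}
    (h : (paths k j).Adj u v) : ¬ (level k j).Adj u v := by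
  intro h'
  rcases Nat.eq_zero_or_pos j with rfl | hpos
  · obtain ⟨t, ht, hl⟩ := (level_adj hj).1 h'
    have h1 := col_lt hj ht.lt
    have h0 := col_lt hj (show t < _ by have := ht.lt; omega)
    have hno : ∀ c c', c < repunit (k + 2) → c' < repunit (k + 2) →
        city k c 1 ≠ city k c' 0 := by
      intro c c' hc hc' h
      exact absurd ((city_inj hc hc').1 h).2 (by decide)
    rcases paths_adj_iff.1 h with h | h | ⟨i, hi, -⟩
    · obtain ⟨c, hc, ⟨rfl, rfl⟩ | ⟨rfl, rfl⟩⟩ := lowRow_adj.1 h <;>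
        rcases hl with ⟨h2, h3⟩ | ⟨h2, h3⟩
      · exact hno _ _ hc.1 h1 h3
      · exact hno _ _ hc.1 h0 h3
      · exact hno _ _ hc.1 h0 h2
      · exact hno _ _ hc.1 h1 h2
    · obtain ⟨c, hc, -, ⟨rfl, rfl⟩ | ⟨rfl, rfl⟩⟩ := verticals_adj.1 h <;>
        rcases hl with ⟨h2, h3⟩ | ⟨h2, h3⟩
      · exact hno _ _ hc h1 h3
      · exact hno _ _ hc h0 h3
      · exact hno _ _ hc h0 h2
      · exact hno _ _ hc h1 h2
    · omega
  · have h1 := hubLength_le_of_paths_adj hj h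
    rw [hubLength_of_level_adj hj h'] at h1
    have : j ≤ j - 1 := (pow_le_pow_iff_right₀ (by norm_num : (1 : ℝ) < 3)).1 h1
    omega

lemma paths_not_adj_none (j : ℕ) (hj : j ≤ k + 2) (v : Option (GridCity k)) :
    ¬ (paths k j).Adj none v := by
  intro h
  rcases paths_adj_iff.1 h with h | h | ⟨i, hi, h⟩
  · obtain ⟨c, hc, ⟨h, -⟩ | ⟨h, -⟩⟩ := lowRow_adj.1 h
    · exact city_ne_none (by have := hc.1; omega) _ h.symm
    · exact city_ne_none hc.1 _ h.symm
  · obtain ⟨c, hc, -, ⟨h, -⟩ | ⟨h, -⟩⟩ := verticals_adj.1 h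
    · exact city_ne_none hc _ h.symm
    · exact city_ne_none hc _ h.symm
  · obtain ⟨t, ht, ⟨h, -⟩ | ⟨h, -⟩⟩ := (level_adj (by omega)).1 h
    · exact city_ne_none (col_lt (by omega) (by have := ht.lt; omega)) _ h.symm
    · exact city_ne_none (col_lt (by omega) ht.lt) _ h.symm

lemma repunit_add_two_mod (i : ℕ) : repunit (i + 2) % 9 = 4 := by
  rw [repunit_succ, repunit_succ]
  omega

open Classical in
lemma deg_verticals {c : ℕ} (hc : c < repunit (k + 2)) (r : Fin 2) :
    deg (verticals k) (city k c r) = if free (repunit (k + 2)) c = 1 then 1 else 0 := by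
  have hset : (verticals k).neighborSet (city k c r) =
      {w | free (repunit (k + 2)) c = 1 ∧ w = city k c (r + 1)} := by
    ext w
    simp only [SimpleGraph.mem_neighborSet, verticals_adj, Set.mem_ofPred_eq]
    constructor
    · rintro ⟨c', hc', hf, ⟨h, rfl⟩ | ⟨h, rfl⟩⟩ <;> obtain ⟨rfl, rfl⟩ := (city_inj hc hc').1 h
      · exact ⟨hf, rfl⟩
      · exact ⟨hf, rfl⟩
    · rintro ⟨hf, rfl⟩
      refine ⟨c, hc, hf, ?_⟩
      fin_cases r
      · exact Or.inl ⟨rfl, rfl⟩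
      · exact Or.inr ⟨rfl, rfl⟩
  rw [deg, hset]
  split_ifs with h <;> simp [h]

lemma deg_low_zero {c : ℕ} (hc : c < repunit (k + 2)) : deg (paths k 0) (city k c 1) = 2 := by
  classical
  have hP := repunit_add_two_mod k
  rw [paths, deg_sup_of_disjoint, deg_verticals hc]
  · have : deg (lowRow k) (city k c 1) = _ :=
      deg_linkGraph (g := fun c => city k c 1) injOn_low (fun _ h => h.1) hc
    rw [this]
    unfold free LowLink
    split_ifs <;> omega
  · intro w h1 h2
    obtain ⟨a, ha, h1⟩ := lowRow_adj.1 h1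
    obtain ⟨b, hb, -, h2⟩ := verticals_adj.1 h2
    have ha1 := ha.1
    have ha0 : a < repunit (k + 2) := by omega
    rcases h1 with ⟨-, rfl⟩ | ⟨-, rfl⟩ <;> rcases h2 with ⟨h, -⟩ | ⟨-, h⟩
    · exact absurd ((city_inj hc hb).1 h).2 (by decide)
    · exact absurd ((city_inj ha1 hb).1 h).2 (by decide)
    · exact absurd ((city_inj hc hb).1 h).2 (by decide)
    · exact absurd ((city_inj ha0 hb).1 h).2 (by decide)

lemma lowRow_not_adj {c : ℕ} (hc : c < repunit (k + 2)) (w : Option (GridCity k)) :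
    ¬ (lowRow k).Adj (city k c 0) w :=
  linkGraph_not_adj injOn_low (fun _ h => h.1)
    (fun _ ht h => absurd ((city_inj hc ht).1 h).2 (by decide)) w

lemma deg_top_zero {c : ℕ} (hc : c < repunit (k + 2)) :
    deg (paths k 0) (city k c 0) = 2 - free (repunit (k + 2)) c := by
  classical
  rw [paths, deg_sup_of_disjoint (fun w h => absurd h (lowRow_not_adj hc w)), deg_verticals hc,
    deg_eq_zero.2 (lowRow_not_adj hc)]
  unfold free
  split_ifs <;> omega

/-- The degrees in the path system before level `j`. -/
lemma deg_paths {j m : ℕ} (hjm : j + m = k) :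
    (∀ c < repunit (k + 2), deg (paths k j) (city k c 1) = 2) ∧
    (∀ t < repunit (m + 2), deg (paths k j) (city k (col j t) 0) = 2 - free (repunit (m + 2)) t) ∧
    (∀ c < repunit (k + 2), (∀ t < repunit (m + 2), c ≠ col j t) →
      deg (paths k j) (city k c 0) = 2) := by
  classical
  induction j generalizing m with
  | zero =>
    obtain rfl : m = k := by omega
    refine ⟨fun c hc => deg_low_zero hc, fun t ht => ?_, fun c hc h => ?_⟩
    · rw [col_zero]
      exact deg_top_zero ht
    · exact absurd (col_zero c).symm (h c hc)
  | succ j ih =>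
    obtain ⟨ih1, ih2, ih3⟩ := ih (m := m + 1) (by omega)
    have hj : j ≤ k + 2 := by omega
    have hsub : k + 2 - j = m + 3 := by omega
    have hsum : ∀ v, deg (paths k (j + 1)) v = deg (paths k j) v + deg (level k j) v := fun v =>
      deg_sup_of_disjoint fun w h => not_level_adj_of_paths_adj hj h
    have hzero : ∀ v, (∀ t < repunit (m + 3), v ≠ city k (col j t) 0) →
        deg (level k j) v = 0 := by
      intro v hv
      refine deg_eq_zero.2 (linkGraph_not_adj (injOn_level hj) (fun _ (h : Link _ _) => h.1) ?_)
      rw [hsub]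
      exact hv
    have hcol : ∀ t < repunit (m + 3), col j t < repunit (k + 2) := by
      intro t ht
      rw [← hsub] at ht
      exact col_lt hj ht
    have hdeg : ∀ t < repunit (m + 3), deg (level k j) (city k (col j t) 0) =
        (if Link (repunit (m + 3)) t then 1 else 0) +
          (if 1 ≤ t ∧ Link (repunit (m + 3)) (t - 1) then 1 else 0) := by
      intro t ht
      have h := deg_linkGraph (g := fun t => city k (col j t) 0) (injOn_level hj)
        (fun _ (h : Link _ _) => h.1) (hsub.symm ▸ ht)
      rw [hsub] at h
      rw [level, hsub]
      exact h
    have hP : repunit (m + 3) % 9 = 4 := repunit_add_two_mod (m + 1)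
    have hP' : 13 ≤ repunit (m + 3) := by
      rw [repunit_succ, repunit_succ, repunit_succ]
      omega
    have hPP : repunit (m + 3) = 3 * repunit (m + 2) + 1 := repunit_succ (m + 2)
    refine ⟨fun c hc => ?_, fun s hs => ?_, fun c hc h => ?_⟩
    · rw [hsum, ih1 c hc, hzero]
      intro t ht h
      exact absurd ((city_inj hc (hcol t ht)).1 h).2 (by decide)
    · have hs' : 3 * s + 1 < repunit (m + 3) := by omega
      rw [col_succ, hsum, ih2 _ hs', hdeg _ hs']
      exact free_link_of_mod_eq hP hP' hPP hs
    · rw [hsum]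
      by_cases hex : ∃ t < repunit (m + 3), c = col j t
      · obtain ⟨t, ht, rfl⟩ := hex
        rw [ih2 t ht, hdeg t ht]
        refine free_link_of_mod_ne hP hP' ht fun hmod => ?_
        refine h (t / 3) (by omega) ?_
        rw [col_succ]
        congr 1
        omega
      · push Not at hex
        rw [ih3 c hc hex, hzero]
        intro t ht h
        exact hex t ht ((city_inj hc (hcol t ht)).1 h).1

lemma reachable_paths_zero :
    (∀ t, t % 3 = 0 → t + 1 < repunit (k + 2) →
      (paths k 0).Reachable (city k t 0) (city k (mate (repunit (k + 2)) t) 0)) ∧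
    (∀ c < repunit (k + 2), ∃ t < repunit (k + 2),
      (paths k 0).Reachable (city k c 1) (city k t 0)) := by
  have hP := repunit_add_two_mod k
  set P := repunit (k + 2) with hPdef
  have hlow : ∀ c d, LowLink P c → d = c + 1 →
      (paths k 0).Reachable (city k c 1) (city k d 1) := by
    rintro c _ hc rfl
    exact (linkGraph_reachable (g := fun c => city k c 1) injOn_low (fun _ h => h.1) hc).mono
      le_sup_left
  have hvert : ∀ c < P, free P c = 1 → (paths k 0).Reachable (city k c 0) (city k c 1) := by
    intro c hc hf
    exact SimpleGraph.Adj.reachable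
      (Or.inr (verticals_adj.2 ⟨c, hc, hf, Or.inl ⟨rfl, rfl⟩⟩))
  constructor
  · intro t h3 ht
    have a1 := hvert t (by omega) (by unfold free; split_ifs <;> omega)
    have a2 := hlow t (t + 1) (by unfold LowLink; omega) rfl
    have a3 := hlow (t + 1) (t + 2) (by unfold LowLink; omega) rfl
    have a := a1.trans (a2.trans a3)
    unfold mate
    split_ifs with h
    · have a4 := hlow (t + 2) (t + 3) (by unfold LowLink; omega) rfl
      have a5 := hvert (t + 3) (by omega) (by unfold free; split_ifs <;> omega)
      exact a.trans (a4.trans a5.symm)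
    · have a5 := hvert (t + 2) (by omega) (by unfold free; split_ifs <;> omega)
      exact a.trans a5.symm
  · intro c hc
    by_cases hf : free P c = 1
    · exact ⟨c, hc, (hvert c hc hf).symm⟩
    · by_cases h1 : c % 3 = 1
      · have a2 := hlow (c - 1) c (by unfold LowLink; omega) (by omega)
        have a1 := hvert (c - 1) (by omega) (by unfold free; split_ifs <;> omega)
        exact ⟨c - 1, by omega, a2.symm.trans a1.symm⟩
      · have hlast : c + 2 = P := by
          unfold free at hf
          split_ifs at hf <;> omega
        have a2 := hlow c (c + 1) (by unfold LowLink; omega) rfl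
        have a1 := hvert (c + 1) (by omega) (by unfold free; split_ifs <;> omega)
        exact ⟨c + 1, by omega, a2.trans a1.symm⟩

/-- The connections in the path system before level `j`. -/
lemma reachable_paths {j m : ℕ} (hjm : j + m = k) :
    (∀ t, t % 3 = 0 → t + 1 < repunit (m + 2) →
      (paths k j).Reachable (city k (col j t) 0) (city k (col j (mate (repunit (m + 2)) t)) 0)) ∧
    (∀ v, v ≠ none → ∃ t < repunit (m + 2), (paths k j).Reachable v (city k (col j t) 0)) := by
  induction j generalizing m with
  | zero =>
    obtain rfl : m = k := by omega
    obtain ⟨h1, h2⟩ := reachable_paths_zero (k := m)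
    simp only [col_zero]
    refine ⟨h1, fun v hv => ?_⟩
    obtain ⟨c, hc, rfl | rfl⟩ := exists_city hv
    · exact ⟨c, hc, .refl _⟩
    · exact h2 c hc
  | succ j ih =>
    obtain ⟨ih1, ih2⟩ := ih (m := m + 1) (by omega)
    have hj : j ≤ k + 2 := by omega
    have hsub : k + 2 - j = m + 3 := by omega
    have hle : paths k j ≤ paths k (j + 1) := le_sup_left
    have hP : repunit (m + 3) % 9 = 4 := repunit_add_two_mod (m + 1)
    have hP' : 13 ≤ repunit (m + 3) := by
      rw [repunit_succ, repunit_succ, repunit_succ]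
      omega
    have hPP : repunit (m + 3) = 3 * repunit (m + 2) + 1 := repunit_succ (m + 2)
    have hl : ∀ t, Link (repunit (m + 3)) t → (paths k (j + 1)).Reachable (city k (col j t) 0)
        (city k (col j (t + 1)) 0) := by
      intro t ht
      rw [← hsub] at ht
      exact (linkGraph_reachable (g := fun t => city k (col j t) 0) (injOn_level hj)
        (fun _ h => h.1) ht).mono le_sup_right
    have hm : ∀ t, t % 3 = 0 → t + 1 < repunit (m + 3) → (paths k (j + 1)).Reachable
        (city k (col j t) 0) (city k (col j (mate (repunit (m + 3)) t)) 0) :=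
      fun t h3 ht => (ih1 t h3 ht).mono hle
    refine ⟨fun s h3 hs => ?_, fun v hv => ?_⟩
    · rw [col_succ, col_succ]
      exact reachable_mate_next (g := fun t => city k (col j t) 0) hP hPP hl hm h3 hs
    · obtain ⟨t, ht, hr⟩ := ih2 v hv
      obtain ⟨s, hs, hr'⟩ := exists_reachable_next (g := fun t => city k (col j t) 0) hP hP' hPP
        hl hm ht
      refine ⟨s, hs, (hr.mono hle).trans ?_⟩
      rw [col_succ]
      exact hr'

lemma free_pos (P t : ℕ) : 1 ≤ free P t := by
  unfold free
  split_ifs <;> omega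

lemma free_le_two (P t : ℕ) : free P t ≤ 2 := by
  unfold free
  split_ifs <;> omega

lemma deg_paths_none {j : ℕ} (hj : j ≤ k + 2) : deg (paths k j) none = 0 :=
  deg_eq_zero.2 (paths_not_adj_none j hj)

lemma deg_paths_le_two {j m : ℕ} (hjm : j + m = k) (v : Option (GridCity k)) :
    deg (paths k j) v ≤ 2 := by
  by_cases hv : v = none
  · rw [hv, deg_paths_none (by omega)]
    omega
  obtain ⟨h1, h2, h3⟩ := deg_paths hjm
  obtain ⟨c, hc, rfl | rfl⟩ := exists_city hv
  · by_cases h : ∃ t < repunit (m + 2), c = col j t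
    · obtain ⟨t, ht, rfl⟩ := h
      rw [h2 t ht]
      omega
    · push Not at h
      exact (h3 c hc h).le
  · exact (h1 c hc).le

lemma exists_end_paths (v : Option (GridCity k)) :
    ∃ w, (paths k k).Reachable v w ∧ deg (paths k k) w ≤ 1 := by
  by_cases hv : v = none
  · exact ⟨v, .refl _, by rw [hv, deg_paths_none (by omega)]; omega⟩
  obtain ⟨t, ht, hr⟩ := (reachable_paths (k := k) (j := k) (m := 0) rfl).2 v hv
  refine ⟨_, hr, ?_⟩
  rw [(deg_paths (k := k) (j := k) (m := 0) rfl).2.1 t ht]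
  have := free_pos (repunit (0 + 2)) t
  omega

/-- A pair of cities at distance less than `3 ^ k` is blocked by edges that are not longer. -/
lemma exists_blocked {u v : Option (GridCity k)} (huv : u ≠ v) (hu : u ≠ none) (hv : v ≠ none)
    (hlt : hubLength k s(u, v) < 3 ^ k) : ∃ a ∈ s(u, v),
      2 ≤ {w | (paths k k).Adj a w ∧ hubLength k s(a, w) ≤ hubLength k s(u, v)}.ncard := by
  obtain ⟨d, hd1, hd⟩ := exists_nat_hubLength hu hv huv
  -- The level with `3 ^ (j - 1) ≤ d < 3 ^ j`: edges of the paths before it have length at most `d`,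
  -- while its active positions are at least `3 ^ j` apart.
  set j := Nat.log 3 d + 1 with hj
  have hlow : 3 ^ (j - 1) ≤ d := Nat.pow_log_le_self 3 (by omega)
  have hhigh : d < 3 ^ j := Nat.lt_pow_succ_log_self (by norm_num) d
  have hjk : j ≤ k := by
    rw [hd] at hlt
    have h1 : d < 3 ^ k := by exact_mod_cast hlt
    have h2 : j - 1 < k := (Nat.pow_lt_pow_iff_right (by norm_num)).1 (hlow.trans_lt h1)
    omega
  obtain ⟨m, hm⟩ := Nat.exists_eq_add_of_le hjk
  obtain ⟨hd1', hd2', hd3'⟩ := deg_paths (k := k) hm.symm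
  have hsub : k + 2 - j = m + 2 := by omega
  have key : ∀ a, a ∈ s(u, v) → deg (paths k j) a = 2 → 2 ≤ {w | (paths k k).Adj a w ∧
      hubLength k s(a, w) ≤ hubLength k s(u, v)}.ncard := by
    intro a _ ha
    rw [← ha, deg]
    refine Set.ncard_le_ncard ?_ (Set.toFinite _)
    intro w hw
    have hw' : (paths k j).Adj a w := hw
    refine ⟨paths_mono k hjk hw', (hubLength_le_of_paths_adj (j := j) (by omega) hw').trans ?_⟩
    rw [hd]
    exact_mod_cast hlow
  by_contra hcon
  push Not at hcon
  -- An inactive city has degree two before level `j` and would block the pair; two different active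
  -- cities are too far apart.
  have hact : ∀ a ∈ s(u, v), a ≠ none → ∃ t < repunit (m + 2), a = city k (col j t) 0 := by
    intro a ha hne
    by_contra hno
    push Not at hno
    have h2 : deg (paths k j) a = 2 := by
      obtain ⟨c, hc, rfl | rfl⟩ := exists_city hne
      · exact hd3' c hc fun t ht h => hno t ht (h ▸ rfl)
      · exact hd1' c hc
    have := key a ha h2
    have := hcon a ha
    omega
  obtain ⟨s, hs, rfl⟩ := hact u (by simp) hu
  obtain ⟨t, ht, rfl⟩ := hact v (by simp) hv
  rw [← hsub] at hs ht
  rw [hubLength_city (col_lt (by omega) hs) (col_lt (by omega) ht)] at hd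
  have hd := Nat.cast_injective (R := ℝ) hd
  simp only [Fin.val_zero] at hd
  rcases lt_trichotomy s t with h | rfl | h
  · have := pow_le_col_sub (j := j) h
    omega
  · exact huv rfl
  · have := pow_le_col_sub (j := j) h
    omega

end Grid

/-! ### Counting edges by free ends and scales -/

section Counting

variable {V : Type*} [Fintype V]

lemma two_mul_card_edges (G : SimpleGraph V) :
    2 * (Set.toFinite G.edgeSet).toFinset.card = ∑ v, deg G v := by
  classical
  have h := sum_edges_sum_mem G fun _ => 1
  rw [Finset.sum_congr rfl fun e he => (?_ : _ = (2 : ℝ)), Finset.sum_const, nsmul_eq_mul] at h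
  · simp only [mul_one] at h
    rw [mul_comm]
    exact_mod_cast h
  · induction e with | _ a b
    rw [sum_mem_mk (SimpleGraph.Adj.ne ((Set.toFinite G.edgeSet).mem_toFinset.1 he))]
    norm_num

lemma sum_deg_add_sum_free [DecidableEq V] {x : V} {G : SimpleGraph V} (hx : deg G x = 0)
    (hdeg : ∀ v, deg G v ≤ 2) : ∑ v, deg G v + ∑ v ∈ Finset.univ.erase x, (2 - deg G v) =
      2 * (Fintype.card V - 1) := by
  rw [← Finset.add_sum_erase _ _ (Finset.mem_univ x), hx, zero_add, ← Finset.sum_add_distrib,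
    Finset.sum_congr rfl fun v _ => Nat.add_sub_of_le (hdeg v), Finset.sum_const,
    Finset.card_erase_of_mem (Finset.mem_univ x), Finset.card_univ, smul_eq_mul, mul_comm]

/-- A lower bound on a number in terms of the powers of three below it. -/
lemma sum_pow_three_le {d : ℕ} (hd : 1 ≤ d) (m : ℕ) :
    ∑ j ∈ Finset.range m, (if 3 ^ (j + 1) ≤ d then 2 * 3 ^ j else 0) + 1 ≤ d ∧
    ∑ j ∈ Finset.range m, (if 3 ^ (j + 1) ≤ d then 2 * 3 ^ j else 0) + 1 ≤ 3 ^ m := by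
  -- The second bound carries the induction: adding `2 * 3 ^ m` to at most `3 ^ m` stays within `3 ^
  -- (m + 1)`, which is at most `d` exactly when the term is present.
  induction m with
  | zero => simpa using hd
  | succ m ih =>
    rw [Finset.sum_range_succ]
    have h : 3 ^ (m + 1) = 3 * 3 ^ m := by ring
    split_ifs with h' <;> omega

end Counting

/-! ### The long output, the short tour, and the logarithmic bounds -/

section GridTour

variable {k : ℕ}

/-- A savings order on the grid instance in which, among pairs with equal savings, the edges of
`H` come first. -/
lemma exists_savingsOrder (H : SimpleGraph (Option (GridCity k))) :
    ∃ L, IsSavingsOrder (hubLength k) none L ∧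
      (∀ i j (hi : i < L.length) (hj : j < L.length), i < j →
        hubLength k L[i] ≤ hubLength k L[j]) ∧
      ∀ i j (hi : i < L.length) (hj : j < L.length), i < j → L[j] ∈ H.edgeSet →
        L[i] ∉ H.edgeSet → hubLength k L[i] < hubLength k L[j] := by
  classical
  obtain ⟨L, hnd, hmem, hsort⟩ := exists_sorted_list
    (Finset.univ.filter fun e : Sym2 (Option (GridCity k)) => ¬ e.IsDiag ∧ none ∉ e)
    -- A lexicographic key: distances are integers here, and the last bit puts edges of `H` first
    -- among ties.
    (fun e => 2 * ⌊hubLength k e⌋₊ + if e ∈ H.edgeSet then 0 else 1)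
  have hmem' : ∀ e, e ∈ L ↔ ¬ e.IsDiag ∧ none ∉ e := fun e => by simp [hmem]
  have hfloor : ∀ e ∈ L, (⌊hubLength k e⌋₊ : ℝ) = hubLength k e := by
    intro e he
    obtain ⟨h1, h2⟩ := (hmem' e).1 he
    induction e with | _ a b
    simp only [Sym2.mem_iff, not_or] at h2
    obtain ⟨d, -, hd⟩ := exists_nat_hubLength (Ne.symm h2.1) (Ne.symm h2.2) h1
    rw [hd, Nat.floor_natCast]
  have hkey : ∀ i j (hi : i < L.length) (hj : j < L.length), i < j →
      2 * ⌊hubLength k L[i]⌋₊ + (if L[i] ∈ H.edgeSet then 0 else 1) ≤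
        2 * ⌊hubLength k L[j]⌋₊ + if L[j] ∈ H.edgeSet then 0 else 1 :=
    List.pairwise_iff_getElem.1 hsort
  have hmono : ∀ i j (hi : i < L.length) (hj : j < L.length), i < j →
      hubLength k L[i] ≤ hubLength k L[j] := by
    intro i j hi hj hij
    rw [← hfloor _ (List.getElem_mem hi), ← hfloor _ (List.getElem_mem hj), Nat.cast_le]
    have := hkey i j hi hj hij
    split_ifs at this <;> omega
  refine ⟨L, ⟨hnd, hmem', List.pairwise_iff_getElem.2 fun i j hi hj hij => ?_⟩, hmono, ?_⟩
  · rw [savings_hubLength ((hmem' _).1 (List.getElem_mem hi)).2,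
      savings_hubLength ((hmem' _).1 (List.getElem_mem hj)).2]
    linarith [hmono i j hi hj hij]
  · intro i j hi hj hij h1 h2
    rw [← hfloor _ (List.getElem_mem hi), ← hfloor _ (List.getElem_mem hj), Nat.cast_lt]
    have := hkey i j hi hj hij
    rw [if_pos h1, if_neg h2] at this
    omega

/-- The active positions carry `4 * repunit (m + 1) + 2 = 2 * 3 ^ (m + 1)` free ends, which
corresponds to `3 ^ (m + 1)` paths on the `3 ^ (k + 2) - 1` grid points. Each path costs one edge
compared to the number of vertices. -/
lemma card_paths_le {j m : ℕ} (hjm : j + m = k) :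
    (Set.toFinite (paths k j).edgeSet).toFinset.card + 3 ^ (m + 1) + 1 ≤ 3 ^ (k + 2) := by
  have h1 := sum_deg_add_sum_free (deg_paths_none (k := k) (j := j) (by omega))
    (deg_paths_le_two hjm)
  have h2 := two_mul_card_edges (paths k j)
  have hsub : k + 2 - j = m + 2 := by omega
  have hinj : Set.InjOn (fun t => city k (col j t) 0) (Finset.range (repunit (m + 2))) := by
    have := injOn_level (k := k) (j := j) (by omega)
    rw [hsub] at this
    rwa [Finset.coe_range]
  have h3 : 4 * repunit (m + 1) + 2 ≤ ∑ v ∈ Finset.univ.erase none, (2 - deg (paths k j) v) := by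
    have hq : 1 ≤ repunit (m + 1) := by
      rw [repunit_succ]
      omega
    rw [← sum_free _ hq, ← repunit_succ,
      Finset.sum_congr rfl fun t ht => (?_ : _ = 2 - deg (paths k j) (city k (col j t) 0)),
      ← Finset.sum_image (f := fun v => 2 - deg (paths k j) v) hinj]
    · refine Finset.sum_le_sum_of_subset fun v hv => ?_
      obtain ⟨t, ht, rfl⟩ := Finset.mem_image.1 hv
      refine Finset.mem_erase.2 ⟨city_ne_none (col_lt (by omega) ?_) _, Finset.mem_univ _⟩
      rw [hsub]
      exact Finset.mem_range.1 ht
    · rw [(deg_paths hjm).2.1 t (Finset.mem_range.1 ht)]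
      have : free (repunit (m + 1 + 1)) t ≤ 2 := free_le_two _ t
      exact (Nat.sub_sub_self this).symm
  have h4 := two_mul_repunit_add_one (m + 1)
  have h5 : 1 ≤ 3 ^ (k + 2) := Nat.one_le_pow _ _ (by norm_num)
  rw [card_gridCity] at h1
  omega

/-- On the grid instance the heuristic can output a long tour. -/
lemma exists_long_output (k : ℕ) : ∃ E, IsOutput (hubLength k) none E ∧
    (2 * k + 17) * 3 ^ k - 1 ≤ length (hubLength k) E := by
  classical
  obtain ⟨L, hL, hmono, hfirst⟩ := exists_savingsOrder (paths k k)
  have hP : Proper none L := fun e he => (hL.2.1 e).1 he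
  set G := runGraph L L.length with hG
  have hS : IsPathSystem none G := isPathSystem_runGraph hP _
  have hcard : 3 ≤ Fintype.card (Option (GridCity k)) := by
    rw [card_gridCity, pow_succ]
    have : 1 ≤ 3 ^ (k + 1) := Nat.one_le_pow _ _ (by norm_num)
    omega
  have hfree := sum_free_eq_two hS (fun u v hu hv => reachable_final hL.2.1 hu hv) hcard
  have hadj : ∀ j ≤ k, ∀ a b, G.Adj a b → hubLength k s(a, b) < 3 ^ j → (paths k j).Adj a b := by
    intro j hj a b hab hlt
    have hlt' : hubLength k s(a, b) < 3 ^ k :=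
      hlt.trans_le (pow_le_pow_right₀ (by norm_num) hj)
    refine paths_adj_of_hubLength_lt (i := k) (by omega) ?_ hlt
    exact adj_of_runGraph_adj hL.1 hL.2.1 hmono hfirst (paths_not_adj_none k (by omega))
      (deg_paths_le_two (m := 0) rfl) exists_end_paths
      (fun a b h1 h2 h3 _ h5 => exists_blocked h1 h2 h3 h5) hab hlt'
  set A := (Set.toFinite G.edgeSet).toFinset with hA
  have hAcard : A.card + 2 = 3 ^ (k + 2) := by
    have h1 := sum_deg_add_sum_free (deg_eq_zero.2 hS.isolated) hS.deg_le
    have h2 : 2 * A.card = _ := two_mul_card_edges G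
    rw [card_gridCity] at h1 hcard
    omega
  -- Shorter output edges all belong to the paths before level `j + 1`, which have too few edges to
  -- make up the spanning path.
  have hlong : ∀ j < k, 3 ^ (k - j) ≤ (A.filter fun e => 3 ^ (j + 1) ≤ hubLength k e).card + 1 := by
    intro j hj
    obtain ⟨m, hm⟩ := Nat.exists_eq_add_of_le (show j + 1 ≤ k from hj)
    have h1 := card_paths_le hm.symm
    have h2 : (A.filter fun e => ¬ 3 ^ (j + 1) ≤ hubLength k e).card ≤
        (Set.toFinite (paths k (j + 1)).edgeSet).toFinset.card := by
      refine Finset.card_le_card fun e he => ?_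
      obtain ⟨he, hlt⟩ := Finset.mem_filter.1 he
      rw [hA, Set.Finite.mem_toFinset] at he
      rw [Set.Finite.mem_toFinset]
      induction e with | _ a b
      exact hadj (j + 1) hj a b he (not_le.1 hlt)
    have h3 := Finset.card_filter_add_card_filter_not (s := A)
      (fun e => 3 ^ (j + 1) ≤ hubLength k e)
    have h4 : k - j = m + 1 := by omega
    rw [h4]
    omega
  -- A layer decomposition of the length, with increments `3 ^ (j + 1) - 3 ^ j = 2 * 3 ^ j`; it
  -- turns the counts in `hlong` into a bound on the total.
  have hpoint : ∀ e ∈ A, 1 + ∑ j ∈ Finset.range k,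
      (if 3 ^ (j + 1) ≤ hubLength k e then 2 * (3 : ℝ) ^ j else 0) ≤ hubLength k e := by
    intro e he
    rw [hA, Set.Finite.mem_toFinset] at he
    induction e with | _ a b
    have he : G.Adj a b := he
    have ha : a ≠ none := fun h => hS.isolated b (h ▸ he)
    have hb : b ≠ none := fun h => hS.isolated a (h ▸ he.symm)
    obtain ⟨d, hd, hd'⟩ := exists_nat_hubLength ha hb he.ne
    have h := (sum_pow_three_le hd k).1
    rw [hd']
    have h' : ((∑ j ∈ Finset.range k, (if 3 ^ (j + 1) ≤ d then 2 * 3 ^ j else 0) + 1 : ℕ) : ℝ) ≤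
        d :=
      Nat.cast_le.2 h
    push_cast at h'
    rw [add_comm]
    refine le_trans (le_of_eq ?_) h'
    congr 1
    refine Finset.sum_congr rfl fun j _ => ?_
    have : (3 : ℝ) ^ (j + 1) ≤ d ↔ 3 ^ (j + 1) ≤ d := by exact_mod_cast Iff.rfl
    simp only [this]
  have hgeom : ∑ j ∈ Finset.range k, 2 * (3 : ℝ) ^ j * (3 ^ (k - j) - 1) =
      2 * k * 3 ^ k - (3 ^ k - 1) := by
    have h1 : ∑ j ∈ Finset.range k, (3 : ℝ) ^ j * 2 = 3 ^ k - 1 := by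
      rw [← Finset.sum_mul, ← geom_sum_mul]
      norm_num
    rw [← h1]
    have h2 : (2 * k * 3 ^ k : ℝ) = ∑ j ∈ Finset.range k, 2 * 3 ^ k := by
      rw [Finset.sum_const, Finset.card_range, nsmul_eq_mul]
      ring
    rw [h2, ← Finset.sum_sub_distrib]
    refine Finset.sum_congr rfl fun j hj => ?_
    have : (3 : ℝ) ^ k = 3 ^ j * 3 ^ (k - j) := by
      rw [← pow_add]
      congr 1
      have := Finset.mem_range.1 hj
      omega
    rw [this]
    ring
  have hedges : (3 ^ (k + 2) - 2) + (2 * k * 3 ^ k - (3 ^ k - 1)) ≤ ∑ e ∈ A, hubLength k e := by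
    refine le_trans ?_ (Finset.sum_le_sum hpoint)
    rw [Finset.sum_add_distrib, Finset.sum_const, nsmul_eq_mul, mul_one, Finset.sum_comm, ← hgeom]
    refine add_le_add ?_ (Finset.sum_le_sum fun j hj => ?_)
    · have : (A.card : ℝ) + 2 = 3 ^ (k + 2) := by exact_mod_cast hAcard
      linarith
    · rw [← Finset.sum_filter, Finset.sum_const, nsmul_eq_mul, mul_comm]
      refine mul_le_mul_of_nonneg_right ?_ (by positivity)
      have : (3 : ℝ) ^ (k - j) ≤ (A.filter fun e => 3 ^ (j + 1) ≤ hubLength k e).card + 1 := by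
        exact_mod_cast hlong j (Finset.mem_range.1 hj)
      linarith
  have hspokes : ∑ v ∈ Finset.univ.erase none, ((2 - deg G v : ℕ) : ℝ) * hubLength k s(v, none) =
      3 ^ (k + 2) := by
    rw [Finset.sum_congr rfl fun v hv => (?_ : _ = ((2 - deg G v : ℕ) : ℝ) * (3 ^ (k + 2) / 2)),
      ← Finset.sum_mul, ← Nat.cast_sum, hfree]
    · push_cast
      ring
    · obtain ⟨p, rfl⟩ := Option.ne_none_iff_exists'.1 (Finset.ne_of_mem_erase hv)
      rw [hubLength_none_right]
  refine ⟨_, ⟨L, hL, rfl⟩, ?_⟩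
  rw [foldl_step_start hP, length_tourOf, hspokes]
  have : (3 : ℝ) ^ (k + 2) = 9 * 3 ^ k := by ring
  rw [this] at hedges ⊢
  linarith

/-! ### A short tour -/

lemma length_pathEdges_le {V : Type*} {c : Sym2 V → ℝ} {x : V} {D : ℝ} (a : V) (l : List V)
    (hD : ∀ v ∈ a :: l, c s(v, x) ≤ D) (hl : (a :: l).IsChain fun u v => c s(u, v) ≤ 1) :
    length c (pathEdges (a :: l ++ [x]) : Multiset (Sym2 V)) ≤ l.length + D := by
  induction l generalizing a with
  | nil =>
    have := hD a (by simp)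
    simpa [pathEdges, length] using this
  | cons b l ih =>
    have h := ih b (fun v hv => hD v (List.mem_cons_of_mem a hv)) hl.tail
    have h1 : c s(a, b) ≤ 1 := hl.rel
    simp only [List.cons_append, pathEdges, length, Multiset.map_coe, List.map_cons,
      Multiset.sum_coe, List.sum_cons, List.length_cons, Nat.cast_add, Nat.cast_one] at h ⊢
    linarith

/-- The `i`-th city of the tour that goes along the upper row and back along the lower row. -/
def aroundCity (k i : ℕ) : Option (GridCity k) :=
  if i < repunit (k + 2) then city k i 0 else city k (2 * repunit (k + 2) - 1 - i) 1

/-- Around the grid there are `2 * N - 1` steps of length at most one, and the two hub edges add `3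
^ (k + 2) = 2 * N + 1`; the sum is below `2 * 3 ^ (k + 2)`. -/
lemma exists_short_tour (k : ℕ) : ∃ T, IsTour T ∧ length (hubLength k) T ≤ 18 * 3 ^ k := by
  set N := repunit (k + 2) with hN
  have hN4 : 4 ≤ N := by
    rw [hN, repunit_succ, repunit_succ]
    omega
  have hne : ∀ i < 2 * N, aroundCity k i ≠ none := by
    intro i hi
    unfold aroundCity
    split_ifs with h
    · exact city_ne_none h 0
    · exact city_ne_none (by omega) 1
  set l := (List.range (2 * N)).map (aroundCity k) with hl
  have hlen : l.length = 2 * N := by simp [hl]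
  have hmem : ∀ v, v ∈ none :: l := by
    intro v
    by_cases hv : v = none
    · simp [hv]
    · refine List.mem_cons_of_mem _ (List.mem_map.2 ?_)
      obtain ⟨c, hc, rfl | rfl⟩ := exists_city hv
      · exact ⟨c, List.mem_range.2 (by omega), if_pos hc⟩
      · refine ⟨2 * N - 1 - c, List.mem_range.2 (by omega), ?_⟩
        rw [aroundCity, if_neg (by omega)]
        congr 1
        omega
  have hnodup : (none :: l).Nodup := by
    refine List.nodup_cons.2 ⟨fun h => ?_, List.nodup_range.map_on ?_⟩
    · obtain ⟨i, hi, h⟩ := List.mem_map.1 h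
      exact hne i (List.mem_range.1 hi) h
    · intro i hi j hj h
      rw [List.mem_range] at hi hj
      unfold aroundCity at h
      split_ifs at h with h1 h2 h2
      · exact ((city_inj h1 h2).1 h).1
      · exact absurd ((city_inj h1 (by omega)).1 h).2 (by decide)
      · exact absurd ((city_inj (by omega) h2).1 h).2 (by decide)
      · have := ((city_inj (by omega) (by omega)).1 h).1
        omega
  have hchain : l.IsChain fun u v => hubLength k s(u, v) ≤ 1 := by
    rw [hl, List.isChain_map, List.isChain_range]
    intro i hi
    unfold aroundCity
    have hle : ∀ d : ℕ, d ≤ 1 → (d : ℝ) ≤ 1 := fun d hd => by exact_mod_cast hd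
    split_ifs with h1 h2 h2
    · rw [hubLength_city h1 h2]
      exact hle _ (by simp)
    · rw [hubLength_city h1 (by omega)]
      refine hle _ ?_
      simp only [Fin.val_zero, Fin.val_one]
      omega
    · omega
    · rw [hubLength_city (by omega) (by omega)]
      refine hle _ ?_
      simp only [Fin.val_one]
      omega
  refine ⟨_, isTour_of_list hnodup hmem (by omega), ?_⟩
  have hD : ∀ v ∈ l, hubLength k s(v, none) ≤ 3 ^ (k + 2) / 2 := by
    intro v hv
    obtain ⟨i, hi, rfl⟩ := List.mem_map.1 hv
    obtain ⟨p, hp⟩ := Option.ne_none_iff_exists'.1 (hne i (List.mem_range.1 hi))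
    rw [hp, hubLength_none_right]
  have hcard : (l.length : ℝ) + 1 = 3 ^ (k + 2) := by
    rw [hlen]
    exact_mod_cast two_mul_repunit_add_one (k + 2)
  match l, hlen, hchain, hD, hcard with
  | [], hlen, _, _, _ =>
    rw [List.length_nil] at hlen
    omega
  | a :: l, _, hchain, hD, hcard =>
    have h1 := length_pathEdges_le a l hD hchain
    have h2 := hD a (by simp)
    rw [Sym2.eq_swap] at h2
    have h3 : (3 : ℝ) ^ (k + 2) = 9 * 3 ^ k := by ring
    simp only [List.cons_append, pathEdges, length, Multiset.map_coe, List.map_cons,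
      Multiset.sum_coe, List.sum_cons, List.length_cons, Nat.cast_add, Nat.cast_one] at h1 hcard ⊢
    rw [h3] at h1 h2 hcard
    linarith

/-- The heuristic can be bad on the grid instance. -/
lemma exists_bad_output (k : ℕ) : ∃ E S, IsOutput (hubLength k) none E ∧ IsTour E ∧
    IsShortestTour (hubLength k) S ∧
    (k + 2) / 9 * length (hubLength k) S < length (hubLength k) E := by
  obtain ⟨E, hE, hlong⟩ := exists_long_output k
  obtain ⟨T, hT, hshort⟩ := exists_short_tour k
  obtain ⟨S, hS⟩ := exists_isShortestTour (hubLength k) hT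
  refine ⟨E, S, hE, isTour_of_isOutput hE ?_, hS, ?_⟩
  · rw [card_gridCity, pow_succ]
    have : 1 ≤ 3 ^ (k + 1) := Nat.one_le_pow _ _ (by norm_num)
    omega
  · have h1 : ((k : ℝ) + 2) / 9 * length (hubLength k) S ≤ (k + 2) / 9 * (18 * 3 ^ k) :=
      -- The right-hand side is `(2 * k + 4) * 3 ^ k`, well below the output bound `(2 * k + 17) * 3
      -- ^ k - 1`.
      mul_le_mul_of_nonneg_left ((hS.2 T hT).trans hshort) (by positivity)
    have h2 : (1 : ℝ) ≤ 3 ^ k := one_le_pow₀ (by norm_num)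
    nlinarith

lemma three_le_three_pow (k : ℕ) : 3 ≤ 3 ^ (k + 2) := by
  have : 1 ≤ 3 ^ k := Nat.one_le_pow _ _ (by norm_num)
  rw [pow_add]
  omega

lemma exceedsRatio_three_pow (k : ℕ) : ExceedsRatio (3 ^ (k + 2)) ((k + 2) / 9) := by
  obtain ⟨E, S, hE, -, hS, hlt⟩ := exists_bad_output k
  exact ⟨_, _, _, _, _, E, S, card_gridCity k, isMetric_hubLength k, hE, hS.1, hlt⟩

lemma lt_ratio_of_three_pow_le {k n : ℕ} (hn : 3 ^ (k + 2) ≤ n) : ((k : ℝ) + 2) / 9 < ratio n :=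
  ((exceedsRatio_three_pow k).mono (three_le_three_pow k) hn).lt_ratio (by positivity)
    ((three_le_three_pow k).trans hn)

lemma one_le_log_three : 1 ≤ Real.log 3 := by
  linarith [Real.log_three_gt_d9]

lemma ratio_le_log {n : ℕ} (hn : 3 ≤ n) : ratio n ≤ 10 * Real.log n := by
  have h1 := ratio_le_harmonic hn
  have h2 := harmonic_le_one_add_log n
  have h3 : Real.log 3 ≤ Real.log n := Real.log_le_log (by norm_num) (by exact_mod_cast hn)
  linarith [one_le_log_three]

lemma log_le_ratio {n : ℕ} (hn : 9 ≤ n) : Real.log n ≤ 27 * ratio n := by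
  -- Here `3 ^ (k + 2) ≤ n < 3 ^ (k + 3)`. The constant 27 suffices because `log 3 < 2` and `2 * (k
  -- + 3) ≤ 3 * (k + 2)`.
  obtain ⟨k, hk⟩ := Nat.exists_eq_add_of_le (show 2 ≤ Nat.log 3 n from
    (Nat.le_log_iff_pow_le (by norm_num) (by omega)).2 hn)
  have h1 : 3 ^ (k + 2) ≤ n := by
    rw [add_comm, ← hk]
    exact Nat.pow_log_le_self 3 (by omega)
  have h2 : n < 3 ^ (k + 3) := by
    have := Nat.lt_pow_succ_log_self (b := 3) (by norm_num) n
    rwa [hk, show (2 + k).succ = k + 3 by omega] at this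
  have h3 := lt_ratio_of_three_pow_le h1
  have h4 : Real.log n ≤ (k + 3) * Real.log 3 := by
    have : Real.log n ≤ Real.log ((3 : ℝ) ^ (k + 3)) :=
      Real.log_le_log (by positivity) (by exact_mod_cast h2.le)
    rw [Real.log_pow] at this
    exact_mod_cast this
  have h5 : ((k : ℝ) + 3) * Real.log 3 ≤ (k + 3) * 2 :=
    mul_le_mul_of_nonneg_left (by linarith [Real.log_three_lt_d9]) (by positivity)
  have h6 : (0 : ℝ) ≤ k := Nat.cast_nonneg k
  linarith

lemma isTheta_ratio : (fun n : ℕ => ratio n) =Θ[atTop] (fun n : ℕ => Real.log n) := by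
  have hlog : ∀ n : ℕ, 0 ≤ Real.log n := fun n => Real.log_natCast_nonneg n
  constructor
  · refine IsBigO.of_bound 10 ?_
    filter_upwards [eventually_ge_atTop 9] with n hn
    have h1 := log_le_ratio hn
    rw [Real.norm_of_nonneg (hlog n), Real.norm_of_nonneg (by linarith [hlog n])]
    exact ratio_le_log (by omega)
  · refine IsBigO.of_bound 27 ?_
    filter_upwards [eventually_ge_atTop 9] with n hn
    have h1 := log_le_ratio hn
    rw [Real.norm_of_nonneg (hlog n), Real.norm_of_nonneg (by linarith [hlog n])]
    exact h1

lemma logb_three_pow (k : ℕ) : 1 / 9 * Real.logb 3 ((3 ^ (k + 2) : ℕ) : ℝ) = (k + 2) / 9 := by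
  rw [Nat.cast_pow, Nat.cast_ofNat, Real.logb_pow, Real.logb_self_eq_one (by norm_num)]
  push_cast
  ring

end GridTour

end SavingsTSP

theorem theorem3 :
    -- for `n ≥ 3` there is a least guaranteed factor (so `ratio n` is finite and attained)
    (∀ n : ℕ, 3 ≤ n → IsLeast {r : ℝ | SavingsTSP.Guaranteed n r} (SavingsTSP.ratio n)) ∧
    -- it is of order `log n`
    (fun n : ℕ => SavingsTSP.ratio n) =Θ[atTop] (fun n : ℕ => Real.log n) ∧
    -- explicit lower bound for `n = 3 ^ (k + 2)`
    (∀ k : ℕ, 1 / 9 * Real.logb 3 ((3 ^ (k + 2) : ℕ) : ℝ) < SavingsTSP.ratio (3 ^ (k + 2))) ∧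
    -- which is witnessed by the grid with an additional city
    (∀ k : ℕ,
      Fintype.card (Option (SavingsTSP.GridCity k)) = 3 ^ (k + 2) ∧
      SavingsTSP.IsMetric (SavingsTSP.hubLength k) ∧
      ∃ E S, SavingsTSP.IsOutput (SavingsTSP.hubLength k) none E ∧
        SavingsTSP.IsTour E ∧
        SavingsTSP.IsShortestTour (SavingsTSP.hubLength k) S ∧
        1 / 9 * Real.logb 3 ((3 ^ (k + 2) : ℕ) : ℝ) * SavingsTSP.length (SavingsTSP.hubLength k) S
          < SavingsTSP.length (SavingsTSP.hubLength k) E) := by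
  refine ⟨fun n hn => SavingsTSP.isLeast_ratio hn, SavingsTSP.isTheta_ratio, fun k => ?_,
    fun k => ⟨SavingsTSP.card_gridCity k, SavingsTSP.isMetric_hubLength k, ?_⟩⟩
  · rw [SavingsTSP.logb_three_pow]
    exact SavingsTSP.lt_ratio_of_three_pow_le le_rfl
  · rw [SavingsTSP.logb_three_pow]
    exact SavingsTSP.exists_bad_output k
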